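/- **Setting.** Let $d\ge 1$, $p\in(1,2]$, $L,\sigma>0$, $x_0\in\mathbb R^d$, let $\xi\sim\mathbb P$, let $F(x;\xi)$ be jointly measurable and integrable in $\xi$ for every $x$, and let $f(x)=\mathbb E_\xi F(x;\xi)$. Assume that $f_*=\inf f>-\infty$; that for $\mathbb P$-a.e. $\xi$ the map $F(\cdot;\xi)$ is differentiable with $L$-Lipschitz gradient; that $\mathbb P(\|\nabla F(x;\xi)-\nabla f(x)\|>t)\le(\sigma/t)^p$ for all $x$ and all $t>0$; and that $\mathbb E\|\nabla F(x;\xi)\|<\infty$ for some $x$. For $\mu>0$ put $\Delta_0=f(x_0)-f_*$, $\bar\Delta_0=\Delta_0+L\mu^2/2$, $S_\mu=(\sqrt{L\bar\Delta_0}+\sigma)/\sqrt d+L\mu$, $R_\mu=dS_\mu$, $H_\mu=\sqrt{2L\Delta_0}+L\mu$. For $\psi_\tau(z)=z\min\{1,\tau/|z|\}$ and independent samples $(u_\ell,\xi_\ell)\sim\mathrm{Unif}(\mathbb S^{d-1})\otimes\mathbb P$ let $$G_\mu(x;M,\tau)=\frac dM\sum_{\ell=1}^M\psi_\tau\Big(\frac{F(x+\mu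 u_\ell;\xi_\ell)-F(x-\mu u_\ell;\xi_\ell)}{2\mu}\Big)u_\ell .$$ Momentum RSC-ZO sets $m_0=g_0=G_\mu(x_0;M_0,\tau_0)$, $x_1=x_0-\alpha m_0$ and, for $t\ge1$, with fresh samples, $g_t=G_\mu(x_t;M,\tau)$, $m_t=\beta m_{t-1}+(1-\beta)g_t$, $x_{t+1}=x_t-\alpha m_t$. Let $\beta\in[1/2,1)$, $\delta\in(0,1]$, $M_0,M,T\in\mathbb N$, $\lambda=\log(2T/\delta)$, $\lambda_0=\log(2/\delta)$, $\tau=8S_\mu(M/((1-\beta)\lambda))^{1/p}$, $\tau_0=8S_\mu(M_0/\lambda_0)^{1/p}$. Call the batches *admissible* if $M_0\ge\lambda_0$ and $M\ge(1-\beta)\lambda$. With $q=(1-\beta)\lambda/M$, $q_0=\lambda_0/M_0$ and constants $C_U,C_B,C_G$ put $$U=C_UdS_\mu q^{\frac{p-1}p}\sqrt{1+\log\tfrac1q},\quad B=C_BdS_\mu q^{\frac{p-1}p},\quad G=C_GdS_\mu q_0^{\frac{p-1}p}\sqrt{1+\log\tfrac1{q_0}} .$$ Let $\ell_p(r)=(1+\max\{0,\log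 r\})^{p/(2(p-1))}$. **Theorem.** There are absolute constants $c_0,c_1,C_Q>0$ and constants $C_U,C_B,C_G,K,C_p>0$ depending only on $p$ such that, for all data as above, the following hold. (1) If the batches are admissible, $T\ge4$, $0<\alpha\le\min\{\frac1{4L},\frac{1-\beta}{4\sqrt3\,\beta L}\}$, $\frac{5\alpha}4G^2+\frac{2\alpha}{1-\beta}\big(\beta((1+L\alpha)G+L\alpha H_\mu)+(1-\beta)B\big)^2\le\bar\Delta_0$ and $(T-1)\alpha(U^2+4B^2)\le\bar\Delta_0$, then with probability at least $1-\delta$ both $f(x_t)-f_*\le4\bar\Delta_0$ for $1\le t\le T-1$ and $$\frac1{T-2}\sum_{t=1}^{T-2}\|\nabla f(x_t)\|^2\le\frac{8\bar\Delta_0}{\alpha(T-2)}+4U^2+16B^2+2L^2\mu^2 .$$ For (2)–(4) let $\epsilon\in(0,1)$, $\mu\le\epsilon/(4Ld)$, $\epsilon^2\le32L\bar\Delta_0$, $\alpha=\frac{1-\beta}{16\sqrt3\,L}$, $T=\big\lceil512\sqrt3\,\frac{L\bar\Delta_0}{(1-\beta)\epsilon^2}\big\rceil+2$, and $$N_0=\Big(\frac{R_\mu}\epsilon\Big)^{\frac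 p{p-1}}\lambda_0\,\ell_p\Big(\frac{R_\mu}\epsilon\Big),\qquad N=(1-\beta)\Big(\frac{R_\mu}\epsilon\Big)^{\frac p{p-1}}\lambda\,\ell_p\Big(\frac{R_\mu}\epsilon\Big).$$ (2) If the batches are admissible and $G\le c_0\epsilon$, $U\le c_1\epsilon$, $B\le c_1\epsilon$, then with probability at least $1-\delta$, $\frac1{T-2}\sum_{t=1}^{T-2}\|\nabla f(x_t)\|^2\le\epsilon^2$. (3) It is enough to take batches of order $M_0=\widetilde\Theta((R_\mu/\epsilon)^{p/(p-1)})$, $M=\widetilde\Theta((1-\beta)(R_\mu/\epsilon)^{p/(p-1)})$: if $M_0\ge KN_0$ and $M\ge KN$, then the hypotheses of (2), and hence its conclusion, hold. (4) Computing $x_T$ takes exactly $Q=2M_0+2M(T-1)$ evaluations of $F$. One has $|\bar\Delta_0-\Delta_0|\le C_Q\,\epsilon^2/(Ld^2)$ and $|R_\mu-\sqrt d(\sqrt{L\Delta_0}+\sigma)|\le C_Q\,\epsilon$. If $M_0\le\kappa N_0$ and $M\le\kappa N$ for some $\kappa$, then $$Q\le C_Q\,\kappa\Big[\Big(\frac{R_\mu}\epsilon\Big)^{\frac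 p{p-1}}\lambda_0\,\ell_p\Big(\frac{R_\mu}\epsilon\Big)+\frac{L\bar\Delta_0}{\epsilon^2}\Big(\frac{R_\mu}\epsilon\Big)^{\frac p{p-1}}\lambda\,\ell_p\Big(\frac{R_\mu}\epsilon\Big)\Big],$$ so that, up to logarithmic factors and the warm start, the total does not depend on $\beta$ while the running batch carries the factor $1-\beta$. If moreover $d\ge2$ or $\epsilon^2\le32L\Delta_0$, then with $A=\sqrt d(\sqrt{L\Delta_0}+\sigma)/\epsilon$, $$Q\le C_p\,\kappa\Big[A^{\frac p{p-1}}\lambda_0\,\ell_p(A)+\frac{L\Delta_0}{\epsilon^2}A^{\frac p{p-1}}\lambda\,\ell_p(A)\Big].$$ -/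

import Mathlib

open MeasureTheory ProbabilityTheory

noncomputable section

/-- The data of a stochastic zeroth-order problem on `ℝ^d`: a sample function `F(x; ξ)`, the law `P`
of `ξ`, the smoothness constant `L`, the noise parameters `σ` and `p`, and the initial point. -/
structure ZOProblem (d : ℕ) (Ξ : Type*) [MeasurableSpace Ξ] where
  F : EuclideanSpace ℝ (Fin d) → Ξ → ℝ
  P : Measure Ξ
  L : ℝ
  σ : ℝ
  p : ℝ
  x₀ : EuclideanSpace ℝ (Fin d)

/-- Parameters of the momentum method (the clipping levels are functions of them): smoothing `μ`,
momentum `β`, stepsize `α`, failure probability `δ`, warm-start batch size `M₀`, running batch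
size `M`, horizon `T`. -/
structure MomentumParams where
  μ : ℝ
  β : ℝ
  α : ℝ
  δ : ℝ
  M₀ : ℕ
  M : ℕ
  T : ℕ

/-- The uniform probability measure on the unit sphere of `ℝ^d`, as a measure on `ℝ^d`. -/
def unifSphere (d : ℕ) : Measure (EuclideanSpace ℝ (Fin d)) :=
  (((volume : Measure (EuclideanSpace ℝ (Fin d))).toSphere Set.univ)⁻¹ •
    (volume : Measure (EuclideanSpace ℝ (Fin d))).toSphere).map Subtype.val

/-- Scalar clipping `ψ_τ(z) = z min{1, τ / |z|}` (which is `0` at `z = 0`). -/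
def clip (τ z : ℝ) : ℝ := z * min 1 (τ / |z|)

/-- The polylogarithmic factor `(1 + max(0, log r))^(p / (2 (p - 1)))`. -/
def logFactor (p r : ℝ) : ℝ := (1 + max 0 (Real.log r)) ^ (p / (2 * (p - 1)))

/-- The state of the momentum method after batch `t`: the iterate `x_{t+1}`, the momentum `m_t`,
and the number of stochastic function evaluations made so far. -/
structure IterState (d : ℕ) where
  x : EuclideanSpace ℝ (Fin d)
  m : EuclideanSpace ℝ (Fin d)
  queries : ℕ

namespace MomentumParams

/-- `λ = log (2T / δ)`. -/
def lam (pr : MomentumParams) : ℝ := Real.log (2 * pr.T / pr.δ)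

/-- `λ₀ = log (2 / δ)`. -/
def lam₀ (pr : MomentumParams) : ℝ := Real.log (2 / pr.δ)

/-- Basic ranges of the parameters. -/
structure Valid (pr : MomentumParams) : Prop where
  μ_pos : 0 < pr.μ
  half_le_β : 1 / 2 ≤ pr.β
  β_lt_one : pr.β < 1
  δ_pos : 0 < pr.δ
  δ_le_one : pr.δ ≤ 1

/-- The lower constraints `M₀ ≥ λ₀` and `M ≥ (1 - β) λ`. -/
structure BatchOK (pr : MomentumParams) : Prop where
  warm : pr.lam₀ ≤ pr.M₀
  running : (1 - pr.β) * pr.lam ≤ pr.M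

end MomentumParams

namespace ZOProblem

variable {d : ℕ} {Ξ : Type*} [MeasurableSpace Ξ]

/-! ### The problem -/

/-- The objective `f(x) = E_ξ F(x; ξ)`. -/
def f (pb : ZOProblem d Ξ) (x : EuclideanSpace ℝ (Fin d)) : ℝ := ∫ ξ, pb.F x ξ ∂pb.P

/-- `f_* = inf f`. -/
def fStar (pb : ZOProblem d Ξ) : ℝ := ⨅ x, pb.f x

/-- The sample gradient `∇F(x; ξ)`, with respect to `x`. -/
def sampleGrad (pb : ZOProblem d Ξ) (x : EuclideanSpace ℝ (Fin d)) (ξ : Ξ) :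
    EuclideanSpace ℝ (Fin d) :=
  gradient (fun z => pb.F z ξ) x

/-- Standing assumptions: `f` is well defined and bounded below, the sample functions are almost
surely `L`-smooth, the sample gradient noise has weak-`L_p` tails uniformly in `x`, and the sample
gradient is integrable at some point. -/
structure Assumptions (pb : ZOProblem d Ξ) : Prop where
  d_pos : 1 ≤ d
  prob : IsProbabilityMeasure pb.P
  L_pos : 0 < pb.L
  σ_pos : 0 < pb.σ
  one_lt_p : 1 < pb.p
  p_le_two : pb.p ≤ 2
  measurable_F : Measurable (Function.uncurry pb.F)
  integrable_F : ∀ x, Integrable (pb.F x) pb.P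
  bddBelow : BddBelow (Set.range pb.f)
  smooth : ∀ᵐ ξ ∂pb.P, Differentiable ℝ (fun x => pb.F x ξ) ∧
    ∀ x y, ‖pb.sampleGrad x ξ - pb.sampleGrad y ξ‖ ≤ pb.L * ‖x - y‖
  weak_noise : ∀ x, ∀ t : ℝ, 0 < t →
    pb.P.real {ξ | t < ‖pb.sampleGrad x ξ - gradient pb.f x‖} ≤ (pb.σ / t) ^ pb.p
  integrable_grad : ∃ x, Integrable (pb.sampleGrad x) pb.P

/-! ### The algorithm, with a count of the stochastic function evaluations -/

/-- One evaluation of `F(z; ξ)`: its value, and its cost `1`. -/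
def query (pb : ZOProblem d Ξ) (z : EuclideanSpace ℝ (Fin d)) (ξ : Ξ) : ℝ × ℕ := (pb.F z ξ, 1)

/-- The two-point directional derivative `Y(x) = (F(x + μu; ξ) - F(x - μu; ξ)) / (2μ)` for a sample
`(u, ξ)`, and its cost. -/
def twoPoint (pb : ZOProblem d Ξ) (μ : ℝ) (s : EuclideanSpace ℝ (Fin d) × Ξ)
    (x : EuclideanSpace ℝ (Fin d)) : ℝ × ℕ :=
  (((pb.query (x + μ • s.1) s.2).1 - (pb.query (x - μ • s.1) s.2).1) / (2 * μ),
    (pb.query (x + μ • s.1) s.2).2 + (pb.query (x - μ • s.1) s.2).2)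

/-- The clipped estimator `G_μ(x; M, τ) = (d / M) ∑_ℓ ψ_τ(Y_ℓ(x)) u_ℓ` on a batch of `M` samples
`(u_ℓ, ξ_ℓ)`, and its cost. -/
def estimator (pb : ZOProblem d Ξ) (μ τ : ℝ) {M : ℕ} (s : Fin M → EuclideanSpace ℝ (Fin d) × Ξ)
    (x : EuclideanSpace ℝ (Fin d)) : EuclideanSpace ℝ (Fin d) × ℕ :=
  (((d : ℝ) / M) • ∑ l, clip τ (pb.twoPoint μ (s l) x).1 • (s l).1,
    ∑ l, (pb.twoPoint μ (s l) x).2)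

/-- The momentum method, run on a warm-start batch `s₀` and running batches `s t`, `t ≥ 1`. -/
def run (pb : ZOProblem d Ξ) (μ α β τ₀ τ : ℝ) {M₀ M : ℕ}
    (s₀ : Fin M₀ → EuclideanSpace ℝ (Fin d) × Ξ)
    (s : ℕ → Fin M → EuclideanSpace ℝ (Fin d) × Ξ) : ℕ → IterState d
  | 0 =>
    let g := pb.estimator μ τ₀ s₀ pb.x₀
    { x := pb.x₀ - α • g.1
      m := g.1
      queries := g.2 }
  | t + 1 =>
    let st := run pb μ α β τ₀ τ s₀ s t
    let g := pb.estimator μ τ (s (t + 1)) st.x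
    let m := β • st.m + (1 - β) • g.1
    { x := st.x - α • m
      m := m
      queries := st.queries + g.2 }

/-! ### Scales, clipping levels and error levels -/

/-- `Δ₀ = f(x₀) - f_*`. -/
def gap (pb : ZOProblem d Ξ) : ℝ := pb.f pb.x₀ - pb.fStar

/-- `Δ̄₀ = Δ₀ + L μ² / 2`. -/
def gapBar (pb : ZOProblem d Ξ) (μ : ℝ) : ℝ := pb.gap + pb.L * μ ^ 2 / 2

/-- `S_μ = (√(L Δ̄₀) + σ) / √d + L μ`. -/
def S (pb : ZOProblem d Ξ) (μ : ℝ) : ℝ :=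
  (Real.sqrt (pb.L * pb.gapBar μ) + pb.σ) / Real.sqrt d + pb.L * μ

/-- `R_μ = d S_μ`. -/
def R (pb : ZOProblem d Ξ) (μ : ℝ) : ℝ := d * pb.S μ

/-- The running clipping level `τ = 8 S_μ (M / ((1 - β) λ))^(1/p)`. -/
def tau (pb : ZOProblem d Ξ) (pr : MomentumParams) : ℝ :=
  8 * pb.S pr.μ * (pr.M / ((1 - pr.β) * pr.lam)) ^ (1 / pb.p)

/-- The warm-start clipping level `τ₀ = 8 S_μ (M₀ / λ₀)^(1/p)`. -/
def tau₀ (pb : ZOProblem d Ξ) (pr : MomentumParams) : ℝ :=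
  8 * pb.S pr.μ * (pr.M₀ / pr.lam₀) ^ (1 / pb.p)

/-- `U = C_U d S_μ q^((p-1)/p) √(1 + log (M / ((1 - β) λ)))` with `q = (1 - β) λ / M`. -/
def U (pb : ZOProblem d Ξ) (pr : MomentumParams) (C : ℝ) : ℝ :=
  C * d * pb.S pr.μ * ((1 - pr.β) * pr.lam / pr.M) ^ ((pb.p - 1) / pb.p) *
    Real.sqrt (1 + Real.log (pr.M / ((1 - pr.β) * pr.lam)))

/-- `B = C_B d S_μ q^((p-1)/p)` with `q = (1 - β) λ / M`. -/
def B (pb : ZOProblem d Ξ) (pr : MomentumParams) (C : ℝ) : ℝ :=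
  C * d * pb.S pr.μ * ((1 - pr.β) * pr.lam / pr.M) ^ ((pb.p - 1) / pb.p)

/-- `G = C_G d S_μ q₀^((p-1)/p) √(1 + log (M₀ / λ₀))` with `q₀ = λ₀ / M₀`. -/
def G (pb : ZOProblem d Ξ) (pr : MomentumParams) (C : ℝ) : ℝ :=
  C * d * pb.S pr.μ * (pr.lam₀ / pr.M₀) ^ ((pb.p - 1) / pb.p) *
    Real.sqrt (1 + Real.log (pr.M₀ / pr.lam₀))

/-- `H_μ = √(2 L Δ₀) + L μ`. -/
def H (pb : ZOProblem d Ξ) (μ : ℝ) : ℝ := Real.sqrt (2 * pb.L * pb.gap) + pb.L * μ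

/-- The warm-start batch scale: `(R_μ / ε)^(p/(p-1))` times the logarithmic factors. -/
def batchScale₀ (pb : ZOProblem d Ξ) (pr : MomentumParams) (ε : ℝ) : ℝ :=
  (pb.R pr.μ / ε) ^ (pb.p / (pb.p - 1)) * (pr.lam₀ * logFactor pb.p (pb.R pr.μ / ε))

/-- The running batch scale: `(1 - β) (R_μ / ε)^(p/(p-1))` times the logarithmic factors. -/
def batchScale (pb : ZOProblem d Ξ) (pr : MomentumParams) (ε : ℝ) : ℝ :=
  (1 - pr.β) * (pb.R pr.μ / ε) ^ (pb.p / (pb.p - 1)) *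
    (pr.lam * logFactor pb.p (pb.R pr.μ / ε))

/-- The accuracy regime and the choice of `μ`, `α` and `T`. -/
structure Tuned (pb : ZOProblem d Ξ) (pr : MomentumParams) (ε : ℝ) : Prop where
  ε_pos : 0 < ε
  ε_lt_one : ε < 1
  μ_le : pr.μ ≤ ε / (4 * pb.L * d)
  ε_le : ε ^ 2 ≤ 32 * pb.L * pb.gapBar pr.μ
  α_eq : pr.α = (1 - pr.β) / (16 * Real.sqrt 3 * pb.L)
  T_eq : pr.T = ⌈512 * Real.sqrt 3 * (pb.L * pb.gapBar pr.μ / ((1 - pr.β) * ε ^ 2))⌉₊ + 2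

/-! ### The random run -/

/-- The random samples `(u, ξ)` of all batches, on a probability space `(Ω, Pr)`: index `Sum.inl l`
is warm-start sample `l`, index `Sum.inr (t, l)` is sample `l` of running batch `t ≥ 1`. They are
independent, with law `Unif(sphere) ⊗ P`. -/
structure IsSampling (pb : ZOProblem d Ξ) (pr : MomentumParams) {Ω : Type*} [MeasurableSpace Ω]
    (Pr : Measure Ω)
    (s : Fin pr.M₀ ⊕ (ℕ × Fin pr.M) → Ω → EuclideanSpace ℝ (Fin d) × Ξ) : Prop where
  measurable : ∀ i, Measurable (s i)
  law : ∀ i, Pr.map (s i) = (unifSphere d).prod pb.P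
  indep : iIndepFun s Pr

/-- The state after batch `t` of the run of the method on the sample point `ω`. -/
def state (pb : ZOProblem d Ξ) (pr : MomentumParams) {Ω : Type*}
    (s : Fin pr.M₀ ⊕ (ℕ × Fin pr.M) → Ω → EuclideanSpace ℝ (Fin d) × Ξ) (ω : Ω) (t : ℕ) :
    IterState d :=
  pb.run pr.μ pr.α pr.β (pb.tau₀ pr) (pb.tau pr)
    (fun l => s (Sum.inl l) ω) (fun t l => s (Sum.inr (t, l)) ω) t

/-- The iterates `x_0, x_1, …`. -/
def iterate (pb : ZOProblem d Ξ) (pr : MomentumParams) {Ω : Type*}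
    (s : Fin pr.M₀ ⊕ (ℕ × Fin pr.M) → Ω → EuclideanSpace ℝ (Fin d) × Ξ) (ω : Ω) :
    ℕ → EuclideanSpace ℝ (Fin d)
  | 0 => pb.x₀
  | t + 1 => (pb.state pr s ω t).x

/-- `(1 / (T - 2)) ∑_{t=1}^{T-2} ‖∇f(x_t)‖²`. -/
def avgGradSq (pb : ZOProblem d Ξ) (pr : MomentumParams) {Ω : Type*}
    (s : Fin pr.M₀ ⊕ (ℕ × Fin pr.M) → Ω → EuclideanSpace ℝ (Fin d) × Ξ) (ω : Ω) : ℝ :=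
  1 / ((pr.T : ℝ) - 2) *
    ∑ t ∈ Finset.Icc 1 (pr.T - 2), ‖gradient pb.f (pb.iterate pr s ω t)‖ ^ 2

end ZOProblem

end

/-! The method is gradient descent with momentum on the average of `f` over balls of radius `μ`
(`ballAverage`), whose gradient `ballGradient` is the mean of the unclipped two-point estimator
(`ballGradient_eq`, from the divergence theorem on the ball). The average is again `L`-smooth, with
values within `L μ² / 2` of `f` and gradient within `L μ` of the gradient of `f`.

Tails. Testing a weak-`L_p` vector against a uniform direction divides its scale by `√d`
(`measure_abs_inner_le`), so while `f - f_*` is at most four times the enlarged gap the slope has a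
weak tail at scale `S_μ`. Clipping at `8 S_μ y^(1/p)` then leaves a bias of order `S_μ y^(-(p-1)/p)`
and a second moment of order `S_μ² y^((2-p)/p) (1 + log y)`. The logarithm is the price of a weak
tail at `p = 2`.

Concentration. The mean of `cosh ‖·‖` grows by a factor of at most `exp v` when a fresh centred
increment of norm at most `1` and second moment at most `v` is added (`lintegral_cosh_norm_add_le`).
This Bernstein bound does not depend on the dimension. It applies to the exponentially weighted
noise with weights `(1 - β) β^k`, whose maximum and sum of squares are both at most `1 - β`. Hence a
running batch smaller by the factor `1 - β` has the same effect. The noise is set to zero outside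
the sublevel region, so its moment bounds hold unconditionally although the iterates are random.

Descent. With `N` the weighted noise, the residual `r = m - k(x) - N` obeys a contraction driven by
drift and bias alone. The potential `φ(x) + α / (1 - β) ‖r‖²` therefore decreases up to errors `U`
and `B` (`momentum_descent`). The initial smoothed gap, the warm start and the accumulated noise
each cost at most one enlarged gap. Induction on time thus keeps the iterates in the region on the
event where all localized noises are small, and a union bound controls that event.

Cost. The horizon carries `1 / (1 - β)` and the running batch `1 - β`, so the product is free of
`β`. The exponent in `logFactor` is the one that cancels the square root of the logarithm in `U` and
`G` (`exists_batch_constant`). -/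

noncomputable section

/-! ### Functions with Lipschitz gradient. -/

section Smooth

variable {E : Type*} [NormedAddCommGroup E] [InnerProductSpace ℝ E] [CompleteSpace E]

/-- The quadratic bound for a function with Lipschitz gradient. -/
theorem abs_sub_sub_inner_gradient_le {f : E → ℝ} {L : ℝ} (hf : Differentiable ℝ f)
    (hL : ∀ x y, ‖gradient f x - gradient f y‖ ≤ L * ‖x - y‖) (x y : E) :
    |f y - f x - inner ℝ (gradient f x) (y - x)| ≤ L / 2 * ‖y - x‖ ^ 2 := by
  set v := y - x with hv
  let g : ℝ → ℝ := fun t => f (x + t • v) - f x - t * inner ℝ (gradient f x) v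
  have hg : ∀ t, HasDerivAt g (inner ℝ (gradient f (x + t • v)) v
      - inner ℝ (gradient f x) v) t := by
    intro t
    have h1 : HasDerivAt (fun t : ℝ => x + t • v) v t := by
      simpa using ((hasDerivAt_id t).smul_const v).const_add x
    have h2 := ((hf (x + t • v)).hasGradientAt.hasFDerivAt).comp_hasDerivAt t h1
    have h3 := (h2.sub_const (f x)).sub
      ((hasDerivAt_id t).mul_const (inner ℝ (gradient f x) v))
    refine HasDerivAt.congr_deriv (f := g) h3 ?_
    rw [one_mul]; rfl
  -- The remainder along the segment starts at `0` and its slope at `t` is at most `L ‖v‖² t`, so it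
  -- stays below the primitive of that bound.
  have key := image_norm_le_of_norm_deriv_right_le_deriv_boundary (a := (0 : ℝ)) (b := 1)
    (f := g) (f' := fun t => inner ℝ (gradient f (x + t • v)) v - inner ℝ (gradient f x) v)
    (B := fun t => L / 2 * ‖v‖ ^ 2 * t ^ 2) (B' := fun t => L * ‖v‖ ^ 2 * t)
    (fun t _ => (hg t).continuousAt.continuousWithinAt)
    (fun t _ => (hg t).hasDerivWithinAt) (by simp [g])
    (fun t => by
      have := (hasDerivAt_pow 2 t).const_mul (L / 2 * ‖v‖ ^ 2)
      refine this.congr_deriv ?_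
      push_cast; ring)
    (fun t ht => by
      rw [← inner_sub_left, Real.norm_eq_abs]
      refine (abs_real_inner_le_norm _ _).trans ?_
      have := hL (x + t • v) x
      simp only [add_sub_cancel_left, norm_smul, Real.norm_eq_abs, abs_of_nonneg ht.1] at this
      calc _ ≤ L * (t * ‖v‖) * ‖v‖ := by gcongr
        _ = _ := by ring)
    (Set.right_mem_Icc.mpr zero_le_one)
  have e1 : g 1 = f y - f x - inner ℝ (gradient f x) v := by simp [g, hv]
  rw [← e1, ← Real.norm_eq_abs]
  simpa using key

/-- A gradient step of length `1 / L` lowers `f` by at least `‖∇f‖² / (2L)`, and the value reached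
is still at least `m`. -/
theorem sq_norm_gradient_le {f : E → ℝ} {L m : ℝ} (hf : Differentiable ℝ f) (hL0 : 0 < L)
    (hL : ∀ x y, ‖gradient f x - gradient f y‖ ≤ L * ‖x - y‖) (hm : ∀ x, m ≤ f x) (x : E) :
    ‖gradient f x‖ ^ 2 ≤ 2 * L * (f x - m) := by
  have h := (abs_le.mp (abs_sub_sub_inner_gradient_le hf hL x (x - (1 / L) • gradient f x))).2
  have h2 := hm (x - (1 / L) • gradient f x)
  simp only [sub_sub_cancel_left, norm_neg, inner_neg_right, inner_smul_right,
    real_inner_self_eq_norm_sq, norm_smul, Real.norm_eq_abs, abs_of_pos (one_div_pos.mpr hL0),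
    mul_pow] at h
  have e : L / 2 * ((1 / L) ^ 2 * ‖gradient f x‖ ^ 2) = ‖gradient f x‖ ^ 2 / (2 * L) := by
    field_simp
  have e' : 1 / L * ‖gradient f x‖ ^ 2 = 2 * (‖gradient f x‖ ^ 2 / (2 * L)) := by field_simp
  rw [e, e'] at h
  have : ‖gradient f x‖ ^ 2 / (2 * L) ≤ f x - m := by linarith
  rw [div_le_iff₀ (by positivity)] at this
  linarith

theorem continuous_gradient_of_lipschitz {f : E → ℝ} {L : ℝ}
    (hL : ∀ x y, ‖gradient f x - gradient f y‖ ≤ L * ‖x - y‖) : Continuous (gradient f) := by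
  have : LipschitzWith (Real.toNNReal L) (gradient f) := by
    refine LipschitzWith.of_dist_le_mul fun x y => ?_
    rw [dist_eq_norm, dist_eq_norm]
    refine (hL x y).trans ?_
    gcongr
    exact Real.le_coe_toNNReal L
  exact this.continuous

end Smooth

/-! ### The one-step inequality for `cosh ‖x‖`. -/

section Bernstein

/-- The power series is `∑ yⁿ / (2n)!`, a nonnegative combination of functions convex on the
half-line. -/
theorem convexOn_cosh_sqrt : ConvexOn ℝ (Set.Ici 0) (fun y => Real.cosh (Real.sqrt y)) := by
  refine ⟨convex_Ici 0, fun x hx y hy a b ha hb hab => ?_⟩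
  have hs : ∀ z : ℝ, 0 ≤ z →
      HasSum (fun n : ℕ => z ^ n / ((2 * n).factorial : ℝ)) (Real.cosh (Real.sqrt z)) := by
    intro z hz
    have := Real.hasSum_cosh (Real.sqrt z)
    simpa [pow_mul, Real.sq_sqrt hz] using this
  have hx' : (0 : ℝ) ≤ x := hx
  have hy' : (0 : ℝ) ≤ y := hy
  have hz : 0 ≤ a * x + b * y := by positivity
  refine hasSum_le (fun n => ?_) (hs _ hz) (((hs x hx).mul_left a).add ((hs y hy).mul_left b))
  have := (convexOn_pow n).2 hx hy ha hb hab
  simp only [smul_eq_mul] at this ⊢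
  rw [mul_div_assoc', mul_div_assoc', ← add_div]
  gcongr

variable {E : Type*} [NormedAddCommGroup E] [InnerProductSpace ℝ E]

/-- A one-step bound for `cosh` of the norm, with a linear term that averages out. -/
theorem cosh_norm_add_le (x d : E) :
    Real.cosh ‖x + d‖ ≤ Real.cosh ‖x‖ * (Real.exp ‖d‖ - ‖d‖)
      + Real.sinh ‖x‖ / ‖x‖ * inner ℝ x d := by
  set r := ‖x‖ with hr
  set b := ‖d‖ with hb
  have hb0 : 0 ≤ b := norm_nonneg d
  have hr0 : 0 ≤ r := norm_nonneg x
  have hsb : b ≤ Real.sinh b := by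
    simpa using Real.self_le_sinh_iff.mpr hb0
  rcases hr0.eq_or_lt with h0 | hrpos
  · have hx : x = 0 := by rw [← norm_eq_zero, ← hr, ← h0]
    rw [← h0]
    simp only [hx, zero_add, ← hb, Real.cosh_zero, inner_zero_left, mul_zero, add_zero, one_mul]
    have := Real.cosh_add_sinh b
    linarith
  rcases hb0.eq_or_lt with h0 | hbpos
  · have hd : d = 0 := by rw [← norm_eq_zero, ← hb, ← h0]
    rw [← h0]
    simp [hd, ← hr]
  set c := inner ℝ x d / r with hc
  have hcr : inner ℝ x d = r * c := by rw [hc]; field_simp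
  have habs : |c| ≤ b := by
    rw [hc, abs_div, abs_of_pos hrpos, div_le_iff₀ hrpos, mul_comm]
    exact abs_real_inner_le_norm x d
  obtain ⟨hc1, hc2⟩ := abs_le.mp habs
  have hn : ‖x + d‖ = Real.sqrt (r ^ 2 + 2 * (r * c) + b ^ 2) := by
    rw [← hcr, hr, hb, ← norm_add_sq_real, Real.sqrt_sq (norm_nonneg _)]
  set θ := (b + c) / (2 * b) with hθ
  have hθ0 : 0 ≤ θ := by rw [hθ]; apply div_nonneg <;> linarith
  have hθ1 : 0 ≤ 1 - θ := by
    rw [hθ, sub_nonneg, div_le_one (by positivity)]; linarith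
  have hcθ : c = (2 * θ - 1) * b := by rw [hθ]; field_simp; ring
  -- `‖x + d‖²` is the mixture of `(r + b)²` and `(r - b)²` with weights `θ` and `1 - θ`, the
  -- extreme values for parallel vectors. Convexity reduces the claim to the addition formulas for
  -- `cosh`.
  have hconv := convexOn_cosh_sqrt.2 (x := (r + b) ^ 2) (y := (r - b) ^ 2)
    (Set.mem_Ici.mpr (sq_nonneg _)) (Set.mem_Ici.mpr (sq_nonneg _)) hθ0 hθ1 (by ring)
  simp only [smul_eq_mul] at hconv
  rw [Real.sqrt_sq (by positivity), Real.sqrt_sq_eq_abs, Real.cosh_abs, Real.cosh_add,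
    Real.cosh_sub] at hconv
  have e1 : θ * (r + b) ^ 2 + (1 - θ) * (r - b) ^ 2 = r ^ 2 + 2 * (r * c) + b ^ 2 := by
    rw [hcθ]; ring
  rw [e1, ← hn] at hconv
  refine hconv.trans ?_
  have e2 : Real.sinh r / r * inner ℝ x d = Real.sinh r * c := by rw [hcr]; field_simp
  rw [e2, hcθ, ← Real.cosh_add_sinh b]
  have hcs : Real.sinh r ≤ Real.cosh r := (Real.sinh_lt_cosh r).le
  have hs0 : 0 ≤ Real.sinh r := Real.sinh_nonneg_iff.mpr hr0
  -- Replacing `sinh b` by `b` in the linear term costs `(2θ - 1) sinh r (sinh b - b)`, which is at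
  -- most `cosh r (sinh b - b)`.
  nlinarith [mul_nonneg (mul_nonneg hθ0 (sub_nonneg.mpr hcs)) (sub_nonneg.mpr hsb),
    mul_nonneg (mul_nonneg hθ1 (sub_nonneg.mpr hcs)) (sub_nonneg.mpr hsb),
    mul_nonneg (mul_nonneg hθ1 hs0) (sub_nonneg.mpr hsb),
    mul_nonneg hs0 (sub_nonneg.mpr hsb)]

/-- On `[0, 1]` one has `exp b - b ≤ 1 + b²`. The term linear in `d` is kept because it has mean
zero in the application. -/
theorem cosh_norm_add_le_of_norm_le_one (x d : E) (hd : ‖d‖ ≤ 1) :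
    Real.cosh ‖x + d‖ ≤ Real.cosh ‖x‖ * (1 + ‖d‖ ^ 2)
      + Real.sinh ‖x‖ / ‖x‖ * inner ℝ x d := by
  refine (cosh_norm_add_le x d).trans ?_
  have h := Real.abs_exp_sub_one_sub_id_le (x := ‖d‖) (by rwa [abs_of_nonneg (norm_nonneg d)])
  have := (abs_le.mp h).2
  have hc := Real.cosh_pos ‖x‖
  gcongr
  linarith

end Bernstein

/-! ### Polar coordinates and the divergence theorem on the ball. -/

section Sphere

open Metric Module

variable {E : Type*} [NormedAddCommGroup E] [InnerProductSpace ℝ E] [FiniteDimensional ℝ E]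
  [MeasurableSpace E] [BorelSpace E]

/-- Integration in polar coordinates. -/
theorem integral_polar [Nontrivial E] (μ : Measure E) [μ.IsAddHaarMeasure] {a : E → ℝ}
    (ha : Integrable a μ) :
    ∫ x, a x ∂μ = ∫ r in Set.Ioi (0 : ℝ), r ^ (finrank ℝ E - 1) *
      ∫ u : sphere (0 : E) 1, a (r • (u : E)) ∂μ.toSphere := by
  have hemb := (Homeomorph.measurableEmbedding (homeomorphUnitSphereProd E))
  have hcomp : ∀ x : ({(0)}ᶜ : Set E), a x =
      (fun p : sphere (0 : E) 1 × Set.Ioi (0 : ℝ) => a ((p.2 : ℝ) • (p.1 : E)))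
        (homeomorphUnitSphereProd E x) := by
    intro x
    have hx : ‖(x : E)‖ ≠ 0 := norm_ne_zero_iff.mpr x.2
    simp [smul_smul, hx]
  have hint : Integrable (fun p : sphere (0 : E) 1 × Set.Ioi (0 : ℝ) => a ((p.2 : ℝ) • (p.1 : E)))
      (μ.toSphere.prod (Measure.volumeIoiPow (finrank ℝ E - 1))) := by
    rw [← μ.measurePreserving_homeomorphUnitSphereProd.integrable_comp_emb hemb]
    have h1 : IntegrableOn a ({0}ᶜ) μ := ha.integrableOn
    rw [integrableOn_iff_comap_subtypeVal (by measurability)] at h1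
    exact h1.congr (Filter.Eventually.of_forall hcomp)
  calc ∫ x, a x ∂μ = ∫ x : ({(0)}ᶜ : Set E), a x.1 ∂(μ.comap (↑)) := by
        rw [integral_subtype_comap (measurableSet_singleton _).compl fun x ↦ a x,
          restrict_compl_singleton]
    _ = ∫ p, a ((p.2 : ℝ) • (p.1 : E))
          ∂μ.toSphere.prod (Measure.volumeIoiPow (finrank ℝ E - 1)) := by
        rw [← μ.measurePreserving_homeomorphUnitSphereProd.integral_comp hemb]
        exact integral_congr_ae (Filter.Eventually.of_forall hcomp)
    _ = ∫ r : Set.Ioi (0 : ℝ), ∫ u : sphere (0 : E) 1, a ((r : ℝ) • (u : E)) ∂μ.toSphere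
          ∂(Measure.volumeIoiPow (finrank ℝ E - 1)) := integral_prod_symm _ hint
    _ = _ := by
        simp only [Measure.volumeIoiPow, ENNReal.ofReal]
        rw [integral_withDensity_eq_integral_smul,
          integral_subtype_comap measurableSet_Ioi fun r => Real.toNNReal (r ^ (finrank ℝ E - 1)) •
            ∫ u : sphere (0 : E) 1, a ((r : ℝ) • (u : E)) ∂μ.toSphere,
          setIntegral_congr_fun measurableSet_Ioi fun x hx ↦ ?_]
        · rw [NNReal.smul_def, Real.coe_toNNReal _ (pow_nonneg hx.out.le _), smul_eq_mul]
        · exact (measurable_subtype_coe.pow_const _).real_toNNReal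

theorem continuous_sphere_integral (μ : Measure E) [μ.IsAddHaarMeasure] {b : E → ℝ}
    (hb : Continuous b) :
    Continuous fun r : ℝ => ∫ u : sphere (0 : E) 1, b (r • (u : E)) ∂μ.toSphere := by
  have := continuous_parametric_integral_of_continuous (μ := μ.toSphere)
    (f := fun (r : ℝ) (u : sphere (0 : E) 1) => b (r • (u : E))) (s := Set.univ)
    (by fun_prop) isCompact_univ
  simpa using this

theorem setIntegral_ball_polar [Nontrivial E] (μ : Measure E) [μ.IsAddHaarMeasure] {b : E → ℝ}
    (hb : Continuous b) (k : ℕ) {s : ℝ} (hs : 0 < s) :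
    ∫ x in ball (0 : E) s, (s ^ 2 - ‖x‖ ^ 2) ^ k * b x ∂μ =
      ∫ r in (0 : ℝ)..s, (s ^ 2 - r ^ 2) ^ k * (r ^ (finrank ℝ E - 1) *
        ∫ u : sphere (0 : E) 1, b (r • (u : E)) ∂μ.toSphere) := by
  have hint : IntegrableOn (fun x : E => (s ^ 2 - ‖x‖ ^ 2) ^ k * b x) (ball 0 s) μ := by
    have : Continuous (fun x : E => (s ^ 2 - ‖x‖ ^ 2) ^ k * b x) := by fun_prop
    exact (this.continuousOn.integrableOn_compact (isCompact_closedBall 0 s)).mono_set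
      ball_subset_closedBall
  rw [← integral_indicator measurableSet_ball,
    integral_polar μ (hint.integrable_indicator measurableSet_ball),
    intervalIntegral.integral_of_le hs.le, integral_Ioc_eq_integral_Ioo]
  have hIoo : Set.Ioo (0 : ℝ) s = Set.Ioi 0 ∩ Set.Iio s := rfl
  rw [hIoo, ← setIntegral_indicator measurableSet_Iio]
  refine setIntegral_congr_fun measurableSet_Ioi fun r hr => ?_
  have hr0 : 0 < r := hr
  have hn : ∀ u : sphere (0 : E) 1, ‖r • (u : E)‖ = r := fun u => by
    rw [norm_smul, norm_eq_of_mem_sphere, mul_one, Real.norm_of_nonneg hr0.le]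
  by_cases hrs : r < s
  · have : ∀ u : sphere (0 : E) 1, (ball (0 : E) s).indicator
        (fun x => (s ^ 2 - ‖x‖ ^ 2) ^ k * b x) (r • (u : E)) =
          (s ^ 2 - r ^ 2) ^ k * b (r • (u : E)) := fun u => by
      rw [Set.indicator_of_mem (by simpa [hn u] using hrs), hn]
    simp only [this, Set.indicator_of_mem (Set.mem_Iio.mpr hrs), integral_const_mul]
    ring
  · have : ∀ u : sphere (0 : E) 1, (ball (0 : E) s).indicator
        (fun x => (s ^ 2 - ‖x‖ ^ 2) ^ k * b x) (r • (u : E)) = 0 := fun u => by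
      rw [Set.indicator_of_notMem (by simpa [hn u] using hrs)]
    simp only [this, Set.indicator_of_notMem (show r ∉ Set.Iio s from hrs), integral_zero, mul_zero]

/-- Expanding the weight leaves only primitives of continuous functions. The weight vanishes at `r =
s`, so the moving endpoint contributes nothing. The same holds for the squared weight below. -/
theorem hasDerivAt_integral_sq_sub {c : ℝ → ℝ} (hc : Continuous c) (s : ℝ) :
    HasDerivAt (fun s => ∫ r in (0 : ℝ)..s, (s ^ 2 - r ^ 2) ^ 1 * c r)
      (2 * s * ∫ r in (0 : ℝ)..s, c r) s := by
  have h0 := (hc.integral_hasStrictDerivAt 0 s).hasDerivAt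
  have h2 := ((show Continuous fun r => r ^ 2 * c r by fun_prop).integral_hasStrictDerivAt
    0 s).hasDerivAt
  have e : (fun s => ∫ r in (0 : ℝ)..s, (s ^ 2 - r ^ 2) ^ 1 * c r) =
      fun s => s ^ 2 * (∫ r in (0 : ℝ)..s, c r) - ∫ r in (0 : ℝ)..s, r ^ 2 * c r := by
    funext s
    rw [← intervalIntegral.integral_const_mul, ← intervalIntegral.integral_sub]
    · congr 1; funext r; ring
    · exact (by fun_prop : Continuous _).intervalIntegrable _ _
    · exact (by fun_prop : Continuous _).intervalIntegrable _ _
  rw [e]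
  refine (((hasDerivAt_pow 2 s).mul h0).sub h2).congr_deriv ?_
  push_cast; ring

theorem hasDerivAt_integral_sq_sub_sq {c : ℝ → ℝ} (hc : Continuous c) (s : ℝ) :
    HasDerivAt (fun s => ∫ r in (0 : ℝ)..s, (s ^ 2 - r ^ 2) ^ 2 * c r)
      (4 * s * ∫ r in (0 : ℝ)..s, (s ^ 2 - r ^ 2) ^ 1 * c r) s := by
  have h0 := (hc.integral_hasStrictDerivAt 0 s).hasDerivAt
  have h2 := ((show Continuous fun r => r ^ 2 * c r by fun_prop).integral_hasStrictDerivAt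
    0 s).hasDerivAt
  have h4 := ((show Continuous fun r => r ^ 4 * c r by fun_prop).integral_hasStrictDerivAt
    0 s).hasDerivAt
  have e : (fun s => ∫ r in (0 : ℝ)..s, (s ^ 2 - r ^ 2) ^ 2 * c r) =
      fun s => s ^ 4 * (∫ r in (0 : ℝ)..s, c r) - 2 * s ^ 2 * (∫ r in (0 : ℝ)..s, r ^ 2 * c r)
        + ∫ r in (0 : ℝ)..s, r ^ 4 * c r := by
    funext s
    rw [← intervalIntegral.integral_const_mul, ← intervalIntegral.integral_const_mul,
      ← intervalIntegral.integral_sub, ← intervalIntegral.integral_add]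
    · congr 1; funext r; ring
    all_goals exact (by fun_prop : Continuous _).intervalIntegrable _ _
  have e1 : ∫ r in (0 : ℝ)..s, (s ^ 2 - r ^ 2) ^ 1 * c r =
      s ^ 2 * (∫ r in (0 : ℝ)..s, c r) - ∫ r in (0 : ℝ)..s, r ^ 2 * c r := by
    rw [← intervalIntegral.integral_const_mul, ← intervalIntegral.integral_sub]
    · congr 1; funext r; ring
    all_goals exact (by fun_prop : Continuous _).intervalIntegrable _ _
  rw [e, e1]
  refine ((((hasDerivAt_pow 4 s).mul h0).sub (((hasDerivAt_pow 2 s).const_mul 2).mul h2)).add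
    h4).congr_deriv ?_
  push_cast; ring

/-- A continuous integrand with vanishing second-order moments is determined by its boundary. -/
theorem integral_eq_of_integral_sq_sub_eq {a b : ℝ → ℝ} (ha : Continuous a) (hb : Continuous b)
    (h : ∀ s > 0, ∫ r in (0 : ℝ)..s, (s ^ 2 - r ^ 2) ^ 2 * a r =
      4 * ∫ r in (0 : ℝ)..s, (s ^ 2 - r ^ 2) ^ 1 * b r) {s : ℝ} (hs : 0 < s) :
    s * ∫ r in (0 : ℝ)..s, a r = b s := by
  have h1 : ∀ s > 0, ∫ r in (0 : ℝ)..s, (s ^ 2 - r ^ 2) ^ 1 * a r =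
      2 * ∫ r in (0 : ℝ)..s, b r := by
    intro s hs
    -- Differentiating in `s` lowers the power of the weight by one on both sides. A second
    -- differentiation removes it on the left and leaves the boundary value `b s` on the right.
    have := (hasDerivAt_integral_sq_sub_sq ha s).unique
      (((hasDerivAt_integral_sq_sub hb s).const_mul 4).congr_of_eventuallyEq
        ((eventually_gt_nhds hs).mono h))
    have h3 : s * (∫ r in (0 : ℝ)..s, (s ^ 2 - r ^ 2) ^ 1 * a r) =
      s * (2 * ∫ r in (0 : ℝ)..s, b r) := by linarith
    exact mul_left_cancel₀ hs.ne' h3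
  have := (hasDerivAt_integral_sq_sub ha s).unique
    (((hb.integral_hasStrictDerivAt 0 s).hasDerivAt.const_mul 2).congr_of_eventuallyEq
      ((eventually_gt_nhds hs).mono h1))
  linarith

/-- The square removes the kink of the positive part at `0`. This is why integration by parts uses
the squared weight and not the indicator of the ball. -/
theorem hasDerivAt_max_zero_sq (y : ℝ) :
    HasDerivAt (fun y : ℝ => (max 0 y) ^ 2) (2 * max 0 y) y := by
  rcases lt_trichotomy y 0 with h | h | h
  · rw [max_eq_left h.le, mul_zero]
    refine (hasDerivAt_const y (0 : ℝ)).congr_of_eventuallyEq ?_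
    filter_upwards [eventually_lt_nhds h] with z hz
    simp [max_eq_left hz.le]
  · subst h
    rw [hasDerivAt_iff_isLittleO]
    simp only [max_self, sub_zero, mul_zero, smul_zero, ne_eq, OfNat.ofNat_ne_zero,
      not_false_eq_true, zero_pow]
    refine Asymptotics.IsBigO.trans_isLittleO (g := fun z : ℝ => z ^ 2) ?_ ?_
    · refine Asymptotics.isBigO_of_le _ fun z => ?_
      rw [Real.norm_eq_abs, Real.norm_eq_abs, abs_pow, abs_pow]
      gcongr ?_ ^ 2
      rw [abs_of_nonneg (le_max_left _ _)]
      exact max_le (abs_nonneg _) (le_abs_self _)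
    · simpa using Asymptotics.isLittleO_pow_id (𝕜 := ℝ) one_lt_two
  · rw [max_eq_right h.le]
    refine (hasDerivAt_pow 2 y).congr_of_eventuallyEq ?_ |>.congr_deriv (by simp)
    filter_upwards [eventually_gt_nhds h] with z hz
    simp [max_eq_right hz.le]

/-- Integration by parts against the weight `max(0, s² - ‖x‖²)²`. -/
theorem integral_max_sq_mul_inner_gradient [Nontrivial E] (μ : Measure E) [μ.IsAddHaarMeasure]
    {g : E → ℝ}
    (hg : Differentiable ℝ g) (hg' : Continuous (gradient g)) (e : E) {s : ℝ} (hs : 0 < s) :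
    ∫ x, (max 0 (s ^ 2 - ‖x‖ ^ 2)) ^ 2 * inner ℝ (gradient g x) e ∂μ =
      4 * ∫ x, (max 0 (s ^ 2 - ‖x‖ ^ 2)) ^ 1 * (g x * inner ℝ x e) ∂μ := by
  have hgc : Continuous g := hg.continuous
  have hc1 : Continuous fun x : E => inner ℝ (gradient g x) e := by fun_prop
  have hcm : Continuous fun x : E => max 0 (s ^ 2 - ‖x‖ ^ 2) := by fun_prop
  -- Every integrand below vanishes with the weight, hence outside the closed ball of radius `s`,
  -- and is continuous with compact support.
  have hint : ∀ φ : E → ℝ, Continuous φ →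
      (∀ x, max 0 (s ^ 2 - ‖x‖ ^ 2) = 0 → φ x = 0) → Integrable φ μ := by
    intro φ hφ h0
    refine hφ.integrable_of_hasCompactSupport ?_
    refine HasCompactSupport.of_support_subset_isCompact (isCompact_closedBall (0 : E) s) ?_
    intro x hx
    by_contra hxs
    have : s < ‖x‖ := by simpa using hxs
    exact hx (h0 x (max_eq_left (by nlinarith)))
  have hd : ∀ x : E, HasLineDerivAt ℝ (fun x : E => (max 0 (s ^ 2 - ‖x‖ ^ 2)) ^ 2)
      (-(4 * (max 0 (s ^ 2 - ‖x‖ ^ 2) * inner ℝ x e))) x e := by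
    intro x
    have h1 : HasFDerivAt (fun x : E => s ^ 2 - ‖x‖ ^ 2) (-(2 • (innerSL ℝ x)) : E →L[ℝ] ℝ) x :=
      ((hasStrictFDerivAt_norm_sq x).hasFDerivAt).const_sub _
    have h2 := ((hasDerivAt_max_zero_sq (s ^ 2 - ‖x‖ ^ 2)).comp_hasFDerivAt x h1).hasLineDerivAt e
    have e1 : ((2 * max 0 (s ^ 2 - ‖x‖ ^ 2)) • (-(2 • (innerSL ℝ x)) : E →L[ℝ] ℝ)) e =
        -(4 * (max 0 (s ^ 2 - ‖x‖ ^ 2) * inner ℝ x e)) := by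
      simp
      ring
    rw [← e1]
    exact h2
  have hd' : ∀ x : E, HasLineDerivAt ℝ g (inner ℝ (gradient g x) e) x e := fun x => by
    simpa using (hg x).hasFDerivAt.hasLineDerivAt e
  have hibp := integral_bilinear_hasLineDerivAt_right_eq_neg_left_of_integrable (μ := μ)
    (B := ContinuousLinearMap.mul ℝ ℝ)
    (f := fun x : E => (max 0 (s ^ 2 - ‖x‖ ^ 2)) ^ 2)
    (f' := fun x : E => -(4 * (max 0 (s ^ 2 - ‖x‖ ^ 2) * inner ℝ x e)))
    (g := g) (g' := fun x => inner ℝ (gradient g x) e) (v := e)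
    (hint _ (by simp only [ContinuousLinearMap.mul_apply']; fun_prop) (fun x hx => by simp [hx]))
    (hint _ (by simp only [ContinuousLinearMap.mul_apply']; fun_prop) (fun x hx => by simp [hx]))
    (hint _ (by simp only [ContinuousLinearMap.mul_apply']; fun_prop) (fun x hx => by simp [hx]))
    (fun x _ => hd x) (fun x _ => hd' x)
  simp only [ContinuousLinearMap.mul_apply'] at hibp
  rw [hibp, ← integral_const_mul, ← integral_neg]
  congr 1
  funext x
  ring

/-- The divergence theorem on the unit ball for the field `g • e`. -/
theorem setIntegral_ball_inner_gradient [Nontrivial E] (μ : Measure E) [μ.IsAddHaarMeasure]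
    {g : E → ℝ}
    (hg : Differentiable ℝ g) (hg' : Continuous (gradient g)) (e : E) :
    ∫ x in ball (0 : E) 1, inner ℝ (gradient g x) e ∂μ =
      ∫ u : sphere (0 : E) 1, g u * inner ℝ (u : E) e ∂μ.toSphere := by
  have hgc : Continuous g := hg.continuous
  set n := finrank ℝ E - 1
  set a : ℝ → ℝ := fun r => r ^ n *
    ∫ u : sphere (0 : E) 1, inner ℝ (gradient g (r • (u : E))) e ∂μ.toSphere with ha
  set b : ℝ → ℝ := fun r => r ^ n *
    ∫ u : sphere (0 : E) 1, g (r • (u : E)) * inner ℝ (r • (u : E)) e ∂μ.toSphere with hb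
  have hc1 : Continuous fun x : E => inner ℝ (gradient g x) e := by fun_prop
  have hc2 : Continuous fun x : E => g x * inner ℝ x e := by fun_prop
  have hac : Continuous a := (continuous_pow n).mul (continuous_sphere_integral μ hc1)
  have hbc : Continuous b := (continuous_pow n).mul (continuous_sphere_integral μ hc2)
  -- Integration by parts against the weight, for all radii at once. Differentiating twice in `s`
  -- then recovers the sharp boundary term at `s = 1`, with no approximation of the indicator.
  have hkey : ∀ s > 0, ∫ r in (0 : ℝ)..s, (s ^ 2 - r ^ 2) ^ 2 * a r =
      4 * ∫ r in (0 : ℝ)..s, (s ^ 2 - r ^ 2) ^ 1 * b r := by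
    intro s hs
    rw [← setIntegral_ball_polar μ hc1 2 hs, ← setIntegral_ball_polar μ hc2 1 hs]
    have hmax : ∀ (k : ℕ), k ≠ 0 → ∀ c : E → ℝ,
        ∫ x in ball (0 : E) s, (s ^ 2 - ‖x‖ ^ 2) ^ k * c x ∂μ =
          ∫ x, (max 0 (s ^ 2 - ‖x‖ ^ 2)) ^ k * c x ∂μ := by
      intro k hk c
      rw [← integral_indicator measurableSet_ball]
      refine integral_congr_ae (Filter.Eventually.of_forall fun x => ?_)
      by_cases hx : ‖x‖ < s
      · have : 0 ≤ s ^ 2 - ‖x‖ ^ 2 := by nlinarith [norm_nonneg x]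
        simp [Set.indicator, hx, max_eq_right this]
      · have : s ^ 2 - ‖x‖ ^ 2 ≤ 0 := by nlinarith [norm_nonneg x]
        simp [Set.indicator, hx, max_eq_left this, hk]
    rw [hmax 2 two_ne_zero, hmax 1 one_ne_zero]
    exact integral_max_sq_mul_inner_gradient μ hg hg' e hs
  have h1 := integral_eq_of_integral_sq_sub_eq hac hbc hkey zero_lt_one
  have h2 := setIntegral_ball_polar μ hc1 0 zero_lt_one
  simp only [pow_zero, one_mul] at h2
  rw [h2]
  simpa [ha, hb] using h1

end Sphere

/-! ### The uniform law on the sphere. -/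

section UnifSphere

open Metric Module
open scoped Pointwise

variable {d : ℕ}

theorem integral_unifSphere {F : Type*} [NormedAddCommGroup F] [NormedSpace ℝ F]
    (h : EuclideanSpace ℝ (Fin d) → F) :
    ∫ u, h u ∂unifSphere d =
      ((volume : Measure (EuclideanSpace ℝ (Fin d))).toSphere.real Set.univ)⁻¹ •
        ∫ u : sphere (0 : EuclideanSpace ℝ (Fin d)) 1, h u
          ∂(volume : Measure (EuclideanSpace ℝ (Fin d))).toSphere := by
  rw [unifSphere, (MeasurableEmbedding.subtype_coe isClosed_sphere.measurableSet).integral_map,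
    integral_smul_measure, ENNReal.toReal_inv, measureReal_def]

theorem isProbabilityMeasure_unifSphere (hd : 1 ≤ d) : IsProbabilityMeasure (unifSphere d) := by
  have : Nonempty (Fin d) := ⟨⟨0, hd⟩⟩
  have h0 := Measure.toSphere_ne_zero (volume : Measure (EuclideanSpace ℝ (Fin d)))
  refine ⟨?_⟩
  rw [unifSphere, Measure.map_apply measurable_subtype_coe MeasurableSet.univ, Set.preimage_univ,
    Measure.smul_apply, smul_eq_mul, ENNReal.inv_mul_cancel]
  · exact fun h => h0 (Measure.measure_univ_eq_zero.mp h)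
  · exact measure_ne_top _ _

theorem ae_norm_eq_one_unifSphere : ∀ᵐ u ∂unifSphere d, ‖u‖ = 1 := by
  rw [unifSphere, (MeasurableEmbedding.subtype_coe isClosed_sphere.measurableSet).ae_map_iff]
  exact Filter.Eventually.of_forall fun u => norm_eq_of_mem_sphere u

/-- The sphere measure of a set is proportional to the volume of the cone over it, and an isometry
preserves volume and maps cones to cones. -/
theorem map_unifSphere (A : EuclideanSpace ℝ (Fin d) ≃ₗᵢ[ℝ] EuclideanSpace ℝ (Fin d)) :
    (unifSphere d).map A = unifSphere d := by
  ext s hs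
  have hA : Measurable A := A.continuous.measurable
  rw [Measure.map_apply hA hs, unifSphere, Measure.map_apply measurable_subtype_coe (hA hs),
    Measure.map_apply measurable_subtype_coe hs, Measure.smul_apply, Measure.smul_apply,
    Measure.toSphere_apply' _ (measurable_subtype_coe (hA hs)),
    Measure.toSphere_apply' _ (measurable_subtype_coe hs)]
  congr 2
  rw [← (A.measurePreserving).measure_preimage_emb A.toHomeomorph.measurableEmbedding
    (Set.Ioo (0 : ℝ) 1 • (Subtype.val '' (Subtype.val ⁻¹' s)))]
  congr 1
  ext x
  simp only [Subtype.image_preimage_coe, Set.mem_smul, Set.mem_inter_iff, mem_sphere_zero_iff_norm,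
    Set.mem_preimage]
  constructor
  · rintro ⟨r, hr, y, ⟨hy1, hy2⟩, rfl⟩
    exact ⟨r, hr, A y, ⟨by simpa using hy1, hy2⟩, by simp⟩
  · rintro ⟨r, hr, y, ⟨hy1, hy2⟩, hx⟩
    refine ⟨r, hr, A.symm y, ⟨by simpa using hy1, by simpa using hy2⟩, ?_⟩
    rw [← map_smul, hx, A.symm_apply_apply]

/-- The reflection in the hyperplane orthogonal to `e - e'` takes `e` to `e'` and preserves the law.
-/
theorem map_inner_unifSphere {e e' : EuclideanSpace ℝ (Fin d)} (h : ‖e‖ = ‖e'‖) :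
    (unifSphere d).map (fun u => inner ℝ e u) = (unifSphere d).map (fun u => inner ℝ e' u) := by
  set A := (ℝ ∙ (e - e'))ᗮ.reflection
  have hA : A e = e' := Submodule.reflection_sub h
  have h1 : (unifSphere d).map (fun u => inner ℝ e' u) =
      ((unifSphere d).map A).map (fun u => inner ℝ e' u) := by rw [map_unifSphere A]
  rw [h1, Measure.map_map (by fun_prop) A.continuous.measurable]
  congr 1
  funext u
  rw [← hA, Function.comp, A.inner_map_map]

theorem integrable_unifSphere {F : Type*} [NormedAddCommGroup F]
    (hd : 1 ≤ d) {h : EuclideanSpace ℝ (Fin d) → F} (hh : Continuous h) :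
    Integrable h (unifSphere d) := by
  have := isProbabilityMeasure_unifSphere hd
  obtain ⟨C, hC⟩ := (isCompact_sphere (0 : EuclideanSpace ℝ (Fin d)) 1).exists_bound_of_continuousOn
    hh.continuousOn
  have hF : AEStronglyMeasurable h (unifSphere d) := hh.aestronglyMeasurable
  refine Integrable.of_bound hF C ?_
  filter_upwards [ae_norm_eq_one_unifSphere] with u hu
  exact hC u (by simpa using hu)

/-- All `d` coordinate directions, scaled by `‖e‖`, give the same integral as `e`, and their squares
add up to `‖e‖²` on the unit sphere. -/
theorem integral_inner_sq_unifSphere (hd : 1 ≤ d) (e : EuclideanSpace ℝ (Fin d)) :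
    ∫ u, (inner ℝ e u) ^ 2 ∂unifSphere d = ‖e‖ ^ 2 / d := by
  have := isProbabilityMeasure_unifSphere hd
  have hd0 : (d : ℝ) ≠ 0 := by positivity
  set b := EuclideanSpace.basisFun (Fin d) ℝ
  have hsame : ∀ i, ∫ u, (inner ℝ (‖e‖ • b i) u) ^ 2 ∂unifSphere d =
      ∫ u, (inner ℝ e u) ^ 2 ∂unifSphere d := by
    intro i
    have hm := map_inner_unifSphere (e := ‖e‖ • b i) (e' := e) (by simp [norm_smul])
    rw [← integral_map (φ := fun u => inner ℝ (‖e‖ • b i) u) (f := fun y : ℝ => y ^ 2)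
      (by fun_prop) (by fun_prop), hm, integral_map (by fun_prop) (by fun_prop)]
  have hsum : ∑ i, ∫ u, (inner ℝ (‖e‖ • b i) u) ^ 2 ∂unifSphere d = ‖e‖ ^ 2 := by
    rw [← integral_finsetSum _ fun i _ => integrable_unifSphere hd (by fun_prop)]
    have : ∀ᵐ u ∂unifSphere d, ∑ i, (inner ℝ (‖e‖ • b i) u) ^ 2 = ‖e‖ ^ 2 := by
      filter_upwards [ae_norm_eq_one_unifSphere] with u hu
      simp only [inner_smul_left, mul_pow, ← Finset.mul_sum]
      rw [b.sum_sq_inner_right u, hu]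
      simp
    rw [integral_congr_ae this]
    simp
  simp only [hsame, Finset.sum_const, Finset.card_univ, Fintype.card_fin, nsmul_eq_mul] at hsum
  rw [← hsum]
  field_simp

end UnifSphere

/-! ### Averages over a ball. -/

section Smoothing

open Metric Module

variable {d : ℕ}

/-- The uniform probability measure on the unit ball. -/
def unifBall (d : ℕ) : Measure (EuclideanSpace ℝ (Fin d)) :=
  ProbabilityTheory.cond volume (ball (0 : EuclideanSpace ℝ (Fin d)) 1)

instance isProbabilityMeasure_unifBall : IsProbabilityMeasure (unifBall d) :=
  ProbabilityTheory.cond_isProbabilityMeasure_of_finite (measure_ball_pos _ _ zero_lt_one).ne'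
    measure_ball_lt_top.ne

theorem ae_norm_le_one_unifBall : ∀ᵐ u ∂unifBall d, ‖u‖ ≤ 1 := by
  filter_upwards [ProbabilityTheory.ae_cond_mem (μ := volume)
    (measurableSet_ball (x := (0 : EuclideanSpace ℝ (Fin d))) (ε := 1))] with u hu
  simpa using (mem_ball_zero_iff.mp hu).le

theorem integrable_unifBall {F : Type*} [NormedAddCommGroup F]
    {h : EuclideanSpace ℝ (Fin d) → F} (hh : Continuous h) :
    Integrable h (unifBall d) := by
  obtain ⟨C, hC⟩ := (isCompact_closedBall (0 : EuclideanSpace ℝ (Fin d)) 1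
    ).exists_bound_of_continuousOn hh.continuousOn
  refine Integrable.of_bound hh.aestronglyMeasurable C ?_
  filter_upwards [ae_norm_le_one_unifBall] with u hu
  exact hC u (by simpa using hu)

theorem map_neg_unifBall : (unifBall d).map (fun x => -x) = unifBall d := by
  ext s hs
  rw [Measure.map_apply measurable_neg hs, unifBall,
    ProbabilityTheory.cond_apply measurableSet_ball,
    ProbabilityTheory.cond_apply measurableSet_ball]
  congr 1
  have : ball (0 : EuclideanSpace ℝ (Fin d)) 1 ∩ (fun x => -x) ⁻¹' s =
      (fun x => -x) ⁻¹' (ball 0 1 ∩ s) := by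
    ext x; simp
  rw [this, (Measure.measurePreserving_neg volume).measure_preimage
    (measurableSet_ball.inter hs).nullMeasurableSet]

/-- The normalized divergence theorem. The factor `d` is the ratio of the surface of the unit sphere
to the volume of the unit ball. -/
theorem integral_unifBall_inner_gradient (hd : 1 ≤ d) {g : EuclideanSpace ℝ (Fin d) → ℝ}
    (hg : Differentiable ℝ g) (hg' : Continuous (gradient g)) (e : EuclideanSpace ℝ (Fin d)) :
    ∫ x, inner ℝ (gradient g x) e ∂unifBall d = d * ∫ u, g u * inner ℝ u e ∂unifSphere d := by
  have : Nonempty (Fin d) := ⟨⟨0, hd⟩⟩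
  have hd0 : (d : ℝ) ≠ 0 := by positivity
  rw [integral_unifSphere, unifBall, ProbabilityTheory.cond, integral_smul_measure,
    setIntegral_ball_inner_gradient volume hg hg' e, Measure.toSphere_real_apply_univ,
    ENNReal.toReal_inv]
  simp only [finrank_euclideanSpace, Fintype.card_fin, smul_eq_mul, measureReal_def]
  rw [mul_inv, ← mul_assoc, ← mul_assoc, mul_inv_cancel₀ hd0, one_mul]

/-- The average of `f` over a ball of radius `μ`. -/
def ballAverage (f : EuclideanSpace ℝ (Fin d) → ℝ) (μ : ℝ) (x : EuclideanSpace ℝ (Fin d)) : ℝ :=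
  ∫ v, f (x + μ • v) ∂unifBall d

/-- The average of the gradient of `f` over a ball of radius `μ`. -/
def ballGradient (f : EuclideanSpace ℝ (Fin d) → ℝ) (μ : ℝ) (x : EuclideanSpace ℝ (Fin d)) :
    EuclideanSpace ℝ (Fin d) :=
  ∫ v, gradient f (x + μ • v) ∂unifBall d

variable {f : EuclideanSpace ℝ (Fin d) → ℝ} {L μ : ℝ}

theorem ballAverage_le (hf : Differentiable ℝ f)
    (hL : ∀ x y, ‖gradient f x - gradient f y‖ ≤ L * ‖x - y‖)
    (x y : EuclideanSpace ℝ (Fin d)) :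
    ballAverage f μ y ≤ ballAverage f μ x + inner ℝ (ballGradient f μ x) (y - x)
      + L / 2 * ‖y - x‖ ^ 2 := by
  have hc := hf.continuous
  have hg := continuous_gradient_of_lipschitz hL
  have e1 : inner ℝ (ballGradient f μ x) (y - x) =
      ∫ v, inner ℝ (gradient f (x + μ • v)) (y - x) ∂unifBall d := by
    rw [ballGradient, real_inner_comm, ← integral_inner]
    · simp only [real_inner_comm]
    · exact integrable_unifBall (by fun_prop)
  have e2 : L / 2 * ‖y - x‖ ^ 2 = ∫ v, L / 2 * ‖y - x‖ ^ 2 ∂unifBall d := by simp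
  rw [e1, e2, ballAverage, ballAverage,
    ← integral_add (integrable_unifBall (by fun_prop)) (integrable_unifBall (by fun_prop)),
    ← integral_add (integrable_unifBall (by fun_prop)) (integrable_unifBall (by fun_prop))]
  refine integral_mono (integrable_unifBall (by fun_prop)) (integrable_unifBall (by fun_prop))
    fun v => ?_
  have := (abs_le.mp (abs_sub_sub_inner_gradient_le hf hL (x + μ • v) (y + μ • v))).2
  simp only [add_sub_add_right_eq_sub] at this
  simp only
  linarith

theorem norm_ballGradient_sub_le
    (hL : ∀ x y, ‖gradient f x - gradient f y‖ ≤ L * ‖x - y‖)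
    (x y : EuclideanSpace ℝ (Fin d)) :
    ‖ballGradient f μ x - ballGradient f μ y‖ ≤ L * ‖x - y‖ := by
  have hg := continuous_gradient_of_lipschitz hL
  rw [ballGradient, ballGradient,
    ← integral_sub (integrable_unifBall (by fun_prop)) (integrable_unifBall (by fun_prop))]
  refine (norm_integral_le_of_norm_le_const (C := L * ‖x - y‖)
    (Filter.Eventually.of_forall fun v => ?_)).trans (by simp)
  simpa using hL (x + μ • v) (y + μ • v)

theorem norm_ballGradient_sub_gradient_le (hL0 : 0 ≤ L) (hμ : 0 ≤ μ)
    (hL : ∀ x y, ‖gradient f x - gradient f y‖ ≤ L * ‖x - y‖)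
    (x : EuclideanSpace ℝ (Fin d)) :
    ‖ballGradient f μ x - gradient f x‖ ≤ L * μ := by
  have hg := continuous_gradient_of_lipschitz hL
  have e : gradient f x = ∫ v, gradient f x ∂unifBall d := by simp
  rw [ballGradient]
  nth_rewrite 1 [e]
  rw [← integral_sub (integrable_unifBall (by fun_prop)) (integrable_unifBall (by fun_prop))]
  refine (norm_integral_le_of_norm_le_const (C := L * μ) ?_).trans (by simp)
  filter_upwards [ae_norm_le_one_unifBall] with v hv
  refine (hL _ _).trans ?_
  rw [add_sub_cancel_left, norm_smul, Real.norm_of_nonneg hμ]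
  gcongr
  exact mul_le_of_le_one_right hμ hv

/-- The ball is symmetric, so the first-order term averages to zero and only the quadratic remainder
is left. -/
theorem abs_ballAverage_sub_le (hL0 : 0 ≤ L) (hμ : 0 ≤ μ) (hf : Differentiable ℝ f)
    (hL : ∀ x y, ‖gradient f x - gradient f y‖ ≤ L * ‖x - y‖)
    (x : EuclideanSpace ℝ (Fin d)) :
    |ballAverage f μ x - f x| ≤ L * μ ^ 2 / 2 := by
  have hc := hf.continuous
  have hmean : ∫ v, inner ℝ (gradient f x) (μ • v) ∂unifBall d = 0 := by
    have h1 : ∫ v, inner ℝ (gradient f x) (μ • v) ∂unifBall d =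
        ∫ v, inner ℝ (gradient f x) (μ • -v) ∂unifBall d := by
      nth_rewrite 1 [← map_neg_unifBall]
      rw [integral_map (by fun_prop) (by fun_prop)]
    simp only [smul_neg, inner_neg_right, integral_neg] at h1
    linarith
  have e : f x = ∫ v, (f x + inner ℝ (gradient f x) (μ • v)) ∂unifBall d := by
    rw [integral_add (integrable_unifBall (by fun_prop)) (integrable_unifBall (by fun_prop)), hmean]
    simp
  rw [ballAverage]
  nth_rewrite 1 [e]
  rw [← integral_sub (integrable_unifBall (by fun_prop)) (integrable_unifBall (by fun_prop)),
    ← Real.norm_eq_abs]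
  refine (norm_integral_le_of_norm_le_const (C := L * μ ^ 2 / 2) ?_).trans (by simp)
  filter_upwards [ae_norm_le_one_unifBall] with v hv
  have h := abs_sub_sub_inner_gradient_le hf hL x (x + μ • v)
  rw [add_sub_cancel_left, norm_smul, Real.norm_of_nonneg hμ] at h
  rw [Real.norm_eq_abs, ← sub_sub]
  refine h.trans ?_
  have : (μ * ‖v‖) ^ 2 ≤ μ ^ 2 := by
    gcongr
    exact mul_le_of_le_one_right hμ hv
  nlinarith

theorem le_ballAverage {m : ℝ} (hc : Continuous f) (hm : ∀ x, m ≤ f x)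
    (x : EuclideanSpace ℝ (Fin d)) : m ≤ ballAverage f μ x := by
  have e : m = ∫ _v, m ∂unifBall d := by simp
  rw [e, ballAverage]
  exact integral_mono (by simp) (integrable_unifBall (by fun_prop)) fun v => hm _

/-- The averaged gradient is the mean of the two-point estimator. -/
theorem ballGradient_eq (hd : 1 ≤ d) (hμ : 0 < μ) (hf : Differentiable ℝ f)
    (hg : Continuous (gradient f)) (x : EuclideanSpace ℝ (Fin d)) :
    ballGradient f μ x =
      (d : ℝ) • ∫ u, ((f (x + μ • u) - f (x - μ • u)) / (2 * μ)) • u ∂unifSphere d := by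
  have hc := hf.continuous
  have hgrad : ∀ v, HasGradientAt (fun v => f (x + μ • v)) (μ • gradient f (x + μ • v)) v := by
    intro v
    have h1 : HasFDerivAt (fun v : EuclideanSpace ℝ (Fin d) => x + μ • v)
        (μ • ContinuousLinearMap.id ℝ (EuclideanSpace ℝ (Fin d))) v :=
      ((hasFDerivAt_id v).const_smul μ).const_add x
    rw [hasGradientAt_iff_hasFDerivAt]
    refine ((hf (x + μ • v)).hasGradientAt.hasFDerivAt.comp v h1).congr_fderiv ?_
    ext w
    simp
  have hd1 : Differentiable ℝ (fun v => f (x + μ • v)) := fun v => (hgrad v).differentiableAt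
  have hg1 : gradient (fun v => f (x + μ • v)) = fun v => μ • gradient f (x + μ • v) :=
    funext fun v => (hgrad v).gradient
  refine ext_inner_right ℝ fun e => ?_
  have e1 : inner ℝ (ballGradient f μ x) e =
      ∫ v, inner ℝ (gradient f (x + μ • v)) e ∂unifBall d := by
    rw [ballGradient, real_inner_comm, ← integral_inner]
    · simp only [real_inner_comm]
    · exact integrable_unifBall (by fun_prop)
  have e2 := integral_unifBall_inner_gradient hd hd1 (by rw [hg1]; fun_prop) e
  simp only [hg1, inner_smul_left, conj_trivial, integral_const_mul] at e2
  have e3 : inner ℝ (∫ u, ((f (x + μ • u) - f (x - μ • u)) / (2 * μ)) • u ∂unifSphere d) e =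
      ∫ u, ((f (x + μ • u) - f (x - μ • u)) / (2 * μ)) * inner ℝ u e ∂unifSphere d := by
    rw [real_inner_comm, ← integral_inner]
    · simp only [real_inner_comm _ e, inner_smul_left, conj_trivial]
    · exact integrable_unifSphere hd (by fun_prop)
  -- Antipodal symmetry makes the two evaluations contribute equally. The central difference
  -- therefore has the same mean as the one-point formula from the divergence theorem.
  have e4 : ∫ u, f (x - μ • u) * inner ℝ u e ∂unifSphere d =
      - ∫ u, f (x + μ • u) * inner ℝ u e ∂unifSphere d := by
    nth_rewrite 1 [← map_unifSphere (LinearIsometryEquiv.neg ℝ)]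
    rw [integral_map (by fun_prop) (by fun_prop), ← integral_neg]
    simp
  have e5 : ∀ u : EuclideanSpace ℝ (Fin d),
      ((f (x + μ • u) - f (x - μ • u)) / (2 * μ)) * inner ℝ u e =
      (1 / (2 * μ)) * (f (x + μ • u) * inner ℝ u e - f (x - μ • u) * inner ℝ u e) :=
    fun u => by ring
  rw [inner_smul_left, conj_trivial, e3, e1]
  simp only [e5]
  rw [integral_const_mul, integral_sub (integrable_unifSphere hd (by fun_prop))
    (integrable_unifSphere hd (by fun_prop)), e4]
  refine mul_left_cancel₀ hμ.ne' ?_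
  rw [e2]
  field_simp
  ring

end Smoothing

/-! ### Regularity of the objective. -/

namespace ZOProblem

variable {d : ℕ} {Ξ : Type*} [MeasurableSpace Ξ] {pb : ZOProblem d Ξ}

section Objective

variable (h : pb.Assumptions)

include h

theorem Assumptions.smooth_bound (x y : EuclideanSpace ℝ (Fin d)) :
    ∀ᵐ ξ ∂pb.P, |pb.F y ξ - pb.F x ξ - inner ℝ (pb.sampleGrad x ξ) (y - x)| ≤
      pb.L / 2 * ‖y - x‖ ^ 2 := by
  filter_upwards [h.smooth] with ξ hξ
  exact abs_sub_sub_inner_gradient_le hξ.1 hξ.2 x y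

theorem Assumptions.measurable_F_apply (x : EuclideanSpace ℝ (Fin d)) : Measurable (pb.F x) :=
  h.measurable_F.comp measurable_prodMk_left

/-- The coordinates of the sample gradient are almost sure limits of difference quotients of the
measurable function `F`. -/
theorem Assumptions.aestronglyMeasurable_sampleGrad (x : EuclideanSpace ℝ (Fin d)) :
    AEStronglyMeasurable (pb.sampleGrad x) pb.P := by
  set b := EuclideanSpace.basisFun (Fin d) ℝ
  refine aestronglyMeasurable_of_tendsto_ae (u := Filter.atTop)
    (f := fun (n : ℕ) ξ => ∑ i, (((n : ℝ) + 1) *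
      (pb.F (x + (1 / ((n : ℝ) + 1)) • b i) ξ - pb.F x ξ)) • b i) (fun n => ?_) ?_
  · refine Measurable.aestronglyMeasurable (Finset.measurable_sum _ fun i _ => ?_)
    exact (((h.measurable_F_apply _).sub (h.measurable_F_apply _)).const_mul _).smul_const _
  · filter_upwards [h.smooth] with ξ hξ
    have e : pb.sampleGrad x ξ = ∑ i, (inner ℝ (pb.sampleGrad x ξ) (b i)) • b i := by
      conv_lhs => rw [← b.sum_repr' (pb.sampleGrad x ξ)]
      simp only [real_inner_comm]
    rw [e]
    refine tendsto_finsetSum _ fun i _ => Filter.Tendsto.smul_const ?_ _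
    have hd : HasLineDerivAt ℝ (fun z => pb.F z ξ) (inner ℝ (pb.sampleGrad x ξ) (b i)) x (b i) := by
      have := (hξ.1 x).hasGradientAt.hasFDerivAt.hasLineDerivAt (b i)
      simpa [sampleGrad] using this
    have := (hasDerivAt_iff_tendsto_slope_zero.mp hd).comp
      (tendsto_nhdsWithin_iff.mpr ⟨tendsto_one_div_add_atTop_nhds_zero_nat (𝕜 := ℝ),
        Filter.Eventually.of_forall fun n => by
          simp only [Set.mem_compl_iff, Set.mem_singleton_iff]; positivity⟩)
    refine this.congr fun n => ?_
    simp

theorem Assumptions.integrable_sampleGrad (x : EuclideanSpace ℝ (Fin d)) :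
    Integrable (pb.sampleGrad x) pb.P := by
  have := h.prob
  obtain ⟨y, hy⟩ := h.integrable_grad
  have : Integrable (fun ξ => pb.sampleGrad x ξ - pb.sampleGrad y ξ) pb.P := by
    refine Integrable.of_bound ((h.aestronglyMeasurable_sampleGrad x).sub
      (h.aestronglyMeasurable_sampleGrad y)) (pb.L * ‖x - y‖) ?_
    filter_upwards [h.smooth] with ξ hξ using hξ.2 x y
  exact (this.add hy).congr (Filter.Eventually.of_forall fun ξ => by simp)

/-- The quadratic remainder bound holds with the same constant for almost every `ξ`, so it survives
integration. No separate theorem on differentiating under the integral is needed. -/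
theorem Assumptions.hasGradientAt_f (x : EuclideanSpace ℝ (Fin d)) :
    HasGradientAt pb.f (∫ ξ, pb.sampleGrad x ξ ∂pb.P) x := by
  have := h.prob
  have hb : ∀ y, ‖pb.f y - pb.f x - inner ℝ (∫ ξ, pb.sampleGrad x ξ ∂pb.P) (y - x)‖ ≤
      pb.L / 2 * ‖y - x‖ ^ 2 := by
    intro y
    have hi : Integrable (fun ξ => inner ℝ (pb.sampleGrad x ξ) (y - x)) pb.P :=
      (h.integrable_sampleGrad x).inner_const _
    have e : inner ℝ (∫ ξ, pb.sampleGrad x ξ ∂pb.P) (y - x) =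
        ∫ ξ, inner ℝ (pb.sampleGrad x ξ) (y - x) ∂pb.P := by
      rw [real_inner_comm, ← integral_inner (h.integrable_sampleGrad x)]
      simp only [real_inner_comm]
    have e' : pb.f y - pb.f x - ∫ ξ, inner ℝ (pb.sampleGrad x ξ) (y - x) ∂pb.P =
        ∫ ξ, (pb.F y ξ - pb.F x ξ - inner ℝ (pb.sampleGrad x ξ) (y - x)) ∂pb.P := by
      rw [f, f, ← integral_sub (h.integrable_F y) (h.integrable_F x)]
      exact (integral_sub ((h.integrable_F y).sub (h.integrable_F x)) hi).symm
    rw [e, e']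
    exact (norm_integral_le_of_norm_le_const (h.smooth_bound x y)).trans (by simp)
  rw [hasGradientAt_iff_hasFDerivAt, hasFDerivAt_iff_isLittleO]
  refine Asymptotics.IsBigO.trans_isLittleO (g := fun y => ‖y - x‖ ^ 2) ?_ ?_
  · refine Asymptotics.IsBigO.of_bound (pb.L / 2) (Filter.Eventually.of_forall fun y => ?_)
    simpa using hb y
  · exact Asymptotics.isLittleO_pow_sub_sub x one_lt_two

theorem Assumptions.differentiable_f : Differentiable ℝ pb.f :=
  fun x => (h.hasGradientAt_f x).differentiableAt

theorem Assumptions.gradient_f (x : EuclideanSpace ℝ (Fin d)) :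
    gradient pb.f x = ∫ ξ, pb.sampleGrad x ξ ∂pb.P := (h.hasGradientAt_f x).gradient

theorem Assumptions.lipschitz_gradient_f (x y : EuclideanSpace ℝ (Fin d)) :
    ‖gradient pb.f x - gradient pb.f y‖ ≤ pb.L * ‖x - y‖ := by
  have := h.prob
  rw [h.gradient_f, h.gradient_f, ← integral_sub (h.integrable_sampleGrad x)
    (h.integrable_sampleGrad y)]
  refine (norm_integral_le_of_norm_le_const (C := pb.L * ‖x - y‖) ?_).trans (by simp)
  filter_upwards [h.smooth] with ξ hξ using hξ.2 x y

theorem Assumptions.fStar_le (x : EuclideanSpace ℝ (Fin d)) : pb.fStar ≤ pb.f x :=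
  ciInf_le h.bddBelow x

theorem Assumptions.gap_nonneg : 0 ≤ pb.gap := sub_nonneg.mpr (h.fStar_le _)

theorem Assumptions.sq_norm_gradient_f_le (x : EuclideanSpace ℝ (Fin d)) :
    ‖gradient pb.f x‖ ^ 2 ≤ 2 * pb.L * (pb.f x - pb.fStar) :=
  sq_norm_gradient_le h.differentiable_f h.L_pos h.lipschitz_gradient_f h.fStar_le x

end Objective

end ZOProblem

/-! ### Weak tails along a random direction. -/

section Tail

variable {d : ℕ} {Ξ : Type*} [MeasurableSpace Ξ]

theorem integral_abs_inner_rpow_unifSphere_le (hd : 1 ≤ d) {p : ℝ} (hp0 : 0 < p) (hp : p ≤ 2)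
    {e : EuclideanSpace ℝ (Fin d)} (he : ‖e‖ = 1) :
    ∫⁻ u, ENNReal.ofReal ((Real.sqrt d * |inner ℝ e u|) ^ p) ∂unifSphere d ≤ 1 := by
  have := isProbabilityMeasure_unifSphere hd
  have hd0 : (0 : ℝ) < d := by positivity
  -- Bernoulli's inequality for the exponent `p / 2 ≤ 1`, applied to `d ⟨e, u⟩²`, whose mean is `1`.
  -- The correction term integrates to zero.
  have hpt : ∀ u : EuclideanSpace ℝ (Fin d), (Real.sqrt d * |inner ℝ e u|) ^ p ≤
      1 + p / 2 * (d * (inner ℝ e u) ^ 2 - 1) := by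
    intro u
    have h1 : (Real.sqrt d * |inner ℝ e u|) ^ p = (d * (inner ℝ e u) ^ 2) ^ (p / 2) := by
      have : (d * (inner ℝ e u) ^ 2) = (Real.sqrt d * |inner ℝ e u|) ^ (2 : ℝ) := by
        rw [Real.rpow_two, mul_pow, Real.sq_sqrt hd0.le, sq_abs]
      rw [this, ← Real.rpow_mul (by positivity)]
      congr 1; ring
    have h2 := rpow_one_add_le_one_add_mul_self (s := d * (inner ℝ e u) ^ 2 - 1)
      (by have : 0 ≤ (d : ℝ) * (inner ℝ e u) ^ 2 := by positivity
          linarith) (p := p / 2) (by positivity) (by linarith)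
    rw [h1]
    simpa using h2
  have hint : Integrable (fun u => 1 + p / 2 * (d * (inner ℝ e u) ^ 2 - 1)) (unifSphere d) :=
    integrable_unifSphere hd (by fun_prop)
  refine (lintegral_mono fun u => ENNReal.ofReal_le_ofReal (hpt u)).trans ?_
  rw [← ofReal_integral_eq_lintegral_ofReal hint (Filter.Eventually.of_forall fun u =>
    (by positivity : (0 : ℝ) ≤ (Real.sqrt d * |inner ℝ e u|) ^ p).trans (hpt u)),
    integral_add (integrable_const _) (integrable_unifSphere hd (by fun_prop)), integral_const_mul,
    integral_sub (integrable_unifSphere hd (by fun_prop)) (integrable_const _),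
    integral_const_mul, integral_inner_sq_unifSphere hd, he]
  simp [hd0.ne']

/-- A weak tail of a random vector gains `√d` when tested against a uniform direction. -/
theorem measure_abs_inner_le (hd : 1 ≤ d) {p σ : ℝ} (hp0 : 0 < p) (hp : p ≤ 2) (hσ : 0 ≤ σ)
    (P : Measure Ξ) [IsProbabilityMeasure P] {η : Ξ → EuclideanSpace ℝ (Fin d)}
    (hη : AEStronglyMeasurable η P)
    (htail : ∀ t : ℝ, 0 < t → P {ξ | t < ‖η ξ‖} ≤ ENNReal.ofReal ((σ / t) ^ p))
    {t : ℝ} (ht : 0 < t) :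
    ((unifSphere d).prod P) {z | t < |inner ℝ (η z.2) z.1|} ≤
      ENNReal.ofReal ((σ / (Real.sqrt d * t)) ^ p) := by
  have := isProbabilityMeasure_unifSphere hd
  have hd0 : (0 : ℝ) < d := by positivity
  wlog hm : Measurable η generalizing η
  · have hmk := hη.ae_eq_mk
    have h1 := this (hη.stronglyMeasurable_mk.aestronglyMeasurable) (fun t ht => by
      refine le_trans (measure_mono_ae ?_) (htail t ht)
      filter_upwards [hmk] with ξ hξ
      intro hlt
      have hlt' : t < ‖hη.mk η ξ‖ := hlt
      rwa [← hξ] at hlt') hη.stronglyMeasurable_mk.measurable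
    refine le_trans (measure_mono_ae ?_) h1
    have h2 : ∀ᵐ z ∂(unifSphere d).prod P, η z.2 = hη.mk η z.2 :=
      Measure.quasiMeasurePreserving_snd.ae hmk
    filter_upwards [h2] with z hz
    intro hlt
    have hlt' : t < |inner ℝ (η z.2) z.1| := hlt
    rwa [hz] at hlt'
  set e : EuclideanSpace ℝ (Fin d) := EuclideanSpace.basisFun (Fin d) ℝ ⟨0, hd⟩
  have he : ‖e‖ = 1 := by simp [e]
  -- By rotation invariance the direction of `η ξ` is irrelevant and only its norm matters. Fubini
  -- in the other order then allows the tail of the norm to be used at level `t / |⟨e, u⟩|` for each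
  -- fixed `u`.
  have hcomp : ∀ ξ, unifSphere d {u | t < |inner ℝ (η ξ) u|} =
      unifSphere d {u | t < ‖η ξ‖ * |inner ℝ e u|} := by
    intro ξ
    have hmap := map_inner_unifSphere (e := η ξ) (e' := ‖η ξ‖ • e) (by simp [norm_smul, he])
    have hs : MeasurableSet {y : ℝ | t < |y|} := measurableSet_lt measurable_const (by fun_prop)
    have h1 := congrArg (fun m => m {y : ℝ | t < |y|}) hmap
    rw [Measure.map_apply (by fun_prop) hs, Measure.map_apply (by fun_prop) hs] at h1
    simpa [inner_smul_left, abs_mul] using h1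
  have hs1 : MeasurableSet {z : EuclideanSpace ℝ (Fin d) × Ξ | t < |inner ℝ (η z.2) z.1|} := by
    refine measurableSet_lt measurable_const ?_
    have : Measurable fun z : EuclideanSpace ℝ (Fin d) × Ξ => inner ℝ (η z.2) z.1 :=
      (hm.comp measurable_snd).inner measurable_fst
    exact this.abs
  have hs2 : MeasurableSet
      {z : EuclideanSpace ℝ (Fin d) × Ξ | t < ‖η z.2‖ * |inner ℝ e z.1|} := by
    refine measurableSet_lt measurable_const ?_
    exact ((hm.comp measurable_snd).norm).mul
      ((measurable_const.inner measurable_fst).abs)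
  calc ((unifSphere d).prod P) {z | t < |inner ℝ (η z.2) z.1|}
      = ∫⁻ ξ, unifSphere d {u | t < |inner ℝ (η ξ) u|} ∂P := by
        rw [Measure.prod_apply_symm hs1]; rfl
    _ = ∫⁻ ξ, unifSphere d {u | t < ‖η ξ‖ * |inner ℝ e u|} ∂P := by simp only [hcomp]
    _ = ((unifSphere d).prod P) {z | t < ‖η z.2‖ * |inner ℝ e z.1|} := by
        rw [Measure.prod_apply_symm hs2]; rfl
    _ = ∫⁻ u, P {ξ | t < ‖η ξ‖ * |inner ℝ e u|} ∂unifSphere d := by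
        rw [Measure.prod_apply hs2]; rfl
    _ ≤ ∫⁻ u, ENNReal.ofReal ((σ / (Real.sqrt d * t)) ^ p) *
          ENNReal.ofReal ((Real.sqrt d * |inner ℝ e u|) ^ p) ∂unifSphere d := by
        refine lintegral_mono fun u => ?_
        rw [← ENNReal.ofReal_mul (by positivity), ← Real.mul_rpow (by positivity) (by positivity)]
        rcases (abs_nonneg (inner ℝ e u)).eq_or_lt with h0 | hpos
        · simp [← h0, not_lt.mpr ht.le]
        · have : {ξ | t < ‖η ξ‖ * |inner ℝ e u|} = {ξ | t / |inner ℝ e u| < ‖η ξ‖} := by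
            ext ξ; simp [div_lt_iff₀ hpos]
          rw [this]
          refine (htail _ (by positivity)).trans (le_of_eq ?_)
          congr 2
          field_simp
    _ ≤ ENNReal.ofReal ((σ / (Real.sqrt d * t)) ^ p) * 1 := by
        rw [lintegral_const_mul _ (by fun_prop)]
        gcongr
        exact integral_abs_inner_rpow_unifSphere_le hd hp0 hp he
    _ = _ := mul_one _

end Tail

/-! ### The tail of the two-point slope. -/

namespace ZOProblem

variable {d : ℕ} {Ξ : Type*} [MeasurableSpace Ξ] {pb : ZOProblem d Ξ}

/-- The joint law of one sample `(u, ξ)`. -/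
def sampleLaw (pb : ZOProblem d Ξ) : Measure (EuclideanSpace ℝ (Fin d) × Ξ) :=
  (unifSphere d).prod pb.P

/-- The value of the two-point directional derivative. -/
def slope (pb : ZOProblem d Ξ) (μ : ℝ) (x : EuclideanSpace ℝ (Fin d))
    (z : EuclideanSpace ℝ (Fin d) × Ξ) : ℝ :=
  (pb.F (x + μ • z.1) z.2 - pb.F (x - μ • z.1) z.2) / (2 * μ)

section

variable (h : pb.Assumptions)

include h

theorem Assumptions.isProbabilityMeasure_sampleLaw : IsProbabilityMeasure pb.sampleLaw := by
  have := h.prob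
  have := isProbabilityMeasure_unifSphere h.d_pos
  unfold sampleLaw
  infer_instance

theorem Assumptions.ae_norm_fst : ∀ᵐ z ∂pb.sampleLaw, ‖z.1‖ = 1 := by
  have := h.prob
  exact Measure.quasiMeasurePreserving_fst.ae ae_norm_eq_one_unifSphere

theorem Assumptions.measurable_slope (μ : ℝ) :
    Measurable fun q : EuclideanSpace ℝ (Fin d) × (EuclideanSpace ℝ (Fin d) × Ξ) =>
      pb.slope μ q.1 q.2 := by
  have h1 : Measurable fun q : EuclideanSpace ℝ (Fin d) × (EuclideanSpace ℝ (Fin d) × Ξ) =>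
      pb.F (q.1 + μ • q.2.1) q.2.2 :=
    h.measurable_F.comp (f := fun q : EuclideanSpace ℝ (Fin d) × (EuclideanSpace ℝ (Fin d) × Ξ) =>
      (q.1 + μ • q.2.1, q.2.2)) (by fun_prop)
  have h2 : Measurable fun q : EuclideanSpace ℝ (Fin d) × (EuclideanSpace ℝ (Fin d) × Ξ) =>
      pb.F (q.1 - μ • q.2.1) q.2.2 :=
    h.measurable_F.comp (f := fun q : EuclideanSpace ℝ (Fin d) × (EuclideanSpace ℝ (Fin d) × Ξ) =>
      (q.1 - μ • q.2.1, q.2.2)) (by fun_prop)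
  exact (h1.sub h2).div_const _

theorem Assumptions.measurable_slope_apply (μ : ℝ) (x : EuclideanSpace ℝ (Fin d)) :
    Measurable (pb.slope μ x) := (h.measurable_slope μ).comp measurable_prodMk_left

theorem Assumptions.ae_smooth_sampleLaw : ∀ᵐ z ∂pb.sampleLaw,
    Differentiable ℝ (fun x => pb.F x z.2) ∧
    ∀ x y, ‖pb.sampleGrad x z.2 - pb.sampleGrad y z.2‖ ≤ pb.L * ‖x - y‖ := by
  have := h.prob
  exact Measure.quasiMeasurePreserving_snd.ae h.smooth

/-- The two-point derivative is the directional derivative up to the smoothing error. -/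
theorem Assumptions.ae_abs_slope_sub_le {μ : ℝ} (hμ : 0 < μ) (x : EuclideanSpace ℝ (Fin d)) :
    ∀ᵐ z ∂pb.sampleLaw, |pb.slope μ x z - inner ℝ (pb.sampleGrad x z.2) z.1| ≤ pb.L * μ / 2 := by
  filter_upwards [h.ae_norm_fst, h.ae_smooth_sampleLaw] with z hz hs
  have h1 := abs_le.mp (abs_sub_sub_inner_gradient_le hs.1 hs.2 x (x + μ • z.1))
  have h2 := abs_le.mp (abs_sub_sub_inner_gradient_le hs.1 hs.2 x (x - μ • z.1))
  simp only [add_sub_cancel_left, sub_sub_cancel_left, norm_neg, norm_smul, hz, mul_one,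
    Real.norm_of_nonneg hμ.le, inner_neg_right, inner_smul_right] at h1 h2
  have e : pb.slope μ x z - inner ℝ (pb.sampleGrad x z.2) z.1 =
      (pb.F (x + μ • z.1) z.2 - pb.F (x - μ • z.1) z.2 -
        2 * (μ * inner ℝ (pb.sampleGrad x z.2) z.1)) / (2 * μ) := by
    rw [slope]; field_simp
  rw [e, abs_div, abs_of_pos (by positivity : 0 < 2 * μ), div_le_iff₀ (by positivity), abs_le]
  rw [sampleGrad]
  constructor <;> nlinarith [h1.1, h1.2, h2.1, h2.2]

theorem Assumptions.measure_slope_le {μ : ℝ} (hμ : 0 < μ) (x : EuclideanSpace ℝ (Fin d)) {A : ℝ}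
    (hA1 : 4 * (‖gradient pb.f x‖ + pb.σ) / Real.sqrt d ≤ A) (hA2 : 2 * pb.L * μ ≤ A)
    {t : ℝ} (ht : 0 < t) :
    pb.sampleLaw {z | t < |pb.slope μ x z|} ≤ ENNReal.ofReal ((A / t) ^ pb.p) := by
  have := h.prob
  have := h.isProbabilityMeasure_sampleLaw
  have hp := h.one_lt_p
  have hd0 : (0 : ℝ) < d := by have := h.d_pos; positivity
  have hσ := h.σ_pos
  have hL := h.L_pos
  by_cases htA : t ≤ A
  · refine prob_le_one.trans ?_
    rw [ENNReal.one_le_ofReal]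
    exact Real.one_le_rpow ((one_le_div ht).mpr htA) (by linarith)
  push Not at htA
  set g := gradient pb.f x
  have htail1 : ∀ t : ℝ, 0 < t → pb.P {ξ | t < ‖pb.sampleGrad x ξ - g‖} ≤
      ENNReal.ofReal ((pb.σ / t) ^ pb.p) := by
    intro t ht
    rw [← ofReal_measureReal]
    exact ENNReal.ofReal_le_ofReal (h.weak_noise x t ht)
  -- A constant has a weak tail at its own norm, so the mean gradient gains the factor `√d` from the
  -- same lemma as the noise.
  have htail2 : ∀ t : ℝ, 0 < t → pb.P {_ξ | t < ‖g‖} ≤ ENNReal.ofReal ((‖g‖ / t) ^ pb.p) := by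
    intro t ht
    by_cases hg : t < ‖g‖
    · refine prob_le_one.trans ?_
      rw [ENNReal.one_le_ofReal]
      exact Real.one_le_rpow ((one_le_div ht).mpr hg.le) (by linarith)
    · simp [hg]
  have ht4 : 0 < t / 4 := by positivity
  have b1 := measure_abs_inner_le h.d_pos (by linarith) h.p_le_two hσ.le pb.P
    ((h.aestronglyMeasurable_sampleGrad x).sub aestronglyMeasurable_const) htail1 ht4
  have b2 := measure_abs_inner_le h.d_pos (by linarith) h.p_le_two (norm_nonneg g) pb.P
    (η := fun _ => g) aestronglyMeasurable_const htail2 ht4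
  -- Noise, mean and smoothing error get `t / 4` each. The last is at most `L μ / 2 ≤ A / 4 < t / 4`
  -- and excludes no sample.
  have hsub : pb.sampleLaw {z | t < |pb.slope μ x z|} ≤
      pb.sampleLaw ({z | t / 4 < |inner ℝ (pb.sampleGrad x z.2 - g) z.1|} ∪
        {z | t / 4 < |inner ℝ g z.1|}) := by
    refine measure_mono_ae ?_
    filter_upwards [h.ae_abs_slope_sub_le hμ x] with z hz hzt
    have hzt' : t < |pb.slope μ x z| := hzt
    by_contra hcon
    have hc : |inner ℝ (pb.sampleGrad x z.2 - g) z.1| ≤ t / 4 ∧ |inner ℝ g z.1| ≤ t / 4 := by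
      constructor
      · by_contra hh; exact hcon (Or.inl (not_le.mp hh))
      · by_contra hh; exact hcon (Or.inr (not_le.mp hh))
    rw [inner_sub_left] at hc
    have h1 := abs_le.mp hz
    have h2 := abs_le.mp hc.1
    have h3 := abs_le.mp hc.2
    have : |pb.slope μ x z| ≤ 3 * t / 4 := abs_le.mpr ⟨by linarith, by linarith⟩
    linarith
  refine hsub.trans ((measure_union_le _ _).trans ((add_le_add b1 b2).trans ?_))
  rw [← ENNReal.ofReal_add (by positivity) (by positivity)]
  refine ENNReal.ofReal_le_ofReal ?_
  -- Since `p ≥ 1`, powers are superadditive, and the two tails merge at the sum of their scales.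
  refine (Real.add_rpow_le_rpow_add (by positivity) (by positivity) hp.le).trans ?_
  refine Real.rpow_le_rpow (by positivity) ?_ (by linarith)
  rw [← add_div, div_le_div_iff₀ (by positivity) ht]
  rw [div_le_iff₀ (by positivity)] at hA1
  nlinarith [Real.sqrt_nonneg (d : ℝ)]

end

end ZOProblem

/-! ### Moments of a clipped variable with a weak tail. -/

section Clip

theorem abs_clip {τ : ℝ} (hτ : 0 ≤ τ) (z : ℝ) : |clip τ z| = min |z| τ := by
  rcases (abs_nonneg z).eq_or_lt with h | h
  · simp [clip, abs_eq_zero.mp h.symm, hτ]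
  · rw [clip, abs_mul, abs_of_nonneg (a := min 1 (τ / |z|)) (by positivity),
      mul_min_of_nonneg _ _ h.le, mul_one, mul_div_cancel₀ _ h.ne']

theorem abs_sub_clip {τ : ℝ} (hτ : 0 ≤ τ) (z : ℝ) : |z - clip τ z| = max 0 (|z| - τ) := by
  rcases (abs_nonneg z).eq_or_lt with h | h
  · simp [clip, abs_eq_zero.mp h.symm, hτ]
  · have e : z - clip τ z = z * (1 - min 1 (τ / |z|)) := by rw [clip]; ring
    rw [e, abs_mul, abs_of_nonneg (a := 1 - min 1 (τ / |z|)) (by simp),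
      mul_sub, mul_min_of_nonneg _ _ h.le, mul_one, mul_div_cancel₀ _ h.ne']
    rcases le_total |z| τ with h1 | h1
    · rw [min_eq_left h1, max_eq_left (by linarith), sub_self]
    · rw [min_eq_right h1, max_eq_right (by linarith)]

theorem measurable_clip (τ : ℝ) : Measurable (clip τ) := by
  unfold clip
  fun_prop

variable {Z : Type*} [MeasurableSpace Z] {ν : Measure Z} {Y : Z → ℝ}
  {p A : ℝ}

theorem lintegral_Ioc_inv {s τ : ℝ} (hs : 0 < s) (hsτ : s ≤ τ) :
    ∫⁻ t in Set.Ioc s τ, ENNReal.ofReal t⁻¹ = ENNReal.ofReal (Real.log (τ / s)) := by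
  have hi : IntervalIntegrable (fun t : ℝ => t⁻¹) volume s τ := by
    refine ContinuousOn.intervalIntegrable fun t ht => ?_
    rw [Set.uIcc_of_le hsτ] at ht
    exact (continuousAt_inv₀ (by linarith [ht.1])).continuousWithinAt
  rw [← integral_inv_of_pos hs (hs.trans_le hsτ), intervalIntegral.integral_of_le hsτ,
    ofReal_integral_eq_lintegral_ofReal
      ((intervalIntegrable_iff_integrableOn_Ioc_of_le hsτ).mp hi)]
  filter_upwards [ae_restrict_mem measurableSet_Ioc] with t ht
  exact inv_nonneg.mpr (hs.trans ht.1).le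

/-- The second moment of a clipped variable with a weak tail. -/
theorem lintegral_clip_sq_le [IsProbabilityMeasure ν] (hY : Measurable Y) (hp : p ≤ 2) (hA : 0 ≤ A)
    (htail : ∀ t : ℝ, 0 < t → ν {z | t < |Y z|} ≤ ENNReal.ofReal ((A / t) ^ p))
    {s τ : ℝ} (hs : 0 < s) (hsτ : s ≤ τ) :
    ∫⁻ z, ENNReal.ofReal ((clip τ (Y z)) ^ 2) ∂ν ≤
      ENNReal.ofReal (s ^ 2 + 2 * A ^ p * τ ^ (2 - p) * Real.log (τ / s)) := by
  have hτ : 0 < τ := hs.trans_le hsτ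
  have hlog : 0 ≤ Real.log (τ / s) := Real.log_nonneg ((one_le_div hs).mpr hsτ)
  have hI : ∀ y : ℝ, ∫ t in (0 : ℝ)..y, 2 * t = y ^ 2 := fun y => by
    rw [intervalIntegral.integral_const_mul, integral_id]; ring
  have hlc := lintegral_comp_eq_lintegral_meas_lt_mul ν (f := fun z => min |Y z| τ)
    (g := fun t => 2 * t) (Filter.Eventually.of_forall fun z => le_min (abs_nonneg _) hτ.le)
    (by fun_prop) (fun t _ => (by fun_prop : Continuous fun t : ℝ => 2 * t).intervalIntegrable _ _)
    ((ae_restrict_mem measurableSet_Ioi).mono fun t ht => by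
      have : (0 : ℝ) < t := ht
      positivity)
  have e : ∀ z, ENNReal.ofReal ((clip τ (Y z)) ^ 2) =
      ENNReal.ofReal (∫ t in (0 : ℝ)..(min |Y z| τ), 2 * t) := fun z => by
    rw [hI, ← abs_clip hτ.le, sq_abs]
  simp only [e, hlc]
  -- Below `s` the probability is bounded by `1`. Between `s` and `τ` the integrand `2 A^p t^(1-p)`
  -- is bounded by `2 A^p τ^(2-p) / t`, which gives the logarithm and avoids a constant `1 / (2 -
  -- p)`.
  have hle : ∀ t ∈ Set.Ioi (0 : ℝ), ν {z | t < min |Y z| τ} * ENNReal.ofReal (2 * t) ≤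
      (Set.Ioc 0 s).indicator (fun t => ENNReal.ofReal (2 * t)) t +
      (Set.Ioc s τ).indicator (fun t => ENNReal.ofReal (2 * A ^ p * τ ^ (2 - p)) *
        ENNReal.ofReal t⁻¹) t := by
    intro t ht
    have ht0 : 0 < t := ht
    rcases le_or_gt t s with h1 | h1
    · rw [Set.indicator_of_mem (show t ∈ Set.Ioc 0 s from ⟨ht, h1⟩)]
      refine le_add_right ?_
      exact (mul_le_mul_left prob_le_one _).trans (by rw [one_mul])
    · rcases lt_or_ge t τ with h2 | h2
      · rw [Set.indicator_of_mem (show t ∈ Set.Ioc s τ from ⟨h1, h2.le⟩),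
          ← ENNReal.ofReal_mul (by positivity)]
        refine le_add_left ?_
        have h3 : ν {z | t < min |Y z| τ} ≤ ENNReal.ofReal ((A / t) ^ p) :=
          (measure_mono (show {z | t < min |Y z| τ} ⊆ {z | t < |Y z|} from
            fun z (hz : t < min |Y z| τ) => (lt_min_iff.mp hz).1)).trans (htail t ht0)
        refine (mul_le_mul_left h3 _).trans ?_
        rw [← ENNReal.ofReal_mul (by positivity)]
        refine ENNReal.ofReal_le_ofReal ?_
        rw [Real.div_rpow hA ht0.le]
        have h4 : t ^ (2 - p) ≤ τ ^ (2 - p) := Real.rpow_le_rpow ht0.le h2.le (by linarith)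
        have h5 : A ^ p / t ^ p * (2 * t) = 2 * A ^ p * t ^ (2 - p) * t⁻¹ := by
          rw [Real.rpow_sub ht0, Real.rpow_two]
          field_simp
        rw [h5]
        gcongr
      · have : {z | t < min |Y z| τ} = ∅ := by
          ext z
          simp only [Set.mem_ofPred_eq, lt_min_iff, Set.mem_empty_iff_false, iff_false, not_and,
            not_lt]
          exact fun _ => h2
        rw [this, measure_empty, zero_mul]
        exact zero_le
  refine (setLIntegral_mono' measurableSet_Ioi hle).trans ?_
  refine (setLIntegral_le_lintegral _ _).trans ?_
  rw [lintegral_add_left ((by fun_prop : Measurable fun t : ℝ =>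
      ENNReal.ofReal (2 * t)).indicator measurableSet_Ioc),
    lintegral_indicator measurableSet_Ioc, lintegral_indicator measurableSet_Ioc,
    lintegral_const_mul _ (by fun_prop), lintegral_Ioc_inv hs hsτ,
    ← ofReal_integral_eq_lintegral_ofReal, ← intervalIntegral.integral_of_le hs.le, hI,
    ← ENNReal.ofReal_mul (by positivity), ← ENNReal.ofReal_add (by positivity) (by positivity)]
  · exact ((by fun_prop : Continuous fun t : ℝ => 2 * t).intervalIntegrable 0 s).1
  · filter_upwards [ae_restrict_mem measurableSet_Ioc] with t ht
    have := ht.1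
    positivity

/-- The clipping bias of a variable with a weak tail. -/
theorem lintegral_abs_sub_clip_le (hY : Measurable Y) (hp : 1 < p) (hA : 0 ≤ A)
    (htail : ∀ t : ℝ, 0 < t → ν {z | t < |Y z|} ≤ ENNReal.ofReal ((A / t) ^ p))
    {τ : ℝ} (hτ : 0 < τ) :
    ∫⁻ z, ENNReal.ofReal |Y z - clip τ (Y z)| ∂ν ≤
      ENNReal.ofReal (A ^ p * τ ^ (1 - p) / (p - 1)) := by
  simp only [abs_sub_clip hτ.le]
  rw [lintegral_eq_lintegral_meas_lt ν (f := fun z => max 0 (|Y z| - τ))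
    (Filter.Eventually.of_forall fun z => le_max_left _ _) (by fun_prop)]
  -- The excess over `τ` exceeds `t` exactly when `|Y|` exceeds `t + τ`. The tail integral from `τ`
  -- converges because `p > 1` and produces the factor `1 / (p - 1)`.
  have hle : ∀ t ∈ Set.Ioi (0 : ℝ), ν {z | t < max 0 (|Y z| - τ)} ≤
      ENNReal.ofReal (A ^ p) * ENNReal.ofReal ((t + τ) ^ (-p)) := by
    intro t ht
    have ht0 : 0 < t := ht
    have h1 : {z | t < max 0 (|Y z| - τ)} = {z | t + τ < |Y z|} := by
      ext z
      simp only [Set.mem_ofPred_eq, lt_max_iff]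
      constructor
      · rintro (h | h) <;> linarith
      · intro h; right; linarith
    rw [h1, ← ENNReal.ofReal_mul (by positivity)]
    refine (htail _ (by positivity)).trans (ENNReal.ofReal_le_ofReal ?_)
    rw [Real.div_rpow hA (by positivity), Real.rpow_neg (by positivity), div_eq_mul_inv]
  refine (setLIntegral_mono' measurableSet_Ioi hle).trans ?_
  rw [lintegral_const_mul _ (by fun_prop)]
  have hshift : ∫⁻ t in Set.Ioi (0 : ℝ), ENNReal.ofReal ((t + τ) ^ (-p)) =
      ∫⁻ t in Set.Ioi τ, ENNReal.ofReal (t ^ (-p)) := by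
    have := (measurePreserving_add_right (volume : Measure ℝ) τ).setLIntegral_comp_preimage
      (measurableSet_Ioi (a := τ)) (f := fun t => ENNReal.ofReal (t ^ (-p))) (by fun_prop)
    rw [← this]
    congr 2
    ext t; simp
  rw [hshift, ← ofReal_integral_eq_lintegral_ofReal
    (integrableOn_Ioi_rpow_of_lt (by linarith) hτ), integral_Ioi_rpow_of_lt (by linarith) hτ,
    ← ENNReal.ofReal_mul (by positivity)]
  · refine ENNReal.ofReal_le_ofReal (le_of_eq ?_)
    have h1 : -p + 1 = 1 - p := by ring
    have h2 : (1 - p) ≠ 0 := by linarith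
    have h3 : (p - 1) ≠ 0 := by linarith
    rw [h1]
    field_simp
    ring
  · filter_upwards [ae_restrict_mem measurableSet_Ioi] with t ht
    have : 0 < t := hτ.trans ht
    positivity

end Clip

/-! ### The σ-algebras of past samples. -/

section SamplesBefore

variable {Ω Z ι : Type*} [MeasurableSpace Z]

/-- The σ-algebra generated by a set of samples. -/
@[reducible]
def samplesBefore (s : ι → Ω → Z) (S : Set ι) : MeasurableSpace Ω :=
  ⨆ i ∈ S, MeasurableSpace.comap (s i) inferInstance

theorem samplesBefore_mono (s : ι → Ω → Z) {S T : Set ι} (h : S ⊆ T) :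
    samplesBefore s S ≤ samplesBefore s T :=
  biSup_mono h

theorem measurable_samplesBefore (s : ι → Ω → Z) {S : Set ι} {i : ι} (hi : i ∈ S) :
    Measurable[samplesBefore s S] (s i) :=
  measurable_iff_comap_le.mpr (le_biSup (fun i => MeasurableSpace.comap (s i) inferInstance) hi)

theorem samplesBefore_le [mΩ : MeasurableSpace Ω] {s : ι → Ω → Z}
    (hs : ∀ i, Measurable (s i)) (S : Set ι) :
    samplesBefore s S ≤ mΩ :=
  iSup₂_le fun i _ => (hs i).comap_le

theorem indepFun_samplesBefore [MeasurableSpace Ω] {Pr : Measure Ω} {s : ι → Ω → Z}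
    (hs : ∀ i, Measurable (s i))
    (hind : iIndepFun s Pr) {S : Set ι} {i : ι} (hi : i ∉ S) {β : Type*} [MeasurableSpace β]
    {X : Ω → β} (hX : Measurable[samplesBefore s S] X) : IndepFun X (s i) Pr := by
  have h := indep_iSup_of_disjoint (fun i => (hs i).comap_le) hind
    (Set.disjoint_singleton_right.mpr hi)
  refine indep_of_indep_of_le_left (indep_of_indep_of_le_right h ?_) (measurable_iff_comap_le.mp hX)
  exact le_biSup (fun i => MeasurableSpace.comap (s i) inferInstance) (Set.mem_singleton i)

end SamplesBefore

/-! ### Concentration of sums of fresh centred increments. -/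

section VectorBernstein

variable {E : Type*} [NormedAddCommGroup E] [InnerProductSpace ℝ E] [CompleteSpace E]
  [MeasurableSpace E] [BorelSpace E] [SecondCountableTopology E]
  {Z : Type*} [MeasurableSpace Z] {ν : Measure Z} [IsProbabilityMeasure ν]

/-- Adding a centred bounded increment multiplies the mean of `cosh ‖·‖` by at most the
exponential of its second moment. -/
theorem lintegral_cosh_norm_add_le {D : Z → E} (hD : Measurable D) (hmean : ∫ z, D z ∂ν = 0)
    (hb : ∀ᵐ z ∂ν, ‖D z‖ ≤ 1) {v : ℝ}
    (hv : ∫⁻ z, ENNReal.ofReal (‖D z‖ ^ 2) ∂ν ≤ ENNReal.ofReal v) (hv0 : 0 ≤ v) (x : E) :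
    ∫⁻ z, ENNReal.ofReal (Real.cosh ‖x + D z‖) ∂ν ≤
      ENNReal.ofReal (Real.exp v) * ENNReal.ofReal (Real.cosh ‖x‖) := by
  have hDi : Integrable D ν := Integrable.of_bound hD.aestronglyMeasurable 1 hb
  have hD2 : Integrable (fun z => ‖D z‖ ^ 2) ν := by
    refine Integrable.of_bound (by fun_prop) 1 ?_
    filter_upwards [hb] with z hz
    rw [Real.norm_of_nonneg (by positivity)]
    exact pow_le_one₀ (norm_nonneg _) hz
  have hv' : ∫ z, ‖D z‖ ^ 2 ∂ν ≤ v := by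
    rw [← ofReal_integral_eq_lintegral_ofReal hD2
      (Filter.Eventually.of_forall fun z => by positivity)] at hv
    exact (ENNReal.ofReal_le_ofReal_iff hv0).mp hv
  have hin : Integrable (fun z => inner ℝ x (D z)) ν := hDi.const_inner x
  have hin0 : ∫ z, inner ℝ x (D z) ∂ν = 0 := by rw [integral_inner hDi, hmean, inner_zero_right]
  have hc := Real.cosh_pos ‖x‖
  have hI0 : Integrable (fun z => 1 + ‖D z‖ ^ 2) ν := (integrable_const 1).add hD2
  have hI1 : Integrable (fun z => Real.cosh ‖x‖ * (1 + ‖D z‖ ^ 2)) ν := hI0.const_mul _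
  have hI2 : Integrable (fun z => Real.sinh ‖x‖ / ‖x‖ * inner ℝ x (D z)) ν := hin.const_mul _
  have hI3 : Integrable (fun z => Real.cosh ‖x‖ * (1 + ‖D z‖ ^ 2)
      + Real.sinh ‖x‖ / ‖x‖ * inner ℝ x (D z)) ν := hI1.add hI2
  calc ∫⁻ z, ENNReal.ofReal (Real.cosh ‖x + D z‖) ∂ν
      ≤ ∫⁻ z, ENNReal.ofReal (Real.cosh ‖x‖ * (1 + ‖D z‖ ^ 2)
          + Real.sinh ‖x‖ / ‖x‖ * inner ℝ x (D z)) ∂ν := by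
        refine lintegral_mono_ae ?_
        filter_upwards [hb] with z hz
        exact ENNReal.ofReal_le_ofReal (cosh_norm_add_le_of_norm_le_one x (D z) hz)
    _ = ENNReal.ofReal (∫ z, (Real.cosh ‖x‖ * (1 + ‖D z‖ ^ 2)
          + Real.sinh ‖x‖ / ‖x‖ * inner ℝ x (D z)) ∂ν) := by
        rw [ofReal_integral_eq_lintegral_ofReal hI3]
        filter_upwards [hb] with z hz
        exact (Real.cosh_pos _).le.trans (cosh_norm_add_le_of_norm_le_one x (D z) hz)
    _ ≤ ENNReal.ofReal (Real.exp v * Real.cosh ‖x‖) := by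
        refine ENNReal.ofReal_le_ofReal ?_
        -- The linear term vanishes because the increment is centred, and what remains is at most `1
        -- + v ≤ exp v`.
        rw [integral_add hI1 hI2,
          integral_const_mul, integral_const_mul, hin0, mul_zero, add_zero,
          integral_add (integrable_const _) hD2]
        simp only [integral_const, probReal_univ, smul_eq_mul, one_mul]
        rw [mul_comm]
        gcongr
        linarith [Real.add_one_le_exp v]
    _ = _ := ENNReal.ofReal_mul (Real.exp_nonneg v)

variable {Ω : Type*} [MeasurableSpace Ω] {Pr : Measure Ω} [IsProbabilityMeasure Pr]
  {E' : Type*} [MeasurableSpace E']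

/-- The conditional form of `lintegral_cosh_norm_add_le`: the increment depends on a past state. -/
theorem lintegral_cosh_norm_add_comp_le {D : E' → Z → E}
    (hD : Measurable fun q : E' × Z => D q.1 q.2)
    (hmean : ∀ x, ∫ z, D x z ∂ν = 0) (hb : ∀ x, ∀ᵐ z ∂ν, ‖D x z‖ ≤ 1) {v : ℝ}
    (hv : ∀ x, ∫⁻ z, ENNReal.ofReal (‖D x z‖ ^ 2) ∂ν ≤ ENNReal.ofReal v) (hv0 : 0 ≤ v)
    {X : Ω → E'} {V : Ω → E} {ζ : Ω → Z} (hX : Measurable X) (hV : Measurable V)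
    (hζ : Measurable ζ) (hlaw : Pr.map ζ = ν) (hind : IndepFun (fun ω => (X ω, V ω)) ζ Pr) :
    ∫⁻ ω, ENNReal.ofReal (Real.cosh ‖V ω + D (X ω) (ζ ω)‖) ∂Pr ≤
      ENNReal.ofReal (Real.exp v) * ∫⁻ ω, ENNReal.ofReal (Real.cosh ‖V ω‖) ∂Pr := by
  -- Independence makes the joint law a product, so the past can be frozen and the unconditional
  -- bound applied inside the integral.
  have hprod := (indepFun_iff_map_prod_eq_prod_map_map (hX.prodMk hV).aemeasurable
    hζ.aemeasurable).mp hind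
  rw [hlaw] at hprod
  have hG : Measurable fun q : (E' × E) × Z =>
      ENNReal.ofReal (Real.cosh ‖q.1.2 + D q.1.1 q.2‖) := by
    have h1 : Measurable fun q : (E' × E) × Z => D q.1.1 q.2 :=
      hD.comp (f := fun q : (E' × E) × Z => (q.1.1, q.2)) (by fun_prop)
    have h2 : Measurable fun q : (E' × E) × Z => q.1.2 + D q.1.1 q.2 :=
      (by fun_prop : Measurable fun q : (E' × E) × Z => q.1.2).add h1
    exact (Real.measurable_cosh.comp h2.norm).ennreal_ofReal
  have hH : Measurable fun q : E' × E => ENNReal.ofReal (Real.cosh ‖q.2‖) :=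
    (Real.measurable_cosh.comp measurable_snd.norm).ennreal_ofReal
  calc ∫⁻ ω, ENNReal.ofReal (Real.cosh ‖V ω + D (X ω) (ζ ω)‖) ∂Pr
      = ∫⁻ q, ENNReal.ofReal (Real.cosh ‖q.1.2 + D q.1.1 q.2‖)
          ∂Pr.map (fun ω => ((X ω, V ω), ζ ω)) :=
        (lintegral_map hG ((hX.prodMk hV).prodMk hζ)).symm
    _ = ∫⁻ q, ∫⁻ z, ENNReal.ofReal (Real.cosh ‖q.2 + D q.1 z‖) ∂ν
          ∂Pr.map (fun ω => (X ω, V ω)) := by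
        rw [hprod, lintegral_prod _ hG.aemeasurable]
    _ ≤ ∫⁻ q, ENNReal.ofReal (Real.exp v) * ENNReal.ofReal (Real.cosh ‖q.2‖)
          ∂Pr.map (fun ω => (X ω, V ω)) :=
        lintegral_mono fun q => lintegral_cosh_norm_add_le
          (hD.comp measurable_prodMk_left) (hmean q.1) (hb q.1) (hv q.1) hv0 q.2
    _ = _ := by
        rw [lintegral_const_mul _ hH, lintegral_map hH (hX.prodMk hV)]

/-- A batch of fresh centred increments, evaluated at a past state. -/
theorem lintegral_cosh_norm_add_sum_le {ι : Type*} {s : ι → Ω → Z}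
    (hs : ∀ i, Measurable (s i)) (hlaw : ∀ i, Pr.map (s i) = ν) (hind : iIndepFun s Pr)
    {D : E' → Z → E} (hD : Measurable fun q : E' × Z => D q.1 q.2)
    (hmean : ∀ x, ∫ z, D x z ∂ν = 0) (hb : ∀ x, ∀ᵐ z ∂ν, ‖D x z‖ ≤ 1) {v : ℝ}
    (hv : ∀ x, ∫⁻ z, ENNReal.ofReal (‖D x z‖ ^ 2) ∂ν ≤ ENNReal.ofReal v) (hv0 : 0 ≤ v)
    {S : Set ι} {X : Ω → E'} {V : Ω → E} (hX : Measurable[samplesBefore s S] X)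
    (hV : Measurable[samplesBefore s S] V) (R : Finset ι) (hR : ∀ i ∈ R, i ∉ S) :
    ∫⁻ ω, ENNReal.ofReal (Real.cosh ‖V ω + ∑ i ∈ R, D (X ω) (s i ω)‖) ∂Pr ≤
      ENNReal.ofReal (Real.exp (R.card * v)) *
        ∫⁻ ω, ENNReal.ofReal (Real.cosh ‖V ω‖) ∂Pr := by
  classical
  induction R using Finset.induction_on with
  | empty => simp
  | insert i R hi ih =>
    have ih' := ih fun j hj => hR j (Finset.mem_insert_of_mem hj)
    -- Batch samples already used are added to the past. The new one is then independent of both the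
    -- state and the partial sum.
    have hiS : i ∉ S ∪ ↑R := by
      simp only [Set.mem_union, Finset.mem_coe, not_or]
      exact ⟨hR i (Finset.mem_insert_self _ _), hi⟩
    have hX' : Measurable[samplesBefore s (S ∪ ↑R)] X :=
      hX.mono (samplesBefore_mono s Set.subset_union_left) le_rfl
    have hV' : Measurable[samplesBefore s (S ∪ ↑R)] fun ω => V ω + ∑ i ∈ R, D (X ω) (s i ω) := by
      refine (hV.mono (samplesBefore_mono s Set.subset_union_left) le_rfl).add ?_
      refine Finset.measurable_sum _ fun j hj => ?_
      exact hD.comp (hX'.prodMk (measurable_samplesBefore s (Or.inr hj)))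
    have hstep := lintegral_cosh_norm_add_comp_le hD hmean hb hv hv0
      (hX'.mono (samplesBefore_le hs _) le_rfl) (hV'.mono (samplesBefore_le hs _) le_rfl)
      (hs i) (hlaw i) (indepFun_samplesBefore hs hind hiS (hX'.prodMk hV'))
    have e : ∀ ω, V ω + ∑ j ∈ insert i R, D (X ω) (s j ω) =
        V ω + ∑ j ∈ R, D (X ω) (s j ω) + D (X ω) (s i ω) := fun ω => by
      rw [Finset.sum_insert hi]; abel
    simp only [e]
    refine hstep.trans ((mul_le_mul_right ih' _).trans (le_of_eq ?_))
    rw [← mul_assoc, ← ENNReal.ofReal_mul (Real.exp_nonneg _), ← Real.exp_add,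
      Finset.card_insert_of_notMem hi]
    congr 3
    push_cast; ring

/-- Markov's inequality for `cosh ‖V‖`, with `cosh r ≥ exp r / 2`. -/
theorem measure_norm_ge_le_of_lintegral_cosh {E Ω : Type*} [NormedAddCommGroup E]
    [MeasurableSpace E] [BorelSpace E] [MeasurableSpace Ω] {Pr : Measure Ω}
    [IsProbabilityMeasure Pr] {V : Ω → E} (hV : Measurable V) {v r : ℝ}
    (h : ∫⁻ ω, ENNReal.ofReal (Real.cosh ‖V ω‖) ∂Pr ≤ ENNReal.ofReal (Real.exp v)) (hr : 0 ≤ r) :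
    Pr.real {ω | r < ‖V ω‖} ≤ 2 * Real.exp (v - r) := by
  have hm : Measurable fun ω => ENNReal.ofReal (Real.cosh ‖V ω‖) :=
    (Real.measurable_cosh.comp hV.norm).ennreal_ofReal
  have h1 := (mul_meas_ge_le_lintegral (μ := Pr) hm (ENNReal.ofReal (Real.cosh r))).trans h
  have h2 : ENNReal.ofReal (Real.cosh r) * Pr {ω | r < ‖V ω‖} ≤ ENNReal.ofReal (Real.exp v) := by
    refine le_trans (mul_le_mul_right (measure_mono ?_) _) h1
    intro ω hω
    have hω' : r < ‖V ω‖ := hω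
    refine ENNReal.ofReal_le_ofReal (Real.cosh_le_cosh.mpr ?_)
    rw [abs_of_nonneg hr, abs_of_nonneg (norm_nonneg _)]
    exact hω'.le
  rw [← ofReal_measureReal, ← ENNReal.ofReal_mul (Real.cosh_pos r).le,
    ENNReal.ofReal_le_ofReal_iff (Real.exp_nonneg v)] at h2
  have h3 : Real.exp r / 2 ≤ Real.cosh r := by
    rw [Real.cosh_eq]; linarith [Real.exp_pos (-r)]
  have h4 : Real.exp r / 2 * Pr.real {ω | r < ‖V ω‖} ≤ Real.exp v :=
    (mul_le_mul_of_nonneg_right h3 measureReal_nonneg).trans h2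
  rw [Real.exp_sub, mul_div_assoc', le_div_iff₀ (Real.exp_pos r)]
  linarith

end VectorBernstein

/-! ### Bias and second moment of the clipped estimator. -/

namespace ZOProblem

variable {d : ℕ} {Ξ : Type*} [MeasurableSpace Ξ] {pb : ZOProblem d Ξ}

/-- The clipped directional estimate of one sample, without the dimension factor. -/
def clipVec (pb : ZOProblem d Ξ) (μ τ : ℝ) (x : EuclideanSpace ℝ (Fin d))
    (z : EuclideanSpace ℝ (Fin d) × Ξ) : EuclideanSpace ℝ (Fin d) :=
  clip τ (pb.slope μ x z) • z.1

/-- The mean of `clipVec`. -/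
def clipMean (pb : ZOProblem d Ξ) (μ τ : ℝ) (x : EuclideanSpace ℝ (Fin d)) :
    EuclideanSpace ℝ (Fin d) :=
  ∫ z, pb.clipVec μ τ x z ∂pb.sampleLaw

/-- The sublevel set in which the iterates stay. -/
def localRegion (pb : ZOProblem d Ξ) (μ : ℝ) : Set (EuclideanSpace ℝ (Fin d)) :=
  {x | pb.f x - pb.fStar ≤ 4 * pb.gapBar μ}

open Classical in
/-- The centred clipped estimate, switched off outside the localization region. -/
def localNoise (pb : ZOProblem d Ξ) (μ τ : ℝ) (x : EuclideanSpace ℝ (Fin d))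
    (z : EuclideanSpace ℝ (Fin d) × Ξ) : EuclideanSpace ℝ (Fin d) :=
  if x ∈ pb.localRegion μ then pb.clipVec μ τ x z - pb.clipMean μ τ x else 0

variable (h : pb.Assumptions)

include h

theorem Assumptions.measurable_clipVec (μ τ : ℝ) :
    Measurable fun q : EuclideanSpace ℝ (Fin d) × (EuclideanSpace ℝ (Fin d) × Ξ) =>
      pb.clipVec μ τ q.1 q.2 :=
  ((measurable_clip τ).comp (h.measurable_slope μ)).smul measurable_snd.fst

theorem Assumptions.measurable_clipVec_apply (μ τ : ℝ) (x : EuclideanSpace ℝ (Fin d)) :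
    Measurable (pb.clipVec μ τ x) :=
  ((measurable_clip τ).comp (h.measurable_slope_apply μ x)).smul measurable_fst

theorem Assumptions.measurable_clipMean (μ τ : ℝ) : Measurable (pb.clipMean μ τ) := by
  have := h.isProbabilityMeasure_sampleLaw
  exact ((h.measurable_clipVec μ τ).stronglyMeasurable.integral_prod_right
    (f := fun x z => pb.clipVec μ τ x z)).measurable

theorem Assumptions.measurableSet_localRegion (μ : ℝ) : MeasurableSet (pb.localRegion μ) :=
  measurableSet_le (h.differentiable_f.continuous.measurable.sub_const _) measurable_const

theorem Assumptions.measurable_localNoise (μ τ : ℝ) :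
    Measurable fun q : EuclideanSpace ℝ (Fin d) × (EuclideanSpace ℝ (Fin d) × Ξ) =>
      pb.localNoise μ τ q.1 q.2 :=
  Measurable.ite (measurable_fst (h.measurableSet_localRegion μ))
    ((h.measurable_clipVec μ τ).sub ((h.measurable_clipMean μ τ).comp measurable_fst))
    measurable_const

theorem Assumptions.ae_norm_clipVec {μ τ : ℝ} (x : EuclideanSpace ℝ (Fin d)) :
    ∀ᵐ z ∂pb.sampleLaw, ‖pb.clipVec μ τ x z‖ = |clip τ (pb.slope μ x z)| := by
  filter_upwards [h.ae_norm_fst] with z hz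
  rw [clipVec, norm_smul, hz, mul_one, Real.norm_eq_abs]

theorem Assumptions.ae_norm_clipVec_le {μ τ : ℝ} (hτ : 0 ≤ τ) (x : EuclideanSpace ℝ (Fin d)) :
    ∀ᵐ z ∂pb.sampleLaw, ‖pb.clipVec μ τ x z‖ ≤ τ := by
  filter_upwards [h.ae_norm_clipVec x] with z hz
  rw [hz, abs_clip hτ]
  exact min_le_right _ _

theorem Assumptions.integrable_clipVec {μ τ : ℝ} (hτ : 0 ≤ τ) (x : EuclideanSpace ℝ (Fin d)) :
    Integrable (pb.clipVec μ τ x) pb.sampleLaw := by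
  have := h.isProbabilityMeasure_sampleLaw
  exact Integrable.of_bound (h.measurable_clipVec_apply μ τ x).aestronglyMeasurable τ
    (h.ae_norm_clipVec_le hτ x)

theorem Assumptions.norm_clipMean_le {μ τ : ℝ} (hτ : 0 ≤ τ) (x : EuclideanSpace ℝ (Fin d)) :
    ‖pb.clipMean μ τ x‖ ≤ τ := by
  have := h.isProbabilityMeasure_sampleLaw
  exact (norm_integral_le_of_norm_le_const (h.ae_norm_clipVec_le hτ x)).trans (by simp)

theorem Assumptions.integral_localNoise {μ τ : ℝ} (hτ : 0 ≤ τ) (x : EuclideanSpace ℝ (Fin d)) :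
    ∫ z, pb.localNoise μ τ x z ∂pb.sampleLaw = 0 := by
  have := h.isProbabilityMeasure_sampleLaw
  by_cases hx : x ∈ pb.localRegion μ
  · simp only [localNoise, hx, if_true]
    rw [integral_sub (h.integrable_clipVec hτ x) (integrable_const _), ← clipMean]
    simp
  · simp [localNoise, hx]

theorem Assumptions.ae_norm_localNoise_le {μ τ : ℝ} (hτ : 0 ≤ τ)
    (x : EuclideanSpace ℝ (Fin d)) :
    ∀ᵐ z ∂pb.sampleLaw, ‖pb.localNoise μ τ x z‖ ≤ 2 * τ := by
  filter_upwards [h.ae_norm_clipVec_le hτ x] with z hz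
  by_cases hx : x ∈ pb.localRegion μ
  · simp only [localNoise, hx, if_true]
    linarith [norm_sub_le (pb.clipVec μ τ x z) (pb.clipMean μ τ x), h.norm_clipMean_le
      (μ := μ) hτ x]
  · simp [localNoise, hx, hτ]

/-- The noise has at most the second moment of the clipped slope. -/
theorem Assumptions.lintegral_norm_localNoise_sq_le {μ τ v : ℝ} (hτ : 0 ≤ τ)
    (hslope : ∀ x ∈ pb.localRegion μ,
      ∫⁻ z, ENNReal.ofReal ((clip τ (pb.slope μ x z)) ^ 2) ∂pb.sampleLaw ≤ ENNReal.ofReal v)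
    (x : EuclideanSpace ℝ (Fin d)) :
    ∫⁻ z, ENNReal.ofReal (‖pb.localNoise μ τ x z‖ ^ 2) ∂pb.sampleLaw ≤ ENNReal.ofReal v := by
  have := h.isProbabilityMeasure_sampleLaw
  by_cases hx : x ∈ pb.localRegion μ
  · refine le_trans ?_ (hslope x hx)
    set c := pb.clipMean μ τ x with hc
    have hm := h.measurable_clipVec_apply μ τ x
    have hi := h.integrable_clipVec (μ := μ) hτ x
    have hi2 : Integrable (fun z => ‖pb.clipVec μ τ x z‖ ^ 2) pb.sampleLaw := by
      refine Integrable.of_bound (by fun_prop) (τ ^ 2) ?_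
      filter_upwards [h.ae_norm_clipVec_le hτ x] with z hz
      rw [Real.norm_of_nonneg (by positivity)]
      gcongr
    have e1 : ∫⁻ z, ENNReal.ofReal ((clip τ (pb.slope μ x z)) ^ 2) ∂pb.sampleLaw =
        ENNReal.ofReal (∫ z, ‖pb.clipVec μ τ x z‖ ^ 2 ∂pb.sampleLaw) := by
      rw [ofReal_integral_eq_lintegral_ofReal hi2
        (Filter.Eventually.of_forall fun z => by positivity)]
      refine lintegral_congr_ae ?_
      filter_upwards [h.ae_norm_clipVec x] with z hz
      rw [hz, sq_abs]
    -- Centring only lowers the second moment: after integration the cross term leaves `-‖c‖²`.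
    have hexp : ∀ z, ‖pb.localNoise μ τ x z‖ ^ 2 =
        ‖pb.clipVec μ τ x z‖ ^ 2 - 2 * inner ℝ c (pb.clipVec μ τ x z) + ‖c‖ ^ 2 := by
      intro z
      simp only [localNoise, hx, if_true]
      rw [norm_sub_sq_real, real_inner_comm]
    have hi3 : Integrable (fun z => 2 * inner ℝ c (pb.clipVec μ τ x z)) pb.sampleLaw :=
      (hi.const_inner c).const_mul 2
    have hi4 : Integrable (fun z => ‖pb.clipVec μ τ x z‖ ^ 2 - 2 * inner ℝ c (pb.clipVec μ τ x z))
      pb.sampleLaw := hi2.sub hi3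
    have hi5 : Integrable (fun z => ‖pb.clipVec μ τ x z‖ ^ 2 - 2 * inner ℝ c (pb.clipVec μ τ x z)
      + ‖c‖ ^ 2) pb.sampleLaw := hi4.add (integrable_const _)
    rw [e1]
    simp only [hexp]
    rw [← ofReal_integral_eq_lintegral_ofReal hi5
      (Filter.Eventually.of_forall fun z => by
        have := sq_nonneg ‖pb.localNoise μ τ x z‖
        rwa [hexp z] at this)]
    refine ENNReal.ofReal_le_ofReal ?_
    rw [integral_add hi4 (integrable_const _), integral_sub hi2 hi3, integral_const_mul,
      integral_inner hi, ← clipMean, ← hc, real_inner_self_eq_norm_sq]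
    simp only [integral_const, probReal_univ, smul_eq_mul, one_mul]
    nlinarith [sq_nonneg ‖c‖]
  · simp [localNoise, hx]

/-- On the unit sphere the displaced value is dominated, through the quadratic bound, by the value
and the gradient at the centre. Both are integrable in `ξ`. -/
theorem Assumptions.integrable_F_comp {μ : ℝ} (x : EuclideanSpace ℝ (Fin d)) :
    Integrable (fun z : EuclideanSpace ℝ (Fin d) × Ξ => pb.F (x + μ • z.1) z.2)
      pb.sampleLaw := by
  have := h.prob
  have := isProbabilityMeasure_unifSphere h.d_pos
  have := h.isProbabilityMeasure_sampleLaw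
  have hm : Measurable fun z : EuclideanSpace ℝ (Fin d) × Ξ => pb.F (x + μ • z.1) z.2 :=
    h.measurable_F.comp (f := fun z : EuclideanSpace ℝ (Fin d) × Ξ => (x + μ • z.1, z.2))
      (by fun_prop)
  have h1 : Integrable (fun z : EuclideanSpace ℝ (Fin d) × Ξ =>
      |pb.F x z.2| + |μ| * ‖pb.sampleGrad x z.2‖ + pb.L / 2 * μ ^ 2) pb.sampleLaw := by
    refine ((Integrable.comp_snd (f := fun ξ => |pb.F x ξ|) (h.integrable_F x).abs _).add
      ((Integrable.comp_snd (f := fun ξ => ‖pb.sampleGrad x ξ‖)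
        (h.integrable_sampleGrad x).norm _).const_mul _)).add (integrable_const _)
  refine h1.mono' hm.aestronglyMeasurable ?_
  filter_upwards [h.ae_norm_fst, h.ae_smooth_sampleLaw] with z hz hs
  have hq := abs_le.mp (abs_sub_sub_inner_gradient_le hs.1 hs.2 x (x + μ • z.1))
  have hi := abs_le.mp (abs_real_inner_le_norm (pb.sampleGrad x z.2) (μ • z.1))
  simp only [add_sub_cancel_left, norm_smul, hz, mul_one, Real.norm_eq_abs, sq_abs] at hq hi
  rw [sampleGrad] at hi
  rw [Real.norm_eq_abs, abs_le, sampleGrad]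
  have := neg_abs_le (pb.F x z.2)
  have := le_abs_self (pb.F x z.2)
  constructor <;> nlinarith [hq.1, hq.2, hi.1, hi.2]

theorem Assumptions.integrable_slope {μ : ℝ} (x : EuclideanSpace ℝ (Fin d)) :
    Integrable (pb.slope μ x) pb.sampleLaw := by
  have h1 := h.integrable_F_comp (μ := μ) x
  have h2 := h.integrable_F_comp (μ := -μ) x
  simp only [neg_smul, ← sub_eq_add_neg] at h2
  exact (h1.sub h2).div_const _

/-- Without clipping, the estimator is unbiased for the averaged gradient. -/
theorem Assumptions.integral_slope_smul {μ : ℝ} (hμ : 0 < μ) (x : EuclideanSpace ℝ (Fin d)) :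
    (d : ℝ) • ∫ z, pb.slope μ x z • z.1 ∂pb.sampleLaw = ballGradient pb.f μ x := by
  have := h.prob
  have := isProbabilityMeasure_unifSphere h.d_pos
  have hi : Integrable (fun z => pb.slope μ x z • z.1) pb.sampleLaw := by
    refine (h.integrable_slope (μ := μ) x).mono
      ((h.measurable_slope_apply μ x).smul measurable_fst).aestronglyMeasurable ?_
    filter_upwards [h.ae_norm_fst] with z hz
    simp [norm_smul, hz]
  rw [ballGradient_eq h.d_pos hμ h.differentiable_f
    (continuous_gradient_of_lipschitz h.lipschitz_gradient_f)]
  congr 1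
  rw [sampleLaw, integral_prod _ hi]
  congr 1
  funext u
  simp only [integral_smul_const]
  congr 1
  simp only [slope]
  rw [integral_div, integral_sub (h.integrable_F _) (h.integrable_F _)]
  rfl

/-- The unclipped mean is exact, so the bias of the vector is at most `d` times the scalar clipping
bias, the directions having norm `1`. -/
theorem Assumptions.norm_clipMean_sub_le {μ τ b : ℝ} (hμ : 0 < μ) (hτ : 0 ≤ τ) (hb0 : 0 ≤ b)
    (x : EuclideanSpace ℝ (Fin d))
    (hb : ∫⁻ z, ENNReal.ofReal |pb.slope μ x z - clip τ (pb.slope μ x z)| ∂pb.sampleLaw ≤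
      ENNReal.ofReal b) :
    ‖(d : ℝ) • pb.clipMean μ τ x - ballGradient pb.f μ x‖ ≤ d * b := by
  have hi : Integrable (fun z => pb.slope μ x z • z.1) pb.sampleLaw := by
    refine (h.integrable_slope (μ := μ) x).mono
      ((h.measurable_slope_apply μ x).smul measurable_fst).aestronglyMeasurable ?_
    filter_upwards [h.ae_norm_fst] with z hz
    simp [norm_smul, hz]
  rw [← h.integral_slope_smul hμ x, clipMean, ← smul_sub,
    ← integral_sub (h.integrable_clipVec hτ x) hi, norm_smul, Real.norm_natCast]
  gcongr
  refine (norm_integral_le_lintegral_norm _).trans (ENNReal.toReal_le_of_le_ofReal hb0 ?_)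
  refine le_trans (lintegral_mono_ae ?_) hb
  filter_upwards [h.ae_norm_fst] with z hz
  rw [clipVec, ← sub_smul, norm_smul, hz, mul_one, Real.norm_eq_abs, abs_sub_comm]

theorem Assumptions.gapBar_nonneg (μ : ℝ) : 0 ≤ pb.gapBar μ := by
  have := h.gap_nonneg
  have := h.L_pos
  unfold gapBar
  positivity

theorem Assumptions.S_pos {μ : ℝ} (hμ : 0 < μ) : 0 < pb.S μ := by
  have := h.σ_pos
  have := h.L_pos
  unfold S
  positivity

/-- On the localization region the slope has a weak tail at scale `S_μ`. -/
theorem Assumptions.measure_slope_le_of_mem {μ : ℝ} (hμ : 0 < μ)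
    {x : EuclideanSpace ℝ (Fin d)} (hx : x ∈ pb.localRegion μ) {t : ℝ} (ht : 0 < t) :
    pb.sampleLaw {z | t < |pb.slope μ x z|} ≤ ENNReal.ofReal ((12 * pb.S μ / t) ^ pb.p) := by
  have hd0 : (0 : ℝ) < d := by have := h.d_pos; positivity
  have hσ := h.σ_pos
  have hL := h.L_pos
  have hx' : pb.f x - pb.fStar ≤ 4 * pb.gapBar μ := hx
  have hg := h.gapBar_nonneg μ
  -- In the region `‖∇f‖²` is at most `2 L` times four enlarged gaps, and `8 ≤ 9`. The constant `12`
  -- of the tail is this `3` times the `4` in `measure_slope_le`.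
  have hsq : ‖gradient pb.f x‖ ^ 2 ≤ (3 * Real.sqrt (pb.L * pb.gapBar μ)) ^ 2 := by
    rw [mul_pow, Real.sq_sqrt (by positivity)]
    have := h.sq_norm_gradient_f_le x
    have : 2 * pb.L * (pb.f x - pb.fStar) ≤ 2 * pb.L * (4 * pb.gapBar μ) := by gcongr
    nlinarith [mul_nonneg hL.le hg]
  have hn : ‖gradient pb.f x‖ ≤ 3 * Real.sqrt (pb.L * pb.gapBar μ) :=
    le_of_sq_le_sq hsq (by positivity)
  have hLμ : 0 < pb.L * μ := by positivity
  refine h.measure_slope_le hμ x ?_ ?_ ht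
  · rw [S, mul_add 12, mul_div_assoc']
    have : 4 * (‖gradient pb.f x‖ + pb.σ) / Real.sqrt d ≤
        12 * (Real.sqrt (pb.L * pb.gapBar μ) + pb.σ) / Real.sqrt d := by
      gcongr ?_ / _
      linarith
    linarith
  · rw [S]
    have : 0 ≤ (Real.sqrt (pb.L * pb.gapBar μ) + pb.σ) / Real.sqrt d := by positivity
    nlinarith

/-- The moment bound is split at `s = S_μ`. Here `12^p 8^(2-p) ≤ 144 · 8 = 1152`, the logarithm is
at most `5/2 (1 + log y)`, and `1 + 2 · 1152 · 5/2 ≤ 6000`. The constant does not depend on `p`. -/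
theorem Assumptions.lintegral_clip_slope_sq_le {μ y : ℝ} (hμ : 0 < μ) (hy : 1 ≤ y)
    {x : EuclideanSpace ℝ (Fin d)} (hx : x ∈ pb.localRegion μ) :
    ∫⁻ z, ENNReal.ofReal ((clip (8 * pb.S μ * y ^ (1 / pb.p)) (pb.slope μ x z)) ^ 2)
      ∂pb.sampleLaw ≤
    ENNReal.ofReal (6000 * pb.S μ ^ 2 * y ^ ((2 - pb.p) / pb.p) * (1 + Real.log y)) := by
  have := h.isProbabilityMeasure_sampleLaw
  have hS := h.S_pos hμ
  have hp := h.one_lt_p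
  have hp2 := h.p_le_two
  have hy0 : 0 < y := by linarith
  have hlog : 0 ≤ Real.log y := Real.log_nonneg hy
  have hyp : 1 ≤ y ^ (1 / pb.p) := Real.one_le_rpow hy (by positivity)
  have hyq : 1 ≤ y ^ ((2 - pb.p) / pb.p) :=
    Real.one_le_rpow hy (div_nonneg (by linarith) (by linarith))
  set τ := 8 * pb.S μ * y ^ (1 / pb.p) with hτ
  have hSτ : pb.S μ ≤ τ := by nlinarith
  refine (lintegral_clip_sq_le (h.measurable_slope_apply μ x) h.p_le_two (by positivity)
    (fun t ht => h.measure_slope_le_of_mem hμ hx ht) hS hSτ).trans (ENNReal.ofReal_le_ofReal ?_)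
  have e1 : Real.log (τ / pb.S μ) ≤ 5 / 2 * (1 + Real.log y) := by
    have : τ / pb.S μ = 8 * y ^ (1 / pb.p) := by rw [hτ]; field_simp
    rw [this, Real.log_mul (by norm_num) (by positivity), Real.log_rpow hy0]
    have h8 : Real.log 8 ≤ 5 / 2 := by
      have : (8 : ℝ) = 2 ^ (3 : ℕ) := by norm_num
      rw [this, Real.log_pow]
      have := Real.log_two_lt_d9
      push_cast; linarith
    have : 1 / pb.p * Real.log y ≤ 1 * Real.log y := by
      gcongr
      rw [div_le_one (by linarith)]; exact hp.le
    linarith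
  have e2 : (12 * pb.S μ) ^ pb.p * τ ^ (2 - pb.p) ≤
      1152 * (pb.S μ ^ 2 * y ^ ((2 - pb.p) / pb.p)) := by
    have a1 : τ ^ (2 - pb.p) = 8 ^ (2 - pb.p) * pb.S μ ^ (2 - pb.p) * y ^ ((2 - pb.p) / pb.p) := by
      rw [hτ, Real.mul_rpow (by positivity) (by positivity),
        Real.mul_rpow (by positivity) (by positivity), ← Real.rpow_mul hy0.le]
      congr 2; ring
    have a2 : pb.S μ ^ pb.p * pb.S μ ^ (2 - pb.p) = pb.S μ ^ 2 := by
      rw [← Real.rpow_add hS, ← Real.rpow_two]; congr 1; ring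
    have a3 : (12 : ℝ) ^ pb.p ≤ 144 := by
      calc (12 : ℝ) ^ pb.p ≤ 12 ^ (2 : ℝ) := Real.rpow_le_rpow_of_exponent_le (by norm_num) hp2
        _ = 144 := by rw [Real.rpow_two]; norm_num
    have a4 : (8 : ℝ) ^ (2 - pb.p) ≤ 8 := by
      calc (8 : ℝ) ^ (2 - pb.p) ≤ 8 ^ (1 : ℝ) :=
            Real.rpow_le_rpow_of_exponent_le (by norm_num) (by linarith)
        _ = 8 := Real.rpow_one 8
    rw [a1, Real.mul_rpow (by norm_num) hS.le]
    calc 12 ^ pb.p * pb.S μ ^ pb.p * (8 ^ (2 - pb.p) * pb.S μ ^ (2 - pb.p)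
          * y ^ ((2 - pb.p) / pb.p))
        = 12 ^ pb.p * 8 ^ (2 - pb.p) * (pb.S μ ^ pb.p * pb.S μ ^ (2 - pb.p)
          * y ^ ((2 - pb.p) / pb.p)) := by ring
      _ ≤ 144 * 8 * (pb.S μ ^ 2 * y ^ ((2 - pb.p) / pb.p)) := by
          rw [a2]; gcongr
      _ = _ := by ring
  set W := pb.S μ ^ 2 * y ^ ((2 - pb.p) / pb.p) with hW
  have hS2 : pb.S μ ^ 2 ≤ W := by
    rw [hW]; exact le_mul_of_one_le_right (by positivity) hyq
  have hW0 : 0 ≤ W := (sq_nonneg _).trans hS2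
  have hlogτ : 0 ≤ Real.log (τ / pb.S μ) := Real.log_nonneg ((one_le_div hS).mpr hSτ)
  calc pb.S μ ^ 2 + 2 * (12 * pb.S μ) ^ pb.p * τ ^ (2 - pb.p) * Real.log (τ / pb.S μ)
      = pb.S μ ^ 2 + 2 * ((12 * pb.S μ) ^ pb.p * τ ^ (2 - pb.p)) * Real.log (τ / pb.S μ) := by ring
    _ ≤ W + 2 * (1152 * W) * (5 / 2 * (1 + Real.log y)) := by gcongr
    _ ≤ 6000 * W * (1 + Real.log y) := by nlinarith [mul_nonneg hW0 hlog]
    _ = _ := by rw [hW]; ring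

/-- The clipping bias at the level `8 S_μ y^(1/p)`. -/
theorem Assumptions.norm_clipMean_sub_le_of_mem {μ y : ℝ} (hμ : 0 < μ) (hy : 1 ≤ y)
    {x : EuclideanSpace ℝ (Fin d)} (hx : x ∈ pb.localRegion μ) :
    ‖(d : ℝ) • pb.clipMean μ (8 * pb.S μ * y ^ (1 / pb.p)) x - ballGradient pb.f μ x‖ ≤
      144 / (pb.p - 1) * d * pb.S μ * (1 / y) ^ ((pb.p - 1) / pb.p) := by
  have := h.isProbabilityMeasure_sampleLaw
  have hS := h.S_pos hμ
  have hp := h.one_lt_p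
  have hp2 := h.p_le_two
  have hp1 : 0 < pb.p - 1 := by linarith
  have hy0 : 0 < y := by linarith
  set τ := 8 * pb.S μ * y ^ (1 / pb.p) with hτ
  have hτ0 : 0 < τ := by positivity
  refine (h.norm_clipMean_sub_le hμ hτ0.le (by positivity) x (lintegral_abs_sub_clip_le
    (h.measurable_slope_apply μ x) hp (by positivity)
    (fun t ht => h.measure_slope_le_of_mem hμ hx ht) hτ0)).trans ?_
  -- The powers of `S_μ` combine to a single factor, and `12^p 8^(1-p) ≤ 144` gives the constant of
  -- the bias.
  have a1 : τ ^ (1 - pb.p) = 8 ^ (1 - pb.p) * pb.S μ ^ (1 - pb.p) *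
      (1 / y) ^ ((pb.p - 1) / pb.p) := by
    rw [hτ, Real.mul_rpow (by positivity) (by positivity),
      Real.mul_rpow (by positivity) (by positivity), ← Real.rpow_mul hy0.le, one_div y,
      Real.inv_rpow hy0.le, ← Real.rpow_neg hy0.le]
    congr 2; ring
  have a2 : pb.S μ ^ pb.p * pb.S μ ^ (1 - pb.p) = pb.S μ := by
    rw [← Real.rpow_add hS]; simp
  have a3 : (12 : ℝ) ^ pb.p ≤ 144 := by
    calc (12 : ℝ) ^ pb.p ≤ 12 ^ (2 : ℝ) := Real.rpow_le_rpow_of_exponent_le (by norm_num) hp2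
      _ = 144 := by rw [Real.rpow_two]; norm_num
  have a4 : (8 : ℝ) ^ (1 - pb.p) ≤ 1 :=
    Real.rpow_le_one_of_one_le_of_nonpos (by norm_num) (by linarith)
  rw [a1, Real.mul_rpow (by norm_num) hS.le]
  calc d * (12 ^ pb.p * pb.S μ ^ pb.p * (8 ^ (1 - pb.p) * pb.S μ ^ (1 - pb.p) *
        (1 / y) ^ ((pb.p - 1) / pb.p)) / (pb.p - 1))
      = 12 ^ pb.p * 8 ^ (1 - pb.p) * (d * (pb.S μ ^ pb.p * pb.S μ ^ (1 - pb.p)) *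
        (1 / y) ^ ((pb.p - 1) / pb.p) / (pb.p - 1)) := by ring
    _ ≤ 144 * 1 * (d * pb.S μ * (1 / y) ^ ((pb.p - 1) / pb.p) / (pb.p - 1)) := by
        rw [a2]; gcongr
    _ = _ := by ring

end ZOProblem

/-- The scale computations behind the deviation bound, with `Y = y ^ ((p - 1) / p)`. -/
theorem deviation_scale {p y : ℝ} (hp : 0 < p) (hy : 0 < y) :
    y ^ (1 / p) = y / y ^ ((p - 1) / p) ∧
    y ^ ((2 - p) / p) = y / (y ^ ((p - 1) / p)) ^ 2 ∧
    (1 / y) ^ ((p - 1) / p) = 1 / y ^ ((p - 1) / p) := by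
  refine ⟨?_, ?_, ?_⟩
  · rw [eq_div_iff (by positivity), ← Real.rpow_add hy]
    conv_rhs => rw [← Real.rpow_one y]
    congr 1; field_simp; ring
  · rw [eq_div_iff (by positivity), ← Real.rpow_natCast, ← Real.rpow_mul hy.le, ← Real.rpow_add hy]
    conv_rhs => rw [← Real.rpow_one y]
    congr 1; push_cast; field_simp; ring
  · rw [Real.div_rpow zero_le_one hy.le, Real.one_rpow]

theorem measurable_fun_smul {Ω E : Type*} [NormedAddCommGroup E] [NormedSpace ℝ E]
    [MeasurableSpace E] [BorelSpace E] {m : MeasurableSpace Ω} {f : Ω → E} (hf : Measurable[m] f)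
    (c : ℝ) : Measurable[m] fun ω => c • f ω :=
  hf.const_smul c

/-! ### Deviation of the weighted and warm-start noise. -/

namespace ZOProblem

variable {d : ℕ} {Ξ : Type*} [MeasurableSpace Ξ] {pb : ZOProblem d Ξ} {pr : MomentumParams}
  {Ω : Type*} {s : Fin pr.M₀ ⊕ (ℕ × Fin pr.M) → Ω → EuclideanSpace ℝ (Fin d) × Ξ}

/-- The deviation scale `d S_μ y^(-(p-1)/p) √(1 + log y)`. -/
def devScale (pb : ZOProblem d Ξ) (μ y : ℝ) : ℝ :=
  d * pb.S μ * (1 / y) ^ ((pb.p - 1) / pb.p) * Real.sqrt (1 + Real.log y)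

theorem Assumptions.devScale_pos (h : pb.Assumptions) {μ y : ℝ} (hμ : 0 < μ) (hy : 1 ≤ y) :
    0 < pb.devScale μ y := by
  have hd0 : (0 : ℝ) < d := by have := h.d_pos; positivity
  have hS := h.S_pos hμ
  have hlog : 0 ≤ Real.log y := Real.log_nonneg hy
  unfold devScale
  positivity

/-- The samples used before running batch `t`. -/
def pastIndices (pr : MomentumParams) (t : ℕ) : Set (Fin pr.M₀ ⊕ (ℕ × Fin pr.M)) :=
  {i | ∀ j l, i = Sum.inr (j, l) → j < t}

theorem pastIndices_mono (pr : MomentumParams) {t u : ℕ} (h : t ≤ u) :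
    pastIndices pr t ⊆ pastIndices pr u :=
  fun _ hi j l e => (hi j l e).trans_le h

theorem estimator_fst (pb : ZOProblem d Ξ) (μ τ : ℝ) {M : ℕ}
    (s : Fin M → EuclideanSpace ℝ (Fin d) × Ξ) (x : EuclideanSpace ℝ (Fin d)) :
    (pb.estimator μ τ s x).1 = ((d : ℝ) / M) • ∑ l, pb.clipVec μ τ x (s l) := rfl

theorem Assumptions.measurable_clipVec_comp (h : pb.Assumptions) (μ τ : ℝ)
    {Ω : Type*} {m : MeasurableSpace Ω} {z : Ω → EuclideanSpace ℝ (Fin d) × Ξ}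
    {x : Ω → EuclideanSpace ℝ (Fin d)} (hz : Measurable[m] z) (hx : Measurable[m] x) :
    Measurable[m] fun ω => pb.clipVec μ τ (x ω) (z ω) := by
  have hp : Measurable[m] fun ω => (x ω, z ω) := hx.prodMk hz
  have h2 := Measurable.comp (h.measurable_clipVec μ τ) hp
  exact h2

theorem Assumptions.measurable_estimator (h : pb.Assumptions) (μ τ : ℝ) {M : ℕ}
    {Ω : Type*} {m : MeasurableSpace Ω} {z : Fin M → Ω → EuclideanSpace ℝ (Fin d) × Ξ}
    {x : Ω → EuclideanSpace ℝ (Fin d)} (hz : ∀ l, Measurable[m] (z l)) (hx : Measurable[m] x) :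
    Measurable[m] fun ω => (pb.estimator μ τ (fun l => z l ω) (x ω)).1 := by
  have h1 : Measurable[m] fun ω => ∑ l, pb.clipVec μ τ (x ω) (z l ω) :=
    Finset.measurable_sum _ fun l _ => h.measurable_clipVec_comp μ τ (hz l) hx
  have h2 := measurable_fun_smul h1 ((d : ℝ) / M)
  simpa only [estimator_fst] using h2

/-- Adaptedness: the state after batch `t` involves no running batch beyond `t`. Warm-start indices
lie in every past. -/
theorem Assumptions.measurable_state (h : pb.Assumptions) (t : ℕ) :
    Measurable[samplesBefore s (pastIndices pr (t + 1))] (fun ω => (pb.state pr s ω t).x) ∧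
    Measurable[samplesBefore s (pastIndices pr (t + 1))] (fun ω => (pb.state pr s ω t).m) := by
  induction t with
  | zero =>
    have hz : ∀ l : Fin pr.M₀,
        Measurable[samplesBefore s (pastIndices pr (0 + 1))] (s (Sum.inl l)) :=
      fun l => measurable_samplesBefore s (fun j l' e => by simp at e)
    have hm := h.measurable_estimator pr.μ (pb.tau₀ pr) (m := samplesBefore s
      (pastIndices pr (0 + 1))) (z := fun l => s (Sum.inl l)) (x := fun _ => pb.x₀) hz
      measurable_const
    exact ⟨measurable_const.sub (hm.const_smul pr.α), hm⟩
  | succ t ih =>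
    have hle := samplesBefore_mono s (pastIndices_mono pr (Nat.le_succ (t + 1)))
    have hx := ih.1.mono hle le_rfl
    have hm := ih.2.mono hle le_rfl
    have hz : ∀ l : Fin pr.M, Measurable[samplesBefore s (pastIndices pr (t + 1 + 1))]
        (s (Sum.inr (t + 1, l))) :=
      fun l => measurable_samplesBefore s (fun j l' e => by
        have : t + 1 = j := (Prod.mk.inj (Sum.inr.inj e)).1
        omega)
    have hg := h.measurable_estimator pr.μ (pb.tau pr) (z := fun l => s (Sum.inr (t + 1, l))) hz hx
    have hm' := (hm.const_smul pr.β).add (hg.const_smul (1 - pr.β))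
    exact ⟨hx.sub (hm'.const_smul pr.α), hm'⟩

theorem Assumptions.measurable_iterate (h : pb.Assumptions) (t : ℕ) :
    Measurable[samplesBefore s (pastIndices pr t)] (fun ω => pb.iterate pr s ω t) := by
  cases t with
  | zero => exact measurable_const
  | succ t => exact (h.measurable_state t).1

/-- The localized noise of running batch `t`. -/
def batchNoise (pb : ZOProblem d Ξ) (pr : MomentumParams)
    (s : Fin pr.M₀ ⊕ (ℕ × Fin pr.M) → Ω → EuclideanSpace ℝ (Fin d) × Ξ) (t : ℕ) (ω : Ω) :
    EuclideanSpace ℝ (Fin d) :=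
  ((d : ℝ) / pr.M) • ∑ l, pb.localNoise pr.μ (pb.tau pr) (pb.iterate pr s ω t)
    (s (Sum.inr (t, l)) ω)

/-- The localized noise of the warm-start batch. -/
def warmNoise (pb : ZOProblem d Ξ) (pr : MomentumParams)
    (s : Fin pr.M₀ ⊕ (ℕ × Fin pr.M) → Ω → EuclideanSpace ℝ (Fin d) × Ξ) (ω : Ω) :
    EuclideanSpace ℝ (Fin d) :=
  ((d : ℝ) / pr.M₀) • ∑ l, pb.localNoise pr.μ (pb.tau₀ pr) pb.x₀ (s (Sum.inl l) ω)

theorem Assumptions.measurable_batchNoise (h : pb.Assumptions) (t : ℕ) :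
    Measurable[samplesBefore s (pastIndices pr (t + 1))] (pb.batchNoise pr s t) := by
  refine measurable_fun_smul ?_ _
  refine Finset.measurable_sum _ fun l _ => (h.measurable_localNoise pr.μ (pb.tau pr)).comp
    (Measurable.prodMk ((h.measurable_iterate t).mono
      (samplesBefore_mono s (pastIndices_mono pr (Nat.le_succ t))) le_rfl)
      (measurable_samplesBefore s fun j l' e => ?_))
  have : t = j := (Prod.mk.inj (Sum.inr.inj e)).1
  omega

variable [MeasurableSpace Ω] {Pr : Measure Ω} [IsProbabilityMeasure Pr]

/-- The localized noise is bounded by `2τ = 16 S_μ y^(1/p)`, so the condition on `θ` is that the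
scaled increments have norm at most `1`. -/
theorem Assumptions.lintegral_cosh_add_localNoise_le (h : pb.Assumptions) {ι : Type*}
    {s : ι → Ω → EuclideanSpace ℝ (Fin d) × Ξ} (hs : ∀ i, Measurable (s i))
    (hlaw : ∀ i, Pr.map (s i) = pb.sampleLaw) (hind : iIndepFun s Pr)
    {μ y θ : ℝ} (hμ : 0 < μ) (hy : 1 ≤ y) (hθ : 0 ≤ θ)
    (hθ1 : θ * (16 * pb.S μ * y ^ (1 / pb.p)) ≤ 1)
    {A : Set ι} {X V : Ω → EuclideanSpace ℝ (Fin d)} (hX : Measurable[samplesBefore s A] X)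
    (hV : Measurable[samplesBefore s A] V) (R : Finset ι) (hR : ∀ i ∈ R, i ∉ A) :
    ∫⁻ ω, ENNReal.ofReal (Real.cosh ‖V ω + ∑ i ∈ R,
      θ • pb.localNoise μ (8 * pb.S μ * y ^ (1 / pb.p)) (X ω) (s i ω)‖) ∂Pr ≤
      ENNReal.ofReal (Real.exp (R.card * (θ ^ 2 *
        (6000 * pb.S μ ^ 2 * y ^ ((2 - pb.p) / pb.p) * (1 + Real.log y))))) *
        ∫⁻ ω, ENNReal.ofReal (Real.cosh ‖V ω‖) ∂Pr := by
  have := h.isProbabilityMeasure_sampleLaw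
  have hS := h.S_pos hμ
  have hlog : 0 ≤ Real.log y := Real.log_nonneg hy
  set τ := 8 * pb.S μ * y ^ (1 / pb.p) with hτ
  have hτ0 : 0 ≤ τ := by positivity
  set v := 6000 * pb.S μ ^ 2 * y ^ ((2 - pb.p) / pb.p) * (1 + Real.log y)
  have hv0 : 0 ≤ v := by positivity
  refine lintegral_cosh_norm_add_sum_le hs hlaw hind
    (D := fun x z => θ • pb.localNoise μ τ x z) ((h.measurable_localNoise μ τ).const_smul θ)
    (fun x => ?_) (fun x => ?_) (fun x => ?_) (by positivity) hX hV R hR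
  · rw [integral_smul, h.integral_localNoise hτ0, smul_zero]
  · filter_upwards [h.ae_norm_localNoise_le hτ0 x] with z hz
    rw [norm_smul, Real.norm_of_nonneg hθ]
    calc θ * ‖pb.localNoise μ τ x z‖ ≤ θ * (2 * τ) := by gcongr
      _ = θ * (16 * pb.S μ * y ^ (1 / pb.p)) := by rw [hτ]; ring
      _ ≤ 1 := hθ1
  · simp only [norm_smul, Real.norm_of_nonneg hθ, mul_pow]
    simp only [ENNReal.ofReal_mul (sq_nonneg θ)]
    rw [lintegral_const_mul' _ _ ENNReal.ofReal_ne_top]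
    gcongr
    exact h.lintegral_norm_localNoise_sq_le hτ0
      (fun x hx => h.lintegral_clip_slope_sq_le hμ hy hx) x

/-- The weights are deterministic, so the sum is a martingale in the number of batches. Each new
batch is fresh given the iterate at which it is evaluated and multiplies the bound by its own
exponential. -/
theorem Assumptions.lintegral_cosh_momentum_le (h : pb.Assumptions) (hs : pb.IsSampling pr Pr s)
    (hμ : 0 < pr.μ) {K c : ℝ} (hK : 0 ≤ K) (hy : 1 ≤ pr.M / ((1 - pr.β) * pr.lam))
    (hc : K * (d / pr.M) * c * (16 * pb.S pr.μ *
      (pr.M / ((1 - pr.β) * pr.lam)) ^ (1 / pb.p)) ≤ 1)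
    {w : ℕ → ℝ} (hw0 : ∀ j, 0 ≤ w j) (hwc : ∀ j, w j ≤ c) (n : ℕ) :
    ∫⁻ ω, ENNReal.ofReal (Real.cosh
      ‖∑ j ∈ Finset.range n, (K * w j) • pb.batchNoise pr s (j + 1) ω‖) ∂Pr ≤
    ENNReal.ofReal (Real.exp (∑ j ∈ Finset.range n, pr.M * ((K * (d / pr.M) * w j) ^ 2 *
      (6000 * pb.S pr.μ ^ 2 * (pr.M / ((1 - pr.β) * pr.lam)) ^ ((2 - pb.p) / pb.p) *
        (1 + Real.log (pr.M / ((1 - pr.β) * pr.lam))))))) := by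
  have hS := h.S_pos hμ
  set y := pr.M / ((1 - pr.β) * pr.lam) with hydef
  have hy0 : 0 < y := by linarith
  induction n with
  | zero => simp
  | succ n ih =>
    have hV : Measurable[samplesBefore s (pastIndices pr (n + 1))] fun ω =>
        ∑ j ∈ Finset.range n, (K * w j) • pb.batchNoise pr s (j + 1) ω := by
      refine Finset.measurable_sum _ fun j hj => measurable_fun_smul ?_ _
      exact (h.measurable_batchNoise (j + 1)).mono (samplesBefore_mono s
        (pastIndices_mono pr (by have := Finset.mem_range.mp hj; omega))) le_rfl
    set R : Finset (Fin pr.M₀ ⊕ (ℕ × Fin pr.M)) :=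
      Finset.univ.map ⟨fun l => Sum.inr (n + 1, l), fun a b e => by simpa using e⟩ with hR
    have hRA : ∀ i ∈ R, i ∉ pastIndices pr (n + 1) := by
      intro i hi hmem
      simp only [hR, Finset.mem_map, Finset.mem_univ, true_and] at hi
      obtain ⟨l, rfl⟩ := hi
      exact absurd (hmem (n + 1) l rfl) (lt_irrefl _)
    have hθ : 0 ≤ K * (d / pr.M) * w n := by have := hw0 n; positivity
    have hstep := h.lintegral_cosh_add_localNoise_le hs.measurable (fun i => hs.law i)
      hs.indep hμ hy hθ
      (le_trans (by gcongr; exact hwc n) hc) (h.measurable_iterate (n + 1)) hV R hRA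
    have e : ∀ ω, ∑ j ∈ Finset.range (n + 1), (K * w j) • pb.batchNoise pr s (j + 1) ω =
        ∑ j ∈ Finset.range n, (K * w j) • pb.batchNoise pr s (j + 1) ω +
        ∑ i ∈ R, (K * (d / pr.M) * w n) • pb.localNoise pr.μ (8 * pb.S pr.μ * y ^ (1 / pb.p))
          (pb.iterate pr s ω (n + 1)) (s i ω) := by
      intro ω
      rw [Finset.sum_range_succ, hR, Finset.sum_map, ← Finset.smul_sum, batchNoise, smul_smul]
      congr 2
      ring
    simp only [e]
    refine hstep.trans ((mul_le_mul_right ih _).trans (le_of_eq ?_))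
    rw [← ENNReal.ofReal_mul (Real.exp_nonneg _), ← Real.exp_add, Finset.sum_range_succ, hR,
      Finset.card_map, Finset.card_univ, Fintype.card_fin, add_comm]

/-- A weighted sum of localized batch noises exceeds the deviation scale with small probability. -/
theorem Assumptions.measure_momentum_noise_le (h : pb.Assumptions) (hs : pb.IsSampling pr Pr s)
    (hμ : 0 < pr.μ) (hβ : pr.β < 1) (hlam : Real.log 2 ≤ pr.lam)
    (hM : (1 - pr.β) * pr.lam ≤ pr.M)
    {w : ℕ → ℝ} (hw0 : ∀ j, 0 ≤ w j) (hwc : ∀ j, w j ≤ 1 - pr.β) {n : ℕ}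
    (hw2 : ∑ j ∈ Finset.range n, w j ^ 2 ≤ 1 - pr.β) :
    Pr.real {ω | 240 * pb.devScale pr.μ (pr.M / ((1 - pr.β) * pr.lam)) <
      ‖∑ j ∈ Finset.range n, w j • pb.batchNoise pr s (j + 1) ω‖} ≤ Real.exp (-pr.lam) := by
  have hS := h.S_pos hμ
  have hd0 : (0 : ℝ) < d := by have := h.d_pos; positivity
  have hp : 0 < pb.p := by linarith [h.one_lt_p]
  have hc : 0 < 1 - pr.β := by linarith
  have hl2 : 0 < Real.log 2 := Real.log_pos (by norm_num)
  have hl : 0 < pr.lam := hl2.trans_le hlam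
  have hM0 : (0 : ℝ) < pr.M := (mul_pos hc hl).trans_le hM
  have hy : 1 ≤ pr.M / ((1 - pr.β) * pr.lam) := (one_le_div (by positivity)).mpr hM
  set y := pr.M / ((1 - pr.β) * pr.lam) with hydef
  have hy0 : 0 < y := by linarith
  have hMy : (pr.M : ℝ) = y * ((1 - pr.β) * pr.lam) := by rw [hydef]; field_simp
  have hD := h.devScale_pos hμ hy
  have hlog : 0 ≤ Real.log y := Real.log_nonneg hy
  -- This scaling makes the increments at most `1 / (5 r) ≤ 1` and the total second moment at most
  -- `(6000 / 6400) λ ≤ λ`. The threshold `240` scales becomes `3 λ`, and `2 exp (λ - 3 λ) ≤ exp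
  -- (-λ)` because `λ ≥ log 2`.
  set K := pr.lam / (80 * pb.devScale pr.μ y) with hK
  have hK0 : 0 < K := by positivity
  obtain ⟨e1, e2, e3⟩ := deviation_scale hp hy0
  set Y := y ^ ((pb.p - 1) / pb.p) with hYdef
  have hY : 0 < Y := by positivity
  set r := Real.sqrt (1 + Real.log y) with hr
  have hr2 : r ^ 2 = 1 + Real.log y := Real.sq_sqrt (by positivity)
  have hr1 : 1 ≤ r := by
    rw [hr]; exact Real.one_le_sqrt.mpr (by linarith)
  have hr0 : 0 < r := by linarith
  have hDe : pb.devScale pr.μ y = d * pb.S pr.μ * r / Y := by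
    rw [devScale, e3]; ring
  have hcond : K * (d / pr.M) * (1 - pr.β) * (16 * pb.S pr.μ * y ^ (1 / pb.p)) ≤ 1 := by
    rw [hK, hDe, hMy, e1]
    have : pr.lam / (80 * (d * pb.S pr.μ * r / Y)) * (d / (y * ((1 - pr.β) * pr.lam))) *
        (1 - pr.β) * (16 * pb.S pr.μ * (y / Y)) = 1 / (5 * r) := by
      field_simp; norm_num
    rw [this, div_le_one (by positivity)]
    linarith
  have hmg := h.lintegral_cosh_momentum_le hs hμ hK0.le hy hcond hw0 hwc n
  have hsum : ∑ j ∈ Finset.range n, pr.M * ((K * (d / pr.M) * w j) ^ 2 *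
      (6000 * pb.S pr.μ ^ 2 * y ^ ((2 - pb.p) / pb.p) * (1 + Real.log y))) ≤ pr.lam := by
    have : ∀ j, pr.M * ((K * (d / pr.M) * w j) ^ 2 *
      (6000 * pb.S pr.μ ^ 2 * y ^ ((2 - pb.p) / pb.p) * (1 + Real.log y))) =
        (pr.M * (K * (d / pr.M)) ^ 2 * (6000 * pb.S pr.μ ^ 2 * y ^ ((2 - pb.p) / pb.p) *
          (1 + Real.log y))) * w j ^ 2 := fun j => by ring
    simp only [this]
    rw [← Finset.mul_sum]
    refine (mul_le_mul_of_nonneg_left hw2 (by positivity)).trans ?_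
    rw [hK, hDe, hMy, e2, ← hr2]
    have : y * ((1 - pr.β) * pr.lam) * (pr.lam / (80 * (d * pb.S pr.μ * r / Y)) *
        (d / (y * ((1 - pr.β) * pr.lam)))) ^ 2 * (6000 * pb.S pr.μ ^ 2 * (y / Y ^ 2) * r ^ 2) *
        (1 - pr.β) = pr.lam * (6000 / 6400) := by
      field_simp; norm_num
    rw [this]
    linarith
  have hmeas : Measurable fun ω => ∑ j ∈ Finset.range n, (K * w j) • pb.batchNoise pr s (j + 1) ω :=
    Finset.measurable_sum _ fun j _ => measurable_fun_smul ((h.measurable_batchNoise (j + 1)).mono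
      (samplesBefore_le hs.measurable _) le_rfl) _
  have htail := measure_norm_ge_le_of_lintegral_cosh hmeas
    (hmg.trans (ENNReal.ofReal_le_ofReal (Real.exp_le_exp.mpr hsum))) (r := 3 * pr.lam)
    (by positivity)
  refine le_trans (measureReal_mono fun ω hω => ?_) (htail.trans ?_)
  · have hω' : 240 * pb.devScale pr.μ y <
      ‖∑ j ∈ Finset.range n, w j • pb.batchNoise pr s (j + 1) ω‖ := hω
    change 3 * pr.lam < ‖∑ j ∈ Finset.range n, (K * w j) • pb.batchNoise pr s (j + 1) ω‖
    simp only [mul_smul]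
    rw [← Finset.smul_sum, norm_smul, Real.norm_of_nonneg hK0.le]
    have : 3 * pr.lam = K * (240 * pb.devScale pr.μ y) := by rw [hK]; field_simp; norm_num
    rw [this]
    gcongr
  · have e : (2 : ℝ) = Real.exp (Real.log 2) := (Real.exp_log (by norm_num)).symm
    rw [e, ← Real.exp_add]
    exact Real.exp_le_exp.mpr (by linarith)

/-- The deviation of the warm-start batch. -/
theorem Assumptions.measure_warmNoise_le (h : pb.Assumptions) (hs : pb.IsSampling pr Pr s)
    (hμ : 0 < pr.μ) (hlam : Real.log 2 ≤ pr.lam₀) (hM : pr.lam₀ ≤ pr.M₀) :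
    Pr.real {ω | 240 * pb.devScale pr.μ (pr.M₀ / pr.lam₀) < ‖pb.warmNoise pr s ω‖} ≤
      Real.exp (-pr.lam₀) := by
  have hS := h.S_pos hμ
  have hd0 : (0 : ℝ) < d := by have := h.d_pos; positivity
  have hp : 0 < pb.p := by linarith [h.one_lt_p]
  have hl2 : 0 < Real.log 2 := Real.log_pos (by norm_num)
  have hl : 0 < pr.lam₀ := hl2.trans_le hlam
  have hM0 : (0 : ℝ) < pr.M₀ := hl.trans_le hM
  have hy : 1 ≤ pr.M₀ / pr.lam₀ := (one_le_div (by positivity)).mpr hM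
  set y := pr.M₀ / pr.lam₀ with hydef
  have hy0 : 0 < y := by linarith
  have hMy : (pr.M₀ : ℝ) = y * pr.lam₀ := by rw [hydef]; field_simp
  have hD := h.devScale_pos hμ hy
  have hlog : 0 ≤ Real.log y := Real.log_nonneg hy
  -- The same scaling as for the running noise, with a single batch of weight `1`.
  set K := pr.lam₀ / (80 * pb.devScale pr.μ y) with hK
  have hK0 : 0 < K := by positivity
  obtain ⟨e1, e2, e3⟩ := deviation_scale hp hy0
  set Y := y ^ ((pb.p - 1) / pb.p) with hYdef
  have hY : 0 < Y := by positivity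
  set r := Real.sqrt (1 + Real.log y) with hr
  have hr2 : r ^ 2 = 1 + Real.log y := Real.sq_sqrt (by positivity)
  have hr1 : 1 ≤ r := by
    rw [hr]; exact Real.one_le_sqrt.mpr (by linarith)
  have hr0 : 0 < r := by linarith
  have hDe : pb.devScale pr.μ y = d * pb.S pr.μ * r / Y := by
    rw [devScale, e3]; ring
  have hcond : K * (d / pr.M₀) * (16 * pb.S pr.μ * y ^ (1 / pb.p)) ≤ 1 := by
    rw [hK, hDe, hMy, e1]
    have : pr.lam₀ / (80 * (d * pb.S pr.μ * r / Y)) * (d / (y * pr.lam₀)) *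
        (16 * pb.S pr.μ * (y / Y)) = 1 / (5 * r) := by
      field_simp; norm_num
    rw [this, div_le_one (by positivity)]
    linarith
  set R : Finset (Fin pr.M₀ ⊕ (ℕ × Fin pr.M)) :=
    Finset.univ.map ⟨fun l => Sum.inl l, fun a b e => by simpa using e⟩ with hR
  have hstep := h.lintegral_cosh_add_localNoise_le hs.measurable (fun i => hs.law i) hs.indep hμ hy
    (by positivity) hcond (A := ∅) (X := fun _ => pb.x₀) (V := fun _ => 0) measurable_const
    measurable_const R (fun i _ => Set.notMem_empty i)
  have hcard : R.card = pr.M₀ := by rw [hR, Finset.card_map, Finset.card_univ, Fintype.card_fin]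
  have e : ∀ ω, 0 + ∑ i ∈ R, (K * (d / pr.M₀)) •
      pb.localNoise pr.μ (8 * pb.S pr.μ * y ^ (1 / pb.p)) pb.x₀ (s i ω) =
        K • pb.warmNoise pr s ω := by
    intro ω
    rw [zero_add, hR, Finset.sum_map, ← Finset.smul_sum, warmNoise, smul_smul]
    rfl
  simp only [e, hcard, norm_zero, Real.cosh_zero, ENNReal.ofReal_one, lintegral_const,
    measure_univ, mul_one] at hstep
  have hsum : pr.M₀ * ((K * (d / pr.M₀)) ^ 2 *
      (6000 * pb.S pr.μ ^ 2 * y ^ ((2 - pb.p) / pb.p) * (1 + Real.log y))) ≤ pr.lam₀ := by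
    rw [hK, hDe, hMy, e2, ← hr2]
    have : y * pr.lam₀ * ((pr.lam₀ / (80 * (d * pb.S pr.μ * r / Y)) *
        (d / (y * pr.lam₀))) ^ 2 * (6000 * pb.S pr.μ ^ 2 * (y / Y ^ 2) * r ^ 2)) =
          pr.lam₀ * (6000 / 6400) := by
      field_simp; norm_num
    rw [this]
    linarith
  have hmeas : Measurable fun ω => K • pb.warmNoise pr s ω := by
    refine measurable_fun_smul (measurable_fun_smul (Finset.measurable_sum _ fun l _ => ?_) _) _
    exact (h.measurable_localNoise pr.μ (pb.tau₀ pr)).comp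
      (measurable_const.prodMk (hs.measurable (Sum.inl l)))
  have htail := measure_norm_ge_le_of_lintegral_cosh hmeas
    (hstep.trans (ENNReal.ofReal_le_ofReal (Real.exp_le_exp.mpr hsum))) (r := 3 * pr.lam₀)
    (by positivity)
  refine le_trans (measureReal_mono fun ω hω => ?_) (htail.trans ?_)
  · have hω' : 240 * pb.devScale pr.μ y < ‖pb.warmNoise pr s ω‖ := hω
    change 3 * pr.lam₀ < ‖K • pb.warmNoise pr s ω‖
    rw [norm_smul, Real.norm_of_nonneg hK0.le]
    have : 3 * pr.lam₀ = K * (240 * pb.devScale pr.μ y) := by rw [hK]; field_simp; norm_num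
    rw [this]
    gcongr
  · have e : (2 : ℝ) = Real.exp (Real.log 2) := (Real.exp_log (by norm_num)).symm
    rw [e, ← Real.exp_add]
    exact Real.exp_le_exp.mpr (by linarith)

end ZOProblem

/-! ### Deterministic analysis of the momentum recursion. -/

section Descent

variable {E : Type*} [NormedAddCommGroup E] [InnerProductSpace ℝ E]

/-- Polarization turns `-α ⟨k, m⟩` into squares. The quadratic term costs at most `α / 8 ‖m‖²`, and
the remaining `-3α / 8 ‖m‖²` later pays for the gradient drift. -/
theorem sub_smul_descent {φ : E → ℝ} {k : E → E} {L α : ℝ}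
    (hφ : ∀ x y, φ y ≤ φ x + inner ℝ (k x) (y - x) + L / 2 * ‖y - x‖ ^ 2)
    (hα : 0 < α) (hLα : L * α ≤ 1 / 4) (x m : E) :
    φ (x - α • m) ≤ φ x - α / 2 * ‖k x‖ ^ 2 - 3 * α / 8 * ‖m‖ ^ 2 + α / 2 * ‖m - k x‖ ^ 2 := by
  have h1 := hφ x (x - α • m)
  rw [sub_sub_cancel_left, norm_neg, inner_neg_right, inner_smul_right, norm_smul,
    Real.norm_of_nonneg hα.le, mul_pow] at h1
  have h2 := norm_sub_sq_real m (k x)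
  rw [real_inner_comm] at h2
  have h3 : L / 2 * (α ^ 2 * ‖m‖ ^ 2) = (L * α) * (α / 2 * ‖m‖ ^ 2) := by ring
  have h4 : (L * α) * (α / 2 * ‖m‖ ^ 2) ≤ 1 / 4 * (α / 2 * ‖m‖ ^ 2) := by gcongr
  nlinarith

theorem sq_norm_convex_le {β : ℝ} (hβ0 : 0 ≤ β) (hβ : β ≤ 1) (a b : E) :
    ‖β • a + (1 - β) • b‖ ^ 2 ≤ β * ‖a‖ ^ 2 + (1 - β) * ‖b‖ ^ 2 := by
  have h1 : ‖β • a + (1 - β) • b‖ ≤ β * ‖a‖ + (1 - β) * ‖b‖ := by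
    refine (norm_add_le _ _).trans (le_of_eq ?_)
    rw [norm_smul, norm_smul, Real.norm_of_nonneg hβ0, Real.norm_of_nonneg (sub_nonneg.mpr hβ)]
  have h2 : ‖β • a + (1 - β) • b‖ ^ 2 ≤ (β * ‖a‖ + (1 - β) * ‖b‖) ^ 2 := by gcongr
  nlinarith [mul_nonneg (mul_nonneg hβ0 (sub_nonneg.mpr hβ)) (sq_nonneg (‖a‖ - ‖b‖))]

theorem sq_norm_add_le {E : Type*} [SeminormedAddCommGroup E] (a b : E) :
    ‖a + b‖ ^ 2 ≤ 2 * ‖a‖ ^ 2 + 2 * ‖b‖ ^ 2 := by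
  have h2 : ‖a + b‖ ^ 2 ≤ (‖a‖ + ‖b‖) ^ 2 := by gcongr; exact norm_add_le _ _
  nlinarith [sq_nonneg (‖a‖ - ‖b‖)]

variable {φ : E → ℝ} {k : E → E} {L α β G H U B : ℝ} {x m N ν b : ℕ → E}

/-- The deterministic analysis of the momentum recursion, given bounds for the weighted noise `N`
and the bias `b`. -/
theorem momentum_descent
    (hφ : ∀ x y, φ y ≤ φ x + inner ℝ (k x) (y - x) + L / 2 * ‖y - x‖ ^ 2)
    (hk : ∀ x y, ‖k x - k y‖ ≤ L * ‖x - y‖) (hL : 0 < L)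
    (hα : 0 < α) (hLα : L * α ≤ 1 / 4) (hβ0 : 0 < β) (hβ : β < 1)
    (hγ : (β * (L * α) / (1 - β)) ^ 2 ≤ 1 / 48)
    (hx : ∀ t, x (t + 1) = x t - α • m t)
    (hm : ∀ t, m (t + 1) = β • m t + (1 - β) • (k (x (t + 1)) + ν (t + 1) + b (t + 1)))
    (hN0 : N 0 = 0) (hN : ∀ t, N (t + 1) = β • N t + (1 - β) • ν (t + 1))
    (hG : ‖m 0 - k (x 0)‖ ≤ G) (hH : ‖k (x 0)‖ ≤ H) (n : ℕ)
    (hU : ∀ t < n, ‖N (t + 1)‖ ≤ U) (hB : ∀ t < n, ‖b (t + 1)‖ ≤ B) :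
    φ (x (n + 1)) + α / 2 * ∑ t ∈ Finset.range n, ‖k (x (t + 1))‖ ^ 2 ≤
      φ (x 0) + (5 * α / 4 * G ^ 2 +
        2 * α / (1 - β) * (β * ((1 + L * α) * G + L * α * H) + (1 - β) * B) ^ 2)
        + n * α * (U ^ 2 + 2 * B ^ 2) := by
  have hc : 0 < 1 - β := by linarith
  have hG0 : 0 ≤ G := (norm_nonneg _).trans hG
  set ρ := β * ((1 + L * α) * G + L * α * H) + (1 - β) * B with hρ
  -- Subtracting the weighted noise removes `ν` from the recursion exactly. Only drift and bias
  -- drive `r`, and the noise enters once, through `‖N‖ ≤ U`.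
  set r : ℕ → E := fun t => m t - k (x t) - N t with hr
  have hdrift : ∀ t, ‖k (x t) - k (x (t + 1))‖ ≤ L * α * ‖m t‖ := by
    intro t
    refine (hk _ _).trans (le_of_eq ?_)
    rw [hx, sub_sub_cancel, norm_smul, Real.norm_of_nonneg hα.le, mul_assoc]
  have hrec : ∀ t, r (t + 1) = β • r t + (β • (k (x t) - k (x (t + 1))) + (1 - β) • b (t + 1)) := by
    intro t
    simp only [hr, hm, hN]
    module
  have hstep : ∀ t, φ (x (t + 1)) ≤ φ (x t) - α / 2 * ‖k (x t)‖ ^ 2 - 3 * α / 8 * ‖m t‖ ^ 2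
      + α / 2 * ‖m t - k (x t)‖ ^ 2 := by
    intro t
    rw [hx]
    exact sub_smul_descent hφ hα hLα (x t) (m t)
  have hfirst : φ (x 1) ≤ φ (x 0) + 5 * α / 4 * G ^ 2 := by
    have h1 := hstep 0
    have h2 : ‖m 0 - k (x 0)‖ ^ 2 ≤ G ^ 2 := by gcongr
    have h3 : α / 2 * ‖m 0 - k (x 0)‖ ^ 2 ≤ α / 2 * G ^ 2 := by gcongr
    have h4 : 0 ≤ α / 2 * ‖k (x 0)‖ ^ 2 := by positivity
    have h5 : 0 ≤ 3 * α / 8 * ‖m 0‖ ^ 2 := by positivity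
    have h6 : 0 ≤ α * G ^ 2 := by positivity
    simp only [zero_add] at h1
    linarith
  -- The first residual is bounded directly, using `‖m 0‖ ≤ G + H` for the drift of the warm-start
  -- step.
  have hr1 : 0 < n → ‖r 1‖ ^ 2 ≤ ρ ^ 2 := by
    intro hn
    have hm0 : ‖m 0‖ ≤ G + H := by
      calc ‖m 0‖ = ‖(m 0 - k (x 0)) + k (x 0)‖ := by rw [sub_add_cancel]
        _ ≤ _ := (norm_add_le _ _).trans (add_le_add hG hH)
    have hr0 : ‖r 0‖ ≤ G := by simpa [hr, hN0] using hG
    gcongr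
    rw [show (1 : ℕ) = 0 + 1 from rfl, hrec]
    calc ‖β • r 0 + (β • (k (x 0) - k (x (0 + 1))) + (1 - β) • b (0 + 1))‖
        ≤ ‖β • r 0‖ + (‖β • (k (x 0) - k (x (0 + 1)))‖ + ‖(1 - β) • b (0 + 1)‖) :=
          (norm_add_le _ _).trans (by gcongr; exact norm_add_le _ _)
      _ = β * ‖r 0‖ + (β * ‖k (x 0) - k (x (0 + 1))‖ + (1 - β) * ‖b (0 + 1)‖) := by
          rw [norm_smul, norm_smul, norm_smul, Real.norm_of_nonneg hβ0.le,
            Real.norm_of_nonneg hc.le]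
      _ ≤ β * G + (β * (L * α * (G + H)) + (1 - β) * B) := by
          have := (hdrift 0).trans (mul_le_mul_of_nonneg_left hm0 (by positivity))
          have := hB 0 hn
          gcongr
      _ = ρ := by rw [hρ]; ring
  have he : ∀ t < n, ‖m (t + 1) - k (x (t + 1))‖ ^ 2 ≤ 2 * ‖r (t + 1)‖ ^ 2 + 2 * U ^ 2 := by
    intro t ht
    have h1 := sq_norm_add_le (r (t + 1)) (N (t + 1))
    have h2 : r (t + 1) + N (t + 1) = m (t + 1) - k (x (t + 1)) := by simp [hr]
    rw [h2] at h1
    have h3 : ‖N (t + 1)‖ ^ 2 ≤ U ^ 2 := by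
      gcongr
      exact hU t ht
    linarith
  -- The new residual is a convex combination of the old one and a forcing vector. Splitting the
  -- square of the latter doubles the `1 / 48` of `hγ` to `1 / 24`.
  have hrsq : ∀ t, t + 1 < n → ‖r (t + 1 + 1)‖ ^ 2 ≤ β * ‖r (t + 1)‖ ^ 2 +
      (1 - β) * (‖m (t + 1)‖ ^ 2 / 24 + 2 * B ^ 2) := by
    intro t ht
    set v := (β / (1 - β)) • (k (x (t + 1)) - k (x (t + 1 + 1))) + b (t + 1 + 1) with hv
    have h1 : r (t + 1 + 1) = β • r (t + 1) + (1 - β) • v := by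
      rw [hrec, hv, smul_add, smul_smul, mul_div_cancel₀ _ hc.ne']
    rw [h1]
    refine (sq_norm_convex_le hβ0.le hβ.le _ _).trans ?_
    gcongr
    refine (sq_norm_add_le _ _).trans ?_
    have h2 : ‖(β / (1 - β)) • (k (x (t + 1)) - k (x (t + 1 + 1)))‖ ^ 2 ≤
        1 / 48 * ‖m (t + 1)‖ ^ 2 := by
      rw [norm_smul, Real.norm_of_nonneg (by positivity)]
      calc (β / (1 - β) * ‖k (x (t + 1)) - k (x (t + 1 + 1))‖) ^ 2
          ≤ (β / (1 - β) * (L * α * ‖m (t + 1)‖)) ^ 2 := by gcongr; exact hdrift _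
        _ = (β * (L * α) / (1 - β)) ^ 2 * ‖m (t + 1)‖ ^ 2 := by ring
        _ ≤ _ := by gcongr
    have h3 : ‖b (t + 1 + 1)‖ ^ 2 ≤ B ^ 2 := by
      gcongr
      exact hB (t + 1) ht
    linarith
  -- With weight `α / (1 - β)` the contraction frees `α ‖r‖²`, which absorbs the residual part of
  -- the descent error. The drift `α ‖m‖² / 24` is covered by `3α / 8 ‖m‖²`.
  have hpot : ∀ j, j < n → φ (x (j + 1)) + α / (1 - β) * ‖r (j + 1)‖ ^ 2 +
      α / 2 * ∑ t ∈ Finset.range j, ‖k (x (t + 1))‖ ^ 2 ≤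
      φ (x 0) + (5 * α / 4 * G ^ 2 + 2 * α / (1 - β) * ρ ^ 2) + j * α * (U ^ 2 + 2 * B ^ 2) := by
    intro j
    induction j with
    | zero =>
      intro hn
      have h1 : α / (1 - β) * ‖r 1‖ ^ 2 ≤ α / (1 - β) * ρ ^ 2 := by
        have := hr1 hn
        gcongr
      have h2 : 2 * α / (1 - β) * ρ ^ 2 = 2 * (α / (1 - β) * ρ ^ 2) := by ring
      have h3 : 0 ≤ α / (1 - β) * ρ ^ 2 := by positivity
      simp only [zero_add, Finset.range_zero, Finset.sum_empty, mul_zero, add_zero, Nat.cast_zero,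
        zero_mul]
      linarith
    | succ j ih =>
      intro hj
      have h0 := ih (by omega)
      have h1 := hstep (j + 1)
      have h2 := he j (by omega)
      have h3 := hrsq j hj
      have h4 : α / (1 - β) * ‖r (j + 1 + 1)‖ ^ 2 ≤ α / (1 - β) * ‖r (j + 1)‖ ^ 2 -
          α * ‖r (j + 1)‖ ^ 2 + α * (‖m (j + 1)‖ ^ 2 / 24 + 2 * B ^ 2) := by
        calc _ ≤ α / (1 - β) * (β * ‖r (j + 1)‖ ^ 2 +
              (1 - β) * (‖m (j + 1)‖ ^ 2 / 24 + 2 * B ^ 2)) := by gcongr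
          _ = _ := by field_simp; ring
      have h5 : α / 2 * ‖m (j + 1) - k (x (j + 1))‖ ^ 2 ≤
          α / 2 * (2 * ‖r (j + 1)‖ ^ 2 + 2 * U ^ 2) := by gcongr
      have h6 : 0 ≤ α * ‖m (j + 1)‖ ^ 2 := by positivity
      rw [Finset.sum_range_succ]
      push_cast
      linarith
  rcases Nat.eq_zero_or_pos n with h0 | hn
  · subst h0
    have : 0 ≤ 2 * α / (1 - β) * ρ ^ 2 := by positivity
    simp only [zero_add, Finset.range_zero, Finset.sum_empty, mul_zero, add_zero, Nat.cast_zero,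
      zero_mul]
    linarith
  -- The last step needs no bound on the next residual: the potential already held, at least `α
  -- ‖r‖²`, pays for it. Hence noise and bias are needed only for batches up to `n`.
  · obtain ⟨j, rfl⟩ : ∃ j, n = j + 1 := ⟨n - 1, by omega⟩
    have h0 := hpot j (by omega)
    have h1 := hstep (j + 1)
    have h2 := he j (by omega)
    have h5 : α / 2 * ‖m (j + 1) - k (x (j + 1))‖ ^ 2 ≤
        α / 2 * (2 * ‖r (j + 1)‖ ^ 2 + 2 * U ^ 2) := by gcongr
    have h6 : 0 ≤ α * ‖m (j + 1)‖ ^ 2 := by positivity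
    have h7 : α * ‖r (j + 1)‖ ^ 2 ≤ α / (1 - β) * ‖r (j + 1)‖ ^ 2 := by
      gcongr
      rw [le_div_iff₀ hc]
      nlinarith
    have h8 : 0 ≤ α * B ^ 2 := by positivity
    rw [Finset.sum_range_succ]
    push_cast
    linarith

end Descent

theorem one_sub_le_measureReal_of_compl_subset {Ω : Type*} [MeasurableSpace Ω] {Pr : Measure Ω}
    [IsProbabilityMeasure Pr] {A D : Set Ω} {a : ℝ} (hAD : ∀ ω, ω ∉ D → ω ∈ A)
    (hD : Pr.real D ≤ a) : 1 - a ≤ Pr.real A := by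
  have h1 : (1 : ℝ) ≤ Pr.real (A ∪ D) := by
    have : A ∪ D = Set.univ := by
      ext ω
      simp only [Set.mem_union, Set.mem_univ, iff_true]
      by_cases h : ω ∈ D
      · exact Or.inr h
      · exact Or.inl (hAD ω h)
    rw [this, probReal_univ]
  have h2 := measureReal_union_le (μ := Pr) A D
  linarith

/-! ### Momentum weights. -/

section Weights

variable {β : ℝ}

/-- Each weight is at most `1 - β` and they sum to at most `1`. This is the variance reduction that
allows a batch smaller by `1 - β`. -/
theorem sum_momentum_weights_sq_le (hβ0 : 0 ≤ β) (hβ : β < 1) (t : ℕ) :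
    ∑ j ∈ Finset.range t, ((1 - β) * β ^ (t - 1 - j)) ^ 2 ≤ 1 - β := by
  have hc : 0 < 1 - β := by linarith
  have h1 : ∑ j ∈ Finset.range t, (1 - β) * β ^ (t - 1 - j) = 1 - β ^ t := by
    rw [← Finset.mul_sum, Finset.sum_range_reflect (fun i => β ^ i) t, mul_neg_geom_sum]
  calc ∑ j ∈ Finset.range t, ((1 - β) * β ^ (t - 1 - j)) ^ 2
      ≤ ∑ j ∈ Finset.range t, (1 - β) * ((1 - β) * β ^ (t - 1 - j)) := by
        refine Finset.sum_le_sum fun j _ => ?_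
        rw [sq]
        exact mul_le_mul_of_nonneg_right
          (mul_le_of_le_one_right hc.le (pow_le_one₀ hβ0 hβ.le)) (by positivity)
    _ = (1 - β) * (1 - β ^ t) := by rw [← Finset.mul_sum, h1]
    _ ≤ 1 - β := by
        have : 0 ≤ β ^ t := by positivity
        nlinarith

theorem momentum_sum_succ {E : Type*} [AddCommGroup E] [Module ℝ E] (ν : ℕ → E) (t : ℕ) :
    ∑ j ∈ Finset.range (t + 1), ((1 - β) * β ^ (t + 1 - 1 - j)) • ν (j + 1) =
      β • ∑ j ∈ Finset.range t, ((1 - β) * β ^ (t - 1 - j)) • ν (j + 1) + (1 - β) • ν (t + 1) := by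
  rw [Finset.sum_range_succ, Finset.smul_sum]
  congr 1
  · refine Finset.sum_congr rfl fun j hj => ?_
    have hj' := Finset.mem_range.mp hj
    rw [smul_smul]
    congr 1
    have : t + 1 - 1 - j = t - 1 - j + 1 := by omega
    rw [this, pow_succ]
    ring
  · simp

end Weights

namespace MomentumParams

variable {pr : MomentumParams}

theorem Valid.log_two_le_lam₀ (hv : pr.Valid) : Real.log 2 ≤ pr.lam₀ := by
  refine Real.log_le_log (by norm_num) ?_
  rw [le_div_iff₀ hv.δ_pos]
  linarith [hv.δ_le_one]

theorem Valid.log_two_le_lam (hv : pr.Valid) (hT : 1 ≤ pr.T) : Real.log 2 ≤ pr.lam := by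
  refine Real.log_le_log (by norm_num) ?_
  rw [le_div_iff₀ hv.δ_pos]
  have : (1 : ℝ) ≤ pr.T := by exact_mod_cast hT
  linarith [hv.δ_le_one]

theorem Valid.exp_neg_lam₀ (hv : pr.Valid) : Real.exp (-pr.lam₀) = pr.δ / 2 := by
  have := hv.δ_pos
  rw [lam₀, Real.exp_neg, Real.exp_log (by positivity), inv_div]

theorem Valid.exp_neg_lam (hv : pr.Valid) (hT : 1 ≤ pr.T) :
    Real.exp (-pr.lam) = pr.δ / (2 * pr.T) := by
  have := hv.δ_pos
  have : (1 : ℝ) ≤ pr.T := by exact_mod_cast hT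
  rw [lam, Real.exp_neg, Real.exp_log (by positivity), inv_div]

end MomentumParams

/-! ### The bootstrap along one run, and the union bound. -/

namespace ZOProblem

variable {d : ℕ} {Ξ : Type*} [MeasurableSpace Ξ] {pb : ZOProblem d Ξ} {pr : MomentumParams}
  {Ω : Type*} {s : Fin pr.M₀ ⊕ (ℕ × Fin pr.M) → Ω → EuclideanSpace ℝ (Fin d) × Ξ} {ω : Ω}

/-- Inside the region the localized noise is the true noise, so removing it leaves the deterministic
clipped mean. -/
theorem localRegion_noise_sum {μ τ : ℝ} {M : ℕ} (hM : (0 : ℝ) < M)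
    {x : EuclideanSpace ℝ (Fin d)} (hx : x ∈ pb.localRegion μ)
    (z : Fin M → EuclideanSpace ℝ (Fin d) × Ξ) :
    (pb.estimator μ τ z x).1 - ((d : ℝ) / M) • ∑ l, pb.localNoise μ τ x (z l) =
      (d : ℝ) • pb.clipMean μ τ x := by
  simp only [estimator_fst, localNoise, hx, if_true]
  rw [← smul_sub, Finset.sum_sub_distrib, sub_sub_cancel, Finset.sum_const, Finset.card_univ,
    Fintype.card_fin, ← Nat.cast_smul_eq_nsmul ℝ, smul_smul, div_mul_cancel₀ _ hM.ne']

theorem U_eq (pb : ZOProblem d Ξ) (pr : MomentumParams) (C : ℝ) :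
    pb.U pr C = C * pb.devScale pr.μ (pr.M / ((1 - pr.β) * pr.lam)) := by
  rw [U, devScale, one_div_div]; ring

theorem B_eq (pb : ZOProblem d Ξ) (pr : MomentumParams) (C : ℝ) :
    pb.B pr C = C * d * pb.S pr.μ *
      (1 / (pr.M / ((1 - pr.β) * pr.lam))) ^ ((pb.p - 1) / pb.p) := by
  rw [B, one_div_div]

theorem G_eq (pb : ZOProblem d Ξ) (pr : MomentumParams) (C : ℝ) :
    pb.G pr C = C * pb.devScale pr.μ (pr.M₀ / pr.lam₀) := by
  rw [G, devScale, one_div_div]; ring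

theorem Assumptions.bias_le_devScale (h : pb.Assumptions) {μ y C : ℝ} (hμ : 0 < μ) (hy : 1 ≤ y)
    (hC : 0 ≤ C) :
    C * d * pb.S μ * (1 / y) ^ ((pb.p - 1) / pb.p) ≤ C * pb.devScale μ y := by
  have hS := h.S_pos hμ
  have : 1 ≤ Real.sqrt (1 + Real.log y) := Real.one_le_sqrt.mpr (by linarith [Real.log_nonneg hy])
  rw [devScale]
  have h0 : 0 ≤ C * (d * pb.S μ * (1 / y) ^ ((pb.p - 1) / pb.p)) := by positivity
  calc _ = C * (d * pb.S μ * (1 / y) ^ ((pb.p - 1) / pb.p)) * 1 := by ring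
    _ ≤ C * (d * pb.S μ * (1 / y) ^ ((pb.p - 1) / pb.p)) * Real.sqrt (1 + Real.log y) := by
        gcongr
    _ = _ := by ring

theorem Assumptions.norm_ballGradient_x₀_le (h : pb.Assumptions) {μ : ℝ} (hμ : 0 < μ) :
    ‖ballGradient pb.f μ pb.x₀‖ ≤ pb.H μ := by
  have h1 := norm_ballGradient_sub_gradient_le h.L_pos.le hμ.le h.lipschitz_gradient_f pb.x₀
  have h2 : ‖gradient pb.f pb.x₀‖ ≤ Real.sqrt (2 * pb.L * pb.gap) :=
    Real.le_sqrt_of_sq_le (h.sq_norm_gradient_f_le pb.x₀)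
  calc ‖ballGradient pb.f μ pb.x₀‖ =
        ‖(ballGradient pb.f μ pb.x₀ - gradient pb.f pb.x₀) + gradient pb.f pb.x₀‖ := by
        rw [sub_add_cancel]
    _ ≤ pb.L * μ + Real.sqrt (2 * pb.L * pb.gap) := (norm_add_le _ _).trans (add_le_add h1 h2)
    _ = pb.H μ := by rw [H]; ring

theorem Assumptions.ballAverage_x₀_le (h : pb.Assumptions) {μ : ℝ} (hμ : 0 < μ) :
    ballAverage pb.f μ pb.x₀ - pb.fStar ≤ pb.gapBar μ := by
  have h1 := (abs_le.mp (abs_ballAverage_sub_le h.L_pos.le hμ.le h.differentiable_f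
    h.lipschitz_gradient_f pb.x₀)).2
  rw [gapBar, gap]
  linarith

/-- The fourth gap in the definition of the region pays for passing from the ball average back to
`f`, since `L μ² / 2` is part of the enlarged gap. -/
theorem Assumptions.mem_localRegion_of_ballAverage_le (h : pb.Assumptions) {μ : ℝ} (hμ : 0 < μ)
    {x : EuclideanSpace ℝ (Fin d)} (hx : ballAverage pb.f μ x - pb.fStar ≤ 3 * pb.gapBar μ) :
    x ∈ pb.localRegion μ := by
  have h1 := (abs_le.mp (abs_ballAverage_sub_le h.L_pos.le hμ.le h.differentiable_f
    h.lipschitz_gradient_f x)).1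
  have h2 : pb.L * μ ^ 2 / 2 ≤ pb.gapBar μ := by
    rw [gapBar]; linarith [h.gap_nonneg]
  change pb.f x - pb.fStar ≤ 4 * pb.gapBar μ
  linarith

theorem Assumptions.x₀_mem_localRegion (h : pb.Assumptions) (μ : ℝ) :
    pb.x₀ ∈ pb.localRegion μ := by
  have h2 : pb.gap ≤ pb.gapBar μ := by
    have := h.L_pos
    have : 0 ≤ pb.L * μ ^ 2 / 2 := by positivity
    rw [gapBar]; linarith
  have := h.gapBar_nonneg μ
  change pb.gap ≤ 4 * pb.gapBar μ
  linarith

theorem iterate_succ (t : ℕ) :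
    pb.iterate pr s ω (t + 1) = pb.iterate pr s ω t - pr.α • (pb.state pr s ω t).m := by
  cases t <;> rfl

/-- The gradient estimate of running batch `t`. -/
def batchEstimate (pb : ZOProblem d Ξ) (pr : MomentumParams)
    (s : Fin pr.M₀ ⊕ (ℕ × Fin pr.M) → Ω → EuclideanSpace ℝ (Fin d) × Ξ) (ω : Ω) (t : ℕ) :
    EuclideanSpace ℝ (Fin d) :=
  (pb.estimator pr.μ (pb.tau pr) (fun l => s (Sum.inr (t, l)) ω) (pb.iterate pr s ω t)).1

theorem state_succ_m (t : ℕ) : (pb.state pr s ω (t + 1)).m =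
    pr.β • (pb.state pr s ω t).m + (1 - pr.β) • pb.batchEstimate pr s ω (t + 1) := rfl

theorem state_zero_m : (pb.state pr s ω 0).m =
    (pb.estimator pr.μ (pb.tau₀ pr) (fun l => s (Sum.inl l) ω) pb.x₀).1 := rfl

theorem Assumptions.norm_batchEstimate_sub_le (h : pb.Assumptions) (hμ : 0 < pr.μ)
    (hM : (0 : ℝ) < pr.M) (hy : 1 ≤ pr.M / ((1 - pr.β) * pr.lam)) {C : ℝ}
    (hC : 144 / (pb.p - 1) ≤ C) (t : ℕ) (hx : pb.iterate pr s ω t ∈ pb.localRegion pr.μ) :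
    ‖pb.batchEstimate pr s ω t - ballGradient pb.f pr.μ (pb.iterate pr s ω t) -
      pb.batchNoise pr s t ω‖ ≤ pb.B pr C := by
  have hS := h.S_pos hμ
  have h1 := localRegion_noise_sum (τ := pb.tau pr) hM hx (fun l => s (Sum.inr (t, l)) ω)
  have e : pb.batchEstimate pr s ω t - ballGradient pb.f pr.μ (pb.iterate pr s ω t) -
      pb.batchNoise pr s t ω = (d : ℝ) • pb.clipMean pr.μ (pb.tau pr) (pb.iterate pr s ω t) -
        ballGradient pb.f pr.μ (pb.iterate pr s ω t) := by
    rw [← h1, batchEstimate, batchNoise]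
    abel
  rw [e]
  have h2 := h.norm_clipMean_sub_le_of_mem hμ hy hx
  rw [B_eq]
  refine h2.trans ?_
  gcongr

theorem Assumptions.norm_state_zero_m_sub_le (h : pb.Assumptions) (hμ : 0 < pr.μ)
    (hM : (0 : ℝ) < pr.M₀) (hy : 1 ≤ pr.M₀ / pr.lam₀) {C : ℝ}
    (hC : 240 + 144 / (pb.p - 1) ≤ C)
    (hwarm : ‖pb.warmNoise pr s ω‖ ≤ 240 * pb.devScale pr.μ (pr.M₀ / pr.lam₀)) :
    ‖(pb.state pr s ω 0).m - ballGradient pb.f pr.μ pb.x₀‖ ≤ pb.G pr C := by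
  have hp1 : 0 < pb.p - 1 := by linarith [h.one_lt_p]
  have hD := h.devScale_pos hμ hy
  have hx := h.x₀_mem_localRegion pr.μ
  have h1 := localRegion_noise_sum (τ := pb.tau₀ pr) hM hx (fun l => s (Sum.inl l) ω)
  have e : (pb.state pr s ω 0).m - ballGradient pb.f pr.μ pb.x₀ = pb.warmNoise pr s ω +
      ((d : ℝ) • pb.clipMean pr.μ (pb.tau₀ pr) pb.x₀ - ballGradient pb.f pr.μ pb.x₀) := by
    rw [← h1, state_zero_m, warmNoise]
    abel
  have h2 := h.norm_clipMean_sub_le_of_mem hμ hy hx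
  have h3 := h.bias_le_devScale hμ hy (C := 144 / (pb.p - 1)) (by positivity)
  rw [e, G_eq]
  calc _ ≤ 240 * pb.devScale pr.μ (pr.M₀ / pr.lam₀) +
        144 / (pb.p - 1) * pb.devScale pr.μ (pr.M₀ / pr.lam₀) :=
        (norm_add_le _ _).trans (add_le_add hwarm (h2.trans h3))
    _ = (240 + 144 / (pb.p - 1)) * pb.devScale pr.μ (pr.M₀ / pr.lam₀) := by ring
    _ ≤ _ := by gcongr

/-- One run, descent up to batch `n`, as long as the earlier iterates stay localized. -/
theorem Assumptions.run_descent (h : pb.Assumptions) (hv : pr.Valid) (hOK : pr.BatchOK)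
    (hlam : 0 < pr.lam) (hα : 0 < pr.α) (hα1 : pr.α ≤ 1 / (4 * pb.L))
    (hα2 : pr.α ≤ (1 - pr.β) / (4 * Real.sqrt 3 * pr.β * pb.L)) {CU CB CG : ℝ}
    (hCU : 240 ≤ CU) (hCB : 144 / (pb.p - 1) ≤ CB) (hCG : 240 + 144 / (pb.p - 1) ≤ CG) {ω : Ω}
    (hwarm : ‖pb.warmNoise pr s ω‖ ≤ 240 * pb.devScale pr.μ (pr.M₀ / pr.lam₀)) (n : ℕ)
    (hnoise : ∀ t < n, ‖∑ j ∈ Finset.range (t + 1), ((1 - pr.β) * pr.β ^ (t + 1 - 1 - j)) •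
      pb.batchNoise pr s (j + 1) ω‖ ≤ 240 * pb.devScale pr.μ (pr.M / ((1 - pr.β) * pr.lam)))
    (hloc : ∀ t ≤ n, pb.iterate pr s ω t ∈ pb.localRegion pr.μ) :
    ballAverage pb.f pr.μ (pb.iterate pr s ω (n + 1)) + pr.α / 2 * ∑ t ∈ Finset.range n,
      ‖ballGradient pb.f pr.μ (pb.iterate pr s ω (t + 1))‖ ^ 2 ≤
    ballAverage pb.f pr.μ pb.x₀ + (5 * pr.α / 4 * pb.G pr CG ^ 2 +
      2 * pr.α / (1 - pr.β) * (pr.β * ((1 + pb.L * pr.α) * pb.G pr CG + pb.L * pr.α * pb.H pr.μ) +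
        (1 - pr.β) * pb.B pr CB) ^ 2) + n * pr.α * (pb.U pr CU ^ 2 + 2 * pb.B pr CB ^ 2) := by
  have hμ := hv.μ_pos
  have hL := h.L_pos
  have hβ0 : 0 < pr.β := by linarith [hv.half_le_β]
  have hc : 0 < 1 - pr.β := by linarith [hv.β_lt_one]
  have hl0 : 0 < pr.lam₀ := (Real.log_pos (by norm_num)).trans_le hv.log_two_le_lam₀
  have hM0 : (0 : ℝ) < pr.M := (mul_pos hc hlam).trans_le hOK.running
  have hM00 : (0 : ℝ) < pr.M₀ := hl0.trans_le hOK.warm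
  have hy : 1 ≤ pr.M / ((1 - pr.β) * pr.lam) := (one_le_div (by positivity)).mpr hOK.running
  have hy0 : 1 ≤ pr.M₀ / pr.lam₀ := (one_le_div hl0).mpr hOK.warm
  have hLα : pb.L * pr.α ≤ 1 / 4 := by
    calc pb.L * pr.α ≤ pb.L * (1 / (4 * pb.L)) := by gcongr
      _ = 1 / 4 := by field_simp
  -- The constant `4√3` in the stepsize condition is the square root of this `48`.
  have hγ : (pr.β * (pb.L * pr.α) / (1 - pr.β)) ^ 2 ≤ 1 / 48 := by
    have h1 : pr.β * (pb.L * pr.α) / (1 - pr.β) ≤ 1 / (4 * Real.sqrt 3) := by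
      rw [div_le_iff₀ hc]
      calc pr.β * (pb.L * pr.α) ≤
            pr.β * (pb.L * ((1 - pr.β) / (4 * Real.sqrt 3 * pr.β * pb.L))) := by gcongr
        _ = 1 / (4 * Real.sqrt 3) * (1 - pr.β) := by field_simp
    calc (pr.β * (pb.L * pr.α) / (1 - pr.β)) ^ 2 ≤ (1 / (4 * Real.sqrt 3)) ^ 2 := by gcongr
      _ = 1 / 48 := by
        rw [div_pow, mul_pow, Real.sq_sqrt (by norm_num)]; norm_num
  have hm0 := h.norm_state_zero_m_sub_le hμ hM00 hy0 hCG hwarm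
  have hU : ∀ t < n, ‖∑ j ∈ Finset.range (t + 1), ((1 - pr.β) * pr.β ^ (t + 1 - 1 - j)) •
      pb.batchNoise pr s (j + 1) ω‖ ≤ pb.U pr CU := by
    intro t ht
    have hD := h.devScale_pos hμ hy
    rw [U_eq]
    refine (hnoise t ht).trans ?_
    gcongr
  have hB := fun t (ht : t < n) =>
    h.norm_batchEstimate_sub_le hμ hM0 hy hCB (t + 1) (hloc (t + 1) ht)
  have hm : ∀ t, (pb.state pr s ω (t + 1)).m = pr.β • (pb.state pr s ω t).m +
      (1 - pr.β) • (ballGradient pb.f pr.μ (pb.iterate pr s ω (t + 1)) +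
        pb.batchNoise pr s (t + 1) ω + (pb.batchEstimate pr s ω (t + 1) -
          ballGradient pb.f pr.μ (pb.iterate pr s ω (t + 1)) -
            pb.batchNoise pr s (t + 1) ω)) := by
    intro t
    rw [state_succ_m]
    congr 2
    abel
  have hN0 : ∑ j ∈ Finset.range 0, ((1 - pr.β) * pr.β ^ (0 - 1 - j)) •
      pb.batchNoise pr s (j + 1) ω = 0 := by simp
  have hx0 : pb.iterate pr s ω 0 = pb.x₀ := rfl
  have hH := h.norm_ballGradient_x₀_le hμ
  rw [← hx0] at hm0 hH ⊢
  have key := momentum_descent (φ := ballAverage pb.f pr.μ) (k := ballGradient pb.f pr.μ)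
    (x := pb.iterate pr s ω) (m := fun t => (pb.state pr s ω t).m)
    (N := fun t => ∑ j ∈ Finset.range t, ((1 - pr.β) * pr.β ^ (t - 1 - j)) •
      pb.batchNoise pr s (j + 1) ω)
    (ν := fun t => pb.batchNoise pr s t ω)
    (b := fun t => pb.batchEstimate pr s ω t - ballGradient pb.f pr.μ (pb.iterate pr s ω t) -
      pb.batchNoise pr s t ω)
    (ballAverage_le h.differentiable_f h.lipschitz_gradient_f)
    (norm_ballGradient_sub_le h.lipschitz_gradient_f)
    hL hα hLα hβ0 hv.β_lt_one hγ iterate_succ hm hN0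
    (momentum_sum_succ fun t => pb.batchNoise pr s t ω) hm0 hH n
    hU hB
  exact key

/-- Descent up to batch `n` needs only that the iterates up to `n` are localized, and it bounds the
smoothed gap at `n + 1` by three enlarged gaps: the initial one, the warm start and the accumulated
noise. Localization therefore propagates by induction, and a last application bounds the gradients.
-/
theorem Assumptions.run_bounds (h : pb.Assumptions) (hv : pr.Valid) (hOK : pr.BatchOK)
    (hT : 4 ≤ pr.T) (hα : 0 < pr.α) (hα1 : pr.α ≤ 1 / (4 * pb.L))
    (hα2 : pr.α ≤ (1 - pr.β) / (4 * Real.sqrt 3 * pr.β * pb.L)) {CU CB CG : ℝ}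
    (hCU : 240 ≤ CU) (hCB : 144 / (pb.p - 1) ≤ CB) (hCG : 240 + 144 / (pb.p - 1) ≤ CG)
    (hG : 5 * pr.α / 4 * pb.G pr CG ^ 2 + 2 * pr.α / (1 - pr.β) *
      (pr.β * ((1 + pb.L * pr.α) * pb.G pr CG + pb.L * pr.α * pb.H pr.μ) +
        (1 - pr.β) * pb.B pr CB) ^ 2 ≤ pb.gapBar pr.μ)
    (hUB : (pr.T - 1) * pr.α * (pb.U pr CU ^ 2 + 4 * pb.B pr CB ^ 2) ≤ pb.gapBar pr.μ) {ω : Ω}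
    (hwarm : ‖pb.warmNoise pr s ω‖ ≤ 240 * pb.devScale pr.μ (pr.M₀ / pr.lam₀))
    (hnoise : ∀ t < pr.T - 2, ‖∑ j ∈ Finset.range (t + 1),
      ((1 - pr.β) * pr.β ^ (t + 1 - 1 - j)) • pb.batchNoise pr s (j + 1) ω‖ ≤
        240 * pb.devScale pr.μ (pr.M / ((1 - pr.β) * pr.lam))) :
    (∀ t, 1 ≤ t → t ≤ pr.T - 1 →
      pb.f (pb.iterate pr s ω t) - pb.fStar ≤ 4 * pb.gapBar pr.μ) ∧
    pb.avgGradSq pr s ω ≤ 8 * pb.gapBar pr.μ / (pr.α * (pr.T - 2)) +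
      4 * pb.U pr CU ^ 2 + 16 * pb.B pr CB ^ 2 + 2 * pb.L ^ 2 * pr.μ ^ 2 := by
  have hμ := hv.μ_pos
  have hL := h.L_pos
  have hlam : 0 < pr.lam := (Real.log_pos (by norm_num)).trans_le
    (hv.log_two_le_lam (by omega))
  have hx0 := h.ballAverage_x₀_le hμ
  have hT' : (4 : ℝ) ≤ pr.T := by exact_mod_cast hT
  have hnT : ∀ n : ℕ, n ≤ pr.T - 2 → (n : ℝ) * pr.α * (pb.U pr CU ^ 2 + 2 * pb.B pr CB ^ 2) ≤
      pb.gapBar pr.μ := by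
    intro n hn
    refine le_trans ?_ hUB
    have : (n : ℝ) ≤ pr.T - 1 := by
      have : n + 1 ≤ pr.T := by omega
      have : (n : ℝ) + 1 ≤ pr.T := by exact_mod_cast this
      linarith
    have hα0 := hα.le
    have h0 : 0 ≤ ((pr.T : ℝ) - 1) * pr.α := mul_nonneg (by linarith) hα0
    have h2 : 2 * pb.B pr CB ^ 2 ≤ 4 * pb.B pr CB ^ 2 := by nlinarith [sq_nonneg (pb.B pr CB)]
    exact mul_le_mul (mul_le_mul_of_nonneg_right this hα0) (by linarith) (by positivity) h0
  have hloc : ∀ n, n ≤ pr.T - 1 → ∀ t ≤ n, pb.iterate pr s ω t ∈ pb.localRegion pr.μ := by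
    intro n
    induction n with
    | zero =>
      intro _ t ht
      obtain rfl : t = 0 := by omega
      exact h.x₀_mem_localRegion pr.μ
    | succ n ih =>
      intro hn t ht
      rcases Nat.lt_or_ge n t with htn | htn
      · obtain rfl : t = n + 1 := by omega
        have hd := h.run_descent hv hOK hlam hα hα1 hα2 hCU hCB hCG hwarm n
          (fun t ht => hnoise t (by omega)) (ih (by omega))
        have h1 := hnT n (by omega)
        have h2 : 0 ≤ pr.α / 2 * ∑ t ∈ Finset.range n,
          ‖ballGradient pb.f pr.μ (pb.iterate pr s ω (t + 1))‖ ^ 2 := by positivity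
        exact h.mem_localRegion_of_ballAverage_le hμ (by linarith)
      · exact ih (by omega) t htn
  refine ⟨fun t _ ht => hloc (pr.T - 1) le_rfl t ht, ?_⟩
  obtain ⟨n, hn⟩ : ∃ n, pr.T = n + 2 := ⟨pr.T - 2, by omega⟩
  have hn2 : pr.T - 2 = n := by omega
  have hcast : (pr.T : ℝ) - 2 = n := by rw [hn]; push_cast; ring
  have hn0 : (0 : ℝ) < n := by rw [← hcast]; linarith
  have hd := h.run_descent hv hOK hlam hα hα1 hα2 hCU hCB hCG hwarm n
    (fun t ht => hnoise t (by omega)) (fun t ht => hloc (pr.T - 1) le_rfl t (by omega))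
  have hlow : pb.fStar ≤ ballAverage pb.f pr.μ (pb.iterate pr s ω (n + 1)) :=
    le_ballAverage h.differentiable_f.continuous h.fStar_le _
  set sumSq := ∑ t ∈ Finset.range n, ‖ballGradient pb.f pr.μ (pb.iterate pr s ω (t + 1))‖ ^ 2
  have hk : pr.α / 2 * sumSq ≤ 2 * pb.gapBar pr.μ +
      n * pr.α * (pb.U pr CU ^ 2 + 2 * pb.B pr CB ^ 2) := by linarith
  have hsum : ∑ t ∈ Finset.Icc 1 n, ‖gradient pb.f (pb.iterate pr s ω t)‖ ^ 2 ≤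
      2 * sumSq + n * (2 * pb.L ^ 2 * pr.μ ^ 2) := by
    have e : Finset.Icc 1 n = Finset.Ico 1 (n + 1) := by ext; simp
    rw [e, Finset.sum_Ico_eq_sum_range, Nat.add_sub_cancel, Finset.mul_sum]
    have : (n : ℝ) * (2 * pb.L ^ 2 * pr.μ ^ 2) =
        ∑ _t ∈ Finset.range n, 2 * pb.L ^ 2 * pr.μ ^ 2 := by simp
    rw [this, ← Finset.sum_add_distrib]
    refine Finset.sum_le_sum fun t _ => ?_
    rw [add_comm 1 t]
    set x := pb.iterate pr s ω (t + 1)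
    have h1 := norm_ballGradient_sub_gradient_le h.L_pos.le hμ.le h.lipschitz_gradient_f x
    have h2 := sq_norm_add_le (ballGradient pb.f pr.μ x)
      (gradient pb.f x - ballGradient pb.f pr.μ x)
    rw [add_sub_cancel, norm_sub_rev] at h2
    have h3 : ‖ballGradient pb.f pr.μ x - gradient pb.f x‖ ^ 2 ≤ (pb.L * pr.μ) ^ 2 := by gcongr
    nlinarith
  rw [avgGradSq, hcast, hn2, one_div, inv_mul_le_iff₀ hn0]
  refine hsum.trans ?_
  have e : (n : ℝ) * (8 * pb.gapBar pr.μ / (pr.α * n) + 4 * pb.U pr CU ^ 2 +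
      16 * pb.B pr CB ^ 2 + 2 * pb.L ^ 2 * pr.μ ^ 2) = 8 * pb.gapBar pr.μ / pr.α +
      n * (4 * pb.U pr CU ^ 2 + 16 * pb.B pr CB ^ 2) + n * (2 * pb.L ^ 2 * pr.μ ^ 2) := by
    field_simp
    ring
  rw [e]
  -- The descent bound is multiplied by `4 / α`: a factor `2 / α` isolates the sum, and another `2`
  -- comes from comparing the gradient of `f` with the averaged gradient.
  have hk2 : 2 * sumSq ≤ 8 * pb.gapBar pr.μ / pr.α +
      n * (4 * pb.U pr CU ^ 2 + 8 * pb.B pr CB ^ 2) := by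
    have : 2 * sumSq = 4 / pr.α * (pr.α / 2 * sumSq) := by field_simp; ring
    rw [this]
    calc 4 / pr.α * (pr.α / 2 * sumSq) ≤ 4 / pr.α * (2 * pb.gapBar pr.μ +
          n * pr.α * (pb.U pr CU ^ 2 + 2 * pb.B pr CB ^ 2)) := by gcongr
      _ = _ := by field_simp; ring
  have : 0 ≤ (n : ℝ) * (8 * pb.B pr CB ^ 2) := by positivity
  linarith

variable [MeasurableSpace Ω] {Pr : Measure Ω} [IsProbabilityMeasure Pr]

/-- Localized convergence in high probability, for general stepsize and horizon. -/
theorem Assumptions.localized_convergence (h : pb.Assumptions) (hv : pr.Valid)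
    (hs : pb.IsSampling pr Pr s) {CU CB CG : ℝ}
    (hCU : 240 ≤ CU) (hCB : 144 / (pb.p - 1) ≤ CB) (hCG : 240 + 144 / (pb.p - 1) ≤ CG)
    (hOK : pr.BatchOK) (hT : 4 ≤ pr.T) (hα : 0 < pr.α) (hα1 : pr.α ≤ 1 / (4 * pb.L))
    (hα2 : pr.α ≤ (1 - pr.β) / (4 * Real.sqrt 3 * pr.β * pb.L))
    (hG : 5 * pr.α / 4 * pb.G pr CG ^ 2 + 2 * pr.α / (1 - pr.β) *
      (pr.β * ((1 + pb.L * pr.α) * pb.G pr CG + pb.L * pr.α * pb.H pr.μ) +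
        (1 - pr.β) * pb.B pr CB) ^ 2 ≤ pb.gapBar pr.μ)
    (hUB : (pr.T - 1) * pr.α * (pb.U pr CU ^ 2 + 4 * pb.B pr CB ^ 2) ≤ pb.gapBar pr.μ) :
    1 - pr.δ ≤ Pr.real {ω |
      (∀ t, 1 ≤ t → t ≤ pr.T - 1 →
        pb.f (pb.iterate pr s ω t) - pb.fStar ≤ 4 * pb.gapBar pr.μ) ∧
      pb.avgGradSq pr s ω ≤ 8 * pb.gapBar pr.μ / (pr.α * (pr.T - 2)) +
        4 * pb.U pr CU ^ 2 + 16 * pb.B pr CB ^ 2 + 2 * pb.L ^ 2 * pr.μ ^ 2} := by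
  have hμ := hv.μ_pos
  have hβ0 : 0 ≤ pr.β := by linarith [hv.half_le_β]
  have hc : 0 < 1 - pr.β := by linarith [hv.β_lt_one]
  set W := {ω | 240 * pb.devScale pr.μ (pr.M₀ / pr.lam₀) < ‖pb.warmNoise pr s ω‖}
  set D : ℕ → Set Ω := fun t => {ω | 240 * pb.devScale pr.μ (pr.M / ((1 - pr.β) * pr.lam)) <
    ‖∑ j ∈ Finset.range (t + 1), ((1 - pr.β) * pr.β ^ (t + 1 - 1 - j)) •
      pb.batchNoise pr s (j + 1) ω‖}
  have hW : Pr.real W ≤ pr.δ / 2 := by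
    rw [← hv.exp_neg_lam₀]
    exact h.measure_warmNoise_le hs hμ hv.log_two_le_lam₀ hOK.warm
  have hD : ∀ t, Pr.real (D t) ≤ pr.δ / (2 * pr.T) := by
    intro t
    rw [← hv.exp_neg_lam (by omega)]
    refine h.measure_momentum_noise_le hs hμ hv.β_lt_one (hv.log_two_le_lam (by omega))
      hOK.running (w := fun j => (1 - pr.β) * pr.β ^ (t + 1 - 1 - j)) (fun j => by positivity)
      (fun j => ?_) (sum_momentum_weights_sq_le hβ0 hv.β_lt_one (t + 1))
    exact mul_le_of_le_one_right hc.le (pow_le_one₀ hβ0 hv.β_lt_one.le)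
  have hT' : (4 : ℝ) ≤ pr.T := by exact_mod_cast hT
  have hδ := hv.δ_pos
  -- The bad events involve only localized noise, so their probabilities need no conditioning on the
  -- trajectory. The warm start uses `δ / 2`, and the `T - 2` running events use `δ / (2T)` each.
  refine one_sub_le_measureReal_of_compl_subset
    (D := W ∪ ⋃ t ∈ Finset.range (pr.T - 2), D t) (fun ω hω => ?_) ?_
  · simp only [Set.mem_union, Set.mem_iUnion, Finset.mem_range, exists_prop, not_or, not_exists,
      not_and] at hω
    refine h.run_bounds hv hOK hT hα hα1 hα2 hCU hCB hCG hG hUB (not_lt.mp hω.1)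
      (fun t ht => not_lt.mp (hω.2 t ht))
  · refine (measureReal_union_le _ _).trans ?_
    have h1 : Pr.real (⋃ t ∈ Finset.range (pr.T - 2), D t) ≤
        ∑ t ∈ Finset.range (pr.T - 2), Pr.real (D t) := measureReal_biUnion_finset_le _ _
    have h2 : ∑ t ∈ Finset.range (pr.T - 2), Pr.real (D t) ≤
        (pr.T - 2 : ℕ) * (pr.δ / (2 * pr.T)) := by
      refine (Finset.sum_le_sum fun t _ => hD t).trans (le_of_eq ?_)
      simp
    have h3 : ((pr.T - 2 : ℕ) : ℝ) * (pr.δ / (2 * pr.T)) ≤ pr.T * (pr.δ / (2 * pr.T)) := by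
      gcongr
      omega
    have h4 : (pr.T : ℝ) * (pr.δ / (2 * pr.T)) = pr.δ / 2 := by field_simp
    linarith

end ZOProblem

/-! ### Inverting the deviation scale. -/

theorem one_le_logFactor {p : ℝ} (hp : 1 < p) (r : ℝ) : 1 ≤ logFactor p r := by
  have : 0 < p - 1 := by linarith
  exact Real.one_le_rpow (by linarith [le_max_left 0 (Real.log r)]) (by positivity)

/-- A batch ratio of order `r^(p/(p-1))` times the logarithmic factor makes the deviation scale
small. -/
theorem exists_batch_constant {p C c : ℝ} (hp : 1 < p) (hp2 : p ≤ 2) (hC : 0 < C) (hc : 0 < c) :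
    ∃ K : ℝ, 0 < K ∧ ∀ r y : ℝ, 1 / 6 ≤ r → K * (r ^ (p / (p - 1)) * logFactor p r) ≤ y →
      1 ≤ y ∧ C * (r * (1 / y) ^ ((p - 1) / p) * Real.sqrt (1 + Real.log y)) ≤ c := by
  have hp1 : 0 < p - 1 := by linarith
  have hp0 : 0 < p := by linarith
  set a := p / (p - 1) with ha
  have ha2 : 2 ≤ a := by rw [ha, le_div_iff₀ hp1]; linarith
  have ha0 : 0 < a := by linarith
  have hb : (p - 1) / p = a⁻¹ := by rw [ha, inv_div]
  -- The final estimate is `C · 2 (1 + a) / k ≤ c`, which this `k` satisfies with room. The bound `k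
  -- ≥ 32` also gives `k² r ≥ 1` for `r ≥ 1 / 6`.
  set k := 32 * (1 + 2 * C * (1 + a) / c) with hk
  have hk32 : 32 ≤ k := by
    have : 0 ≤ 2 * C * (1 + a) / c := by positivity
    rw [hk]; linarith
  have hk0 : 0 < k := by linarith
  refine ⟨k ^ (2 * a), by positivity, fun r y hr hy => ?_⟩
  have hr0 : 0 < r := by linarith
  have hl1 := one_le_logFactor hp r
  have hl0 : 0 < logFactor p r := by linarith
  set ℓ := logFactor p r with hℓ
  set P := max 0 (Real.log r) with hP
  have hP0 : 0 ≤ P := le_max_left _ _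
  have hℓP : ℓ = (1 + P) ^ (a / 2) := by
    rw [hℓ, logFactor, ← hP, ha]; congr 1; field_simp
  have hra : 0 < r ^ a := by positivity
  set w := y / (r ^ a * ℓ) with hw
  have hyw : y = w * (r ^ a * ℓ) := by rw [hw]; field_simp
  have hKw : k ^ (2 * a) ≤ w := by rw [hw, le_div_iff₀ (by positivity)]; exact hy
  have hK1 : 1 ≤ k ^ (2 * a) := Real.one_le_rpow (by linarith) (by positivity)
  have hw1 : 1 ≤ w := hK1.trans hKw
  have hw0 : 0 < w := by linarith
  have hy1 : 1 ≤ y := by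
    refine le_trans ?_ hy
    have h1 : 1 ≤ k ^ (2 * a) * r ^ a := by
      rw [Real.rpow_mul hk0.le, ← Real.mul_rpow (by positivity) hr0.le]
      refine Real.one_le_rpow ?_ ha0.le
      rw [Real.rpow_two]
      nlinarith
    rw [← mul_assoc]
    nlinarith
  refine ⟨hy1, ?_⟩
  have hlogw : 0 ≤ Real.log w := Real.log_nonneg hw1
  have hlogy : 1 + Real.log y ≤ 3 * a / 2 * ((1 + Real.log w) * (1 + P)) := by
    rw [hyw, Real.log_mul hw0.ne' (by positivity), Real.log_mul hra.ne' hl0.ne',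
      Real.log_rpow hr0, hℓP, Real.log_rpow (by linarith)]
    have h1 : Real.log (1 + P) ≤ P := by
      have := Real.log_le_sub_one_of_pos (x := 1 + P) (by linarith)
      linarith
    have h2 : Real.log r ≤ P := le_max_right _ _
    have h3 : a * Real.log r ≤ a * P := by gcongr
    have h4 : a / 2 * Real.log (1 + P) ≤ a / 2 * P := by gcongr
    have h5 : 0 ≤ Real.log w * P := by positivity
    nlinarith
  -- The logarithm of the surplus `w` is paid by one of the two powers `w^(1/a)` available after
  -- squaring.
  have hlogw2 : 1 + Real.log w ≤ (1 + a) * w ^ a⁻¹ := by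
    have h1 := Real.log_le_rpow_div hw0.le (ε := a⁻¹) (by positivity)
    have h2 : 1 ≤ w ^ a⁻¹ := Real.one_le_rpow hw1 (by positivity)
    rw [div_inv_eq_mul] at h1
    linarith
  have hkw : k ^ 2 ≤ w ^ a⁻¹ := by
    calc k ^ 2 = (k ^ (2 * a)) ^ a⁻¹ := by
          rw [← Real.rpow_mul hk0.le, mul_assoc, mul_inv_cancel₀ ha0.ne', mul_one, Real.rpow_two]
      _ ≤ w ^ a⁻¹ := by gcongr
  have hwa : 0 < w ^ a⁻¹ := by positivity
  -- The exponent of `logFactor` is `a / 2`, so its `a`-th root is `√(1 + P)`. This cancels the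
  -- contribution of `r` to `√(1 + log y)`.
  have hyr : r * (1 / y) ^ a⁻¹ = (w ^ a⁻¹)⁻¹ * (Real.sqrt (1 + P))⁻¹ := by
    rw [one_div, Real.inv_rpow (by linarith), hyw, Real.mul_rpow hw0.le (by positivity),
      Real.mul_rpow hra.le hl0.le, ← Real.rpow_mul hr0.le, mul_inv_cancel₀ ha0.ne', Real.rpow_one,
      hℓP, ← Real.rpow_mul (by linarith), Real.sqrt_eq_rpow]
    have : a / 2 * a⁻¹ = 1 / 2 := by field_simp
    rw [this]
    field_simp
  have hsq : (r * (1 / y) ^ a⁻¹ * Real.sqrt (1 + Real.log y)) ^ 2 ≤ (2 * (1 + a) / k) ^ 2 := by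
    rw [mul_pow, Real.sq_sqrt (by linarith [Real.log_nonneg hy1]), hyr, mul_pow, inv_pow, inv_pow,
      Real.sq_sqrt (by linarith)]
    calc ((w ^ a⁻¹) ^ 2)⁻¹ * (1 + P)⁻¹ * (1 + Real.log y)
        ≤ ((w ^ a⁻¹) ^ 2)⁻¹ * (1 + P)⁻¹ *
          (3 * a / 2 * (((1 + a) * w ^ a⁻¹) * (1 + P))) := by
          refine mul_le_mul_of_nonneg_left (hlogy.trans ?_) (by positivity)
          gcongr
      _ = 3 * a / 2 * (1 + a) / w ^ a⁻¹ := by field_simp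
      _ ≤ 3 * a / 2 * (1 + a) / k ^ 2 := by gcongr
      _ ≤ (2 * (1 + a) / k) ^ 2 := by
          rw [div_pow]
          gcongr
          nlinarith
  have h1 : r * (1 / y) ^ a⁻¹ * Real.sqrt (1 + Real.log y) ≤ 2 * (1 + a) / k :=
    le_of_sq_le_sq hsq (by positivity)
  rw [hb]
  refine (mul_le_mul_of_nonneg_left h1 hC.le).trans ?_
  rw [mul_div_assoc', div_le_iff₀ hk0, hk]
  have : c * (32 * (1 + 2 * C * (1 + a) / c)) = 32 * c + 32 * (2 * C * (1 + a)) := by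
    field_simp
  rw [this]
  nlinarith [mul_pos hC (show 0 < 1 + a by linarith)]

/-! ### The tuned stepsize and horizon. -/

namespace ZOProblem

variable {d : ℕ} {Ξ : Type*} [MeasurableSpace Ξ] {pb : ZOProblem d Ξ} {pr : MomentumParams}
  {Ω : Type*} {s : Fin pr.M₀ ⊕ (ℕ × Fin pr.M) → Ω → EuclideanSpace ℝ (Fin d) × Ξ} {ε : ℝ}

/-- The real number of which the horizon is the ceiling, up to an additive `2`. -/
def horizon (pb : ZOProblem d Ξ) (pr : MomentumParams) (ε : ℝ) : ℝ :=
  512 * Real.sqrt 3 * (pb.L * pb.gapBar pr.μ / ((1 - pr.β) * ε ^ 2))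

theorem one_le_sqrt_three : 1 ≤ Real.sqrt 3 := Real.one_le_sqrt.mpr (by norm_num)

theorem sqrt_three_le_two : Real.sqrt 3 ≤ 2 := by
  rw [Real.sqrt_le_left (by norm_num)]; norm_num

theorem Tuned.two_le_horizon (ht : pb.Tuned pr ε) (hv : pr.Valid) : 2 ≤ pb.horizon pr ε := by
  have hc : 0 < 1 - pr.β := by linarith [hv.β_lt_one]
  have hε := ht.ε_pos
  have h1 : 1 / 32 ≤ pb.L * pb.gapBar pr.μ / ((1 - pr.β) * ε ^ 2) := by
    rw [le_div_iff₀ (by positivity)]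
    have := hv.half_le_β
    nlinarith [ht.ε_le, sq_nonneg ε]
  rw [horizon]
  nlinarith [one_le_sqrt_three]

theorem Tuned.T_eq_ceil (ht : pb.Tuned pr ε) : pr.T = ⌈pb.horizon pr ε⌉₊ + 2 := ht.T_eq

theorem Tuned.horizon_le (ht : pb.Tuned pr ε) : pb.horizon pr ε ≤ (pr.T : ℝ) - 2 := by
  rw [ht.T_eq_ceil]
  push_cast
  linarith [Nat.le_ceil (pb.horizon pr ε)]

theorem Tuned.T_sub_one_le (ht : pb.Tuned pr ε) (hv : pr.Valid) :
    (pr.T : ℝ) - 1 ≤ 2 * pb.horizon pr ε := by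
  have h2 := ht.two_le_horizon hv
  rw [ht.T_eq_ceil]
  push_cast
  linarith [Nat.ceil_lt_add_one (show 0 ≤ pb.horizon pr ε by linarith)]

theorem Tuned.four_le_T (ht : pb.Tuned pr ε) (hv : pr.Valid) : 4 ≤ pr.T := by
  have h1 := ht.two_le_horizon hv
  have h2 := ht.horizon_le
  have : (4 : ℝ) ≤ pr.T := by linarith
  exact_mod_cast this

theorem Tuned.α_mul_horizon (ht : pb.Tuned pr ε) (h : pb.Assumptions) (hv : pr.Valid) :
    pr.α * pb.horizon pr ε = 32 * pb.gapBar pr.μ / ε ^ 2 := by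
  have hc : 0 < 1 - pr.β := by linarith [hv.β_lt_one]
  have hε := ht.ε_pos
  have hL := h.L_pos
  rw [ht.α_eq, horizon]
  field_simp
  ring

theorem Tuned.L_mul_α_le (ht : pb.Tuned pr ε) (h : pb.Assumptions) (hv : pr.Valid) :
    pb.L * pr.α ≤ (1 - pr.β) / 16 := by
  have hc : 0 < 1 - pr.β := by linarith [hv.β_lt_one]
  have hL := h.L_pos
  calc pb.L * pr.α = (1 - pr.β) / (16 * Real.sqrt 3) := by rw [ht.α_eq]; field_simp
    _ ≤ (1 - pr.β) / (16 * 1) := by gcongr; exact one_le_sqrt_three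
    _ = _ := by ring

theorem Tuned.L_mul_μ_le (ht : pb.Tuned pr ε) (h : pb.Assumptions) :
    d * (pb.L * pr.μ) ≤ ε / 4 := by
  have hL := h.L_pos
  have hd : (0 : ℝ) < d := by exact_mod_cast h.d_pos
  calc d * (pb.L * pr.μ) ≤ d * (pb.L * (ε / (4 * pb.L * d))) := by gcongr; exact ht.μ_le
    _ = ε / 4 := by field_simp

/-- By `(a + b)² ≤ 2a² + 2b²`, the square of `H_μ` is at most `4 L Δ₀ + 2 L² μ²`, which is four
times `L` times the enlarged gap. -/
theorem Assumptions.H_le (h : pb.Assumptions) {μ : ℝ} :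
    pb.H μ ≤ 2 * Real.sqrt (pb.L * pb.gapBar μ) := by
  have hL := h.L_pos
  have hg := h.gap_nonneg
  have hD := h.gapBar_nonneg μ
  refine le_of_sq_le_sq ?_ (by positivity)
  rw [mul_pow, Real.sq_sqrt (by positivity), H, gapBar]
  have h1 := Real.sq_sqrt (show 0 ≤ 2 * pb.L * pb.gap by positivity)
  nlinarith [sq_nonneg (Real.sqrt (2 * pb.L * pb.gap) - pb.L * μ)]

theorem Assumptions.U_nonneg (h : pb.Assumptions) (hμ : 0 < pr.μ) {C : ℝ} (hC : 0 ≤ C)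
    (hy : 1 ≤ pr.M / ((1 - pr.β) * pr.lam)) : 0 ≤ pb.U pr C := by
  rw [U_eq]; exact mul_nonneg hC (h.devScale_pos hμ hy).le

theorem Assumptions.G_nonneg (h : pb.Assumptions) (hμ : 0 < pr.μ) {C : ℝ} (hC : 0 ≤ C)
    (hy : 1 ≤ pr.M₀ / pr.lam₀) : 0 ≤ pb.G pr C := by
  rw [G_eq]; exact mul_nonneg hC (h.devScale_pos hμ hy).le

theorem Assumptions.B_nonneg (h : pb.Assumptions) (hμ : 0 < pr.μ) {C : ℝ} (hC : 0 ≤ C)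
    (hy : 1 ≤ pr.M / ((1 - pr.β) * pr.lam)) : 0 ≤ pb.B pr C := by
  have := h.S_pos hμ
  rw [B_eq]; positivity

theorem Assumptions.one_le_running (hv : pr.Valid) (hT : 1 ≤ pr.T) (hOK : pr.BatchOK) :
    1 ≤ pr.M / ((1 - pr.β) * pr.lam) := by
  have hc : 0 < 1 - pr.β := by linarith [hv.β_lt_one]
  have hlam : 0 < pr.lam := (Real.log_pos (by norm_num)).trans_le (hv.log_two_le_lam hT)
  exact (one_le_div (by positivity)).mpr hOK.running

theorem Assumptions.one_le_warm (hv : pr.Valid) (hOK : pr.BatchOK) : 1 ≤ pr.M₀ / pr.lam₀ :=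
  (one_le_div ((Real.log_pos (by norm_num)).trans_le hv.log_two_le_lam₀)).mpr hOK.warm

variable [MeasurableSpace Ω] {Pr : Measure Ω} [IsProbabilityMeasure Pr]

/-- Convergence to accuracy `ε` when the error levels are below `ε / 20`. -/
theorem Assumptions.tuned_convergence (h : pb.Assumptions) (hv : pr.Valid)
    (hs : pb.IsSampling pr Pr s) (ht : pb.Tuned pr ε) {CU CB CG : ℝ}
    (hCU : 240 ≤ CU) (hCB : 144 / (pb.p - 1) ≤ CB) (hCG : 240 + 144 / (pb.p - 1) ≤ CG)
    (hOK : pr.BatchOK) (hG : pb.G pr CG ≤ 1 / 20 * ε) (hU : pb.U pr CU ≤ 1 / 20 * ε)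
    (hB : pb.B pr CB ≤ 1 / 20 * ε) :
    1 - pr.δ ≤ Pr.real {ω | pb.avgGradSq pr s ω ≤ ε ^ 2} := by
  have hμ := hv.μ_pos
  have hL := h.L_pos
  have hε := ht.ε_pos
  have hβ0 : 0 < pr.β := by linarith [hv.half_le_β]
  have hβ1 := hv.β_lt_one
  have hc : 0 < 1 - pr.β := by linarith
  have hp1 : 0 < pb.p - 1 := by linarith [h.one_lt_p]
  have hCp : 0 < 144 / (pb.p - 1) := by positivity
  have hT := ht.four_le_T hv
  have hy := Assumptions.one_le_running hv (by omega) hOK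
  have hU0 := h.U_nonneg hμ (by linarith : 0 ≤ CU) hy
  have hB0 := h.B_nonneg hμ (by linarith : 0 ≤ CB) hy
  have hG0 := h.G_nonneg hμ (by linarith : 0 ≤ CG) (Assumptions.one_le_warm hv hOK)
  have hD := h.gapBar_nonneg pr.μ
  have hα : 0 < pr.α := by rw [ht.α_eq]; positivity
  have hLα := ht.L_mul_α_le h hv
  have hX := ht.two_le_horizon hv
  have hTX := ht.T_sub_one_le hv
  have hXT := ht.horizon_le
  have hαX := ht.α_mul_horizon h hv
  have hU2 : pb.U pr CU ^ 2 ≤ ε ^ 2 / 400 := by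
    calc pb.U pr CU ^ 2 ≤ (1 / 20 * ε) ^ 2 := by gcongr
      _ = _ := by ring
  have hB2 : pb.B pr CB ^ 2 ≤ ε ^ 2 / 400 := by
    calc pb.B pr CB ^ 2 ≤ (1 / 20 * ε) ^ 2 := by gcongr
      _ = _ := by ring
  have hG2 : pb.G pr CG ^ 2 ≤ ε ^ 2 / 400 := by
    calc pb.G pr CG ^ 2 ≤ (1 / 20 * ε) ^ 2 := by gcongr
      _ = _ := by ring
  have hα1 : pr.α ≤ 1 / (4 * pb.L) := by
    rw [le_div_iff₀ (by positivity)]; nlinarith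
  have hα2 : pr.α ≤ (1 - pr.β) / (4 * Real.sqrt 3 * pr.β * pb.L) := by
    have := one_le_sqrt_three
    rw [ht.α_eq]
    refine div_le_div_of_nonneg_left hc.le (by positivity) ?_
    calc 4 * Real.sqrt 3 * pr.β * pb.L ≤ 16 * Real.sqrt 3 * 1 * pb.L := by gcongr; norm_num
      _ = _ := by ring
  have hwarm : 5 * pr.α / 4 * pb.G pr CG ^ 2 + 2 * pr.α / (1 - pr.β) *
      (pr.β * ((1 + pb.L * pr.α) * pb.G pr CG + pb.L * pr.α * pb.H pr.μ) +
        (1 - pr.β) * pb.B pr CB) ^ 2 ≤ pb.gapBar pr.μ := by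
    set w := Real.sqrt (pb.L * pb.gapBar pr.μ) with hw
    have hw0 : 0 ≤ w := Real.sqrt_nonneg _
    have hw2 : w ^ 2 = pb.L * pb.gapBar pr.μ := Real.sq_sqrt (by positivity)
    -- From `ε² ≤ 32 w²` and `32 ≤ 36`. All error levels, at most `ε / 20`, are thus at most `3 w /
    -- 10`.
    have hεw : ε ≤ 6 * w := by
      refine le_of_sq_le_sq ?_ (by positivity)
      rw [mul_pow, hw2]
      nlinarith [ht.ε_le, mul_nonneg hL.le hD]
    have hH : pb.H pr.μ ≤ 2 * w := h.H_le
    have hH0 : 0 ≤ pb.H pr.μ := by rw [H]; positivity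
    have hLα0 : 0 < pb.L * pr.α := by positivity
    have hin : pr.β * ((1 + pb.L * pr.α) * pb.G pr CG + pb.L * pr.α * pb.H pr.μ) +
        (1 - pr.β) * pb.B pr CB ≤ w := by
      calc _ ≤ 1 * ((1 + 1 / 16) * (3 / 10 * w) + 1 / 16 * (2 * w)) + 1 * (3 / 10 * w) := by
            gcongr <;> linarith
        _ ≤ w := by linarith
    have hin0 : 0 ≤ pr.β * ((1 + pb.L * pr.α) * pb.G pr CG + pb.L * pr.α * pb.H pr.μ) +
        (1 - pr.β) * pb.B pr CB := by positivity
    have h1 : 2 * pr.α / (1 - pr.β) ≤ 1 / (8 * pb.L) := by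
      rw [div_le_div_iff₀ hc (by positivity)]; linarith
    have h2 : 5 * pr.α / 4 * pb.G pr CG ^ 2 ≤ pb.gapBar pr.μ / 8 := by
      have e1 : pb.G pr CG ^ 2 ≤ pb.L * pb.gapBar pr.μ := by
        linarith [ht.ε_le, mul_nonneg hL.le hD]
      calc 5 * pr.α / 4 * pb.G pr CG ^ 2 ≤ 5 * pr.α / 4 * (pb.L * pb.gapBar pr.μ) := by gcongr
        _ = 5 / 4 * (pb.L * pr.α) * pb.gapBar pr.μ := by ring
        _ ≤ 5 / 4 * (1 / 16) * pb.gapBar pr.μ := by gcongr; linarith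
        _ ≤ _ := by linarith
    calc _ ≤ pb.gapBar pr.μ / 8 + 1 / (8 * pb.L) * w ^ 2 := by gcongr
      _ = pb.gapBar pr.μ / 4 := by rw [hw2]; field_simp; ring
      _ ≤ _ := by linarith
  -- `(T - 1) α` is at most `64 / ε²` enlarged gaps and the error is at most `ε² / 80`, so `4 / 5`
  -- of the budget is used.
  have hnoise : (pr.T - 1) * pr.α * (pb.U pr CU ^ 2 + 4 * pb.B pr CB ^ 2) ≤ pb.gapBar pr.μ := by
    calc (pr.T - 1) * pr.α * (pb.U pr CU ^ 2 + 4 * pb.B pr CB ^ 2)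
        ≤ 2 * pb.horizon pr ε * pr.α * (ε ^ 2 / 400 + 4 * (ε ^ 2 / 400)) := by gcongr
      _ = 2 * (pr.α * pb.horizon pr ε) * (ε ^ 2 / 80) := by ring
      _ = 4 / 5 * pb.gapBar pr.μ := by rw [hαX]; field_simp; ring
      _ ≤ _ := by linarith
  refine (h.localized_convergence hv hs hCU hCB hCG hOK hT hα hα1 hα2 hwarm hnoise).trans
    (measureReal_mono ?_)
  rintro ω ⟨-, hω⟩
  refine hω.trans ?_
  -- The parts of the final bound are `ε² / 4` for descent, `ε² / 20` for noise and bias together,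
  -- and `ε² / 8` for smoothing.
  have h1 : 8 * pb.gapBar pr.μ / (pr.α * (pr.T - 2)) ≤ ε ^ 2 / 4 := by
    rw [div_le_iff₀ (by have : 0 < (pr.T : ℝ) - 2 := by linarith
                        positivity)]
    calc 8 * pb.gapBar pr.μ = ε ^ 2 / 4 * (pr.α * pb.horizon pr ε) := by
          rw [hαX]; field_simp; ring
      _ ≤ _ := by gcongr
  have h2 : pb.L * pr.μ ≤ ε / 4 := by
    have hd : (1 : ℝ) ≤ d := by exact_mod_cast h.d_pos
    have := ht.L_mul_μ_le h
    have h0 : pb.L * pr.μ ≤ d * (pb.L * pr.μ) := le_mul_of_one_le_left (by positivity) hd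
    linarith
  have h3 : (pb.L * pr.μ) ^ 2 ≤ (ε / 4) ^ 2 := by gcongr
  have h4 : 2 * pb.L ^ 2 * pr.μ ^ 2 = 2 * (pb.L * pr.μ) ^ 2 := by ring
  have h5 : (ε / 4) ^ 2 = ε ^ 2 / 16 := by ring
  rw [h4]
  linarith [sq_nonneg ε]

end ZOProblem

/-- As `log 5 ≤ 2`, the base `1 + max 0 (log r)` grows by at most `2`, hence by a factor of at most
`3`. -/
theorem logFactor_le_of_le_five_mul {p r A : ℝ} (hp : 1 < p) (hr : 0 < r) (hA : 0 < A)
    (hrA : r ≤ 5 * A) : logFactor p r ≤ 3 ^ (p / (2 * (p - 1))) * logFactor p A := by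
  have hp1 : 0 < p - 1 := by linarith
  have hP : 0 ≤ max 0 (Real.log A) := le_max_left _ _
  have h5 : Real.log 5 ≤ 2 := by
    rw [Real.log_le_iff_le_exp (by norm_num)]
    have h1 : (2.7 : ℝ) ≤ Real.exp 1 := by linarith [Real.exp_one_gt_d9]
    calc (5 : ℝ) ≤ 2.7 ^ 2 := by norm_num
      _ ≤ Real.exp 1 ^ 2 := by gcongr
      _ = Real.exp 2 := by rw [← Real.exp_nat_mul]; norm_num
  have h1 : Real.log r ≤ 2 + max 0 (Real.log A) := by
    calc Real.log r ≤ Real.log (5 * A) := Real.log_le_log hr hrA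
      _ = Real.log 5 + Real.log A := Real.log_mul (by norm_num) hA.ne'
      _ ≤ _ := add_le_add h5 (le_max_right _ _)
  rw [logFactor, logFactor, ← Real.mul_rpow (by norm_num) (by linarith)]
  refine Real.rpow_le_rpow (by linarith [le_max_left 0 (Real.log r)]) ?_ (by positivity)
  have : max 0 (Real.log r) ≤ 2 + max 0 (Real.log A) := max_le (by linarith) h1
  linarith

/-! ### Counting evaluations. -/

namespace ZOProblem

variable {d : ℕ} {Ξ : Type*} [MeasurableSpace Ξ] {pb : ZOProblem d Ξ} {pr : MomentumParams}
  {Ω : Type*} {s : Fin pr.M₀ ⊕ (ℕ × Fin pr.M) → Ω → EuclideanSpace ℝ (Fin d) × Ξ} {ε : ℝ}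

theorem estimator_snd (pb : ZOProblem d Ξ) (μ τ : ℝ) {M : ℕ}
    (z : Fin M → EuclideanSpace ℝ (Fin d) × Ξ) (x : EuclideanSpace ℝ (Fin d)) :
    (pb.estimator μ τ z x).2 = 2 * M := by
  simp [estimator, twoPoint, query, mul_comm]

theorem state_queries (ω : Ω) (t : ℕ) :
    (pb.state pr s ω t).queries = 2 * pr.M₀ + 2 * pr.M * t := by
  induction t with
  | zero => exact estimator_snd pb pr.μ (pb.tau₀ pr) (fun l => s (Sum.inl l) ω) pb.x₀
  | succ t ih =>
    have : (pb.state pr s ω (t + 1)).queries = (pb.state pr s ω t).queries +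
        (pb.estimator pr.μ (pb.tau pr) (fun l => s (Sum.inr (t + 1, l)) ω)
          (pb.state pr s ω t).x).2 := rfl
    rw [this, ih, estimator_snd]
    ring

theorem Assumptions.R_eq (h : pb.Assumptions) (μ : ℝ) :
    pb.R μ = Real.sqrt d * (Real.sqrt (pb.L * pb.gapBar μ) + pb.σ) + d * (pb.L * μ) := by
  have hd : (0 : ℝ) < d := by exact_mod_cast h.d_pos
  have h1 : (d : ℝ) / Real.sqrt d = Real.sqrt d := Real.div_sqrt
  rw [R, S, mul_add, mul_div_assoc', mul_comm (d : ℝ) (_ + _), mul_div_assoc, h1, mul_comm]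

theorem Tuned.sqrt_ge (ht : pb.Tuned pr ε) (h : pb.Assumptions) :
    ε ≤ 6 * Real.sqrt (pb.L * pb.gapBar pr.μ) := by
  have hD := mul_nonneg h.L_pos.le (h.gapBar_nonneg pr.μ)
  refine le_of_sq_le_sq ?_ (by positivity)
  rw [mul_pow, Real.sq_sqrt hD]
  linarith [ht.ε_le]

theorem Tuned.le_R_div (ht : pb.Tuned pr ε) (h : pb.Assumptions) (hv : pr.Valid) :
    1 / 6 ≤ pb.R pr.μ / ε := by
  have hσ := h.σ_pos
  have hL := h.L_pos
  have hμ := hv.μ_pos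
  have h1 := ht.sqrt_ge h
  have h2 : 1 ≤ Real.sqrt d := Real.one_le_sqrt.mpr (by exact_mod_cast h.d_pos)
  have h3 : 0 ≤ d * (pb.L * pr.μ) := by positivity
  rw [le_div_iff₀ ht.ε_pos, h.R_eq]
  have h4 : Real.sqrt (pb.L * pb.gapBar pr.μ) + pb.σ ≤
      Real.sqrt d * (Real.sqrt (pb.L * pb.gapBar pr.μ) + pb.σ) :=
    le_mul_of_one_le_left (by positivity) h2
  linarith

theorem devScale_eq (pb : ZOProblem d Ξ) (μ y : ℝ) (hε : 0 < ε) : pb.devScale μ y =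
    ε * (pb.R μ / ε * (1 / y) ^ ((pb.p - 1) / pb.p) * Real.sqrt (1 + Real.log y)) := by
  rw [devScale, R]
  field_simp

/-- Batches of the stated order are admissible and make the error levels at most `c ε`. -/
theorem Tuned.error_levels_le (ht : pb.Tuned pr ε) (h : pb.Assumptions) (hv : pr.Valid)
    {C c K CU CB CG : ℝ} (hCU : CU ≤ C) (hCB0 : 0 ≤ CB) (hCB : CB ≤ C) (hCG : CG ≤ C)
    (hK : ∀ r y : ℝ, 1 / 6 ≤ r → K * (r ^ (pb.p / (pb.p - 1)) * logFactor pb.p r) ≤ y →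
      1 ≤ y ∧ C * (r * (1 / y) ^ ((pb.p - 1) / pb.p) * Real.sqrt (1 + Real.log y)) ≤ c)
    (hM₀ : K * pb.batchScale₀ pr ε ≤ pr.M₀) (hM : K * pb.batchScale pr ε ≤ pr.M) :
    pr.BatchOK ∧ pb.G pr CG ≤ c * ε ∧ pb.U pr CU ≤ c * ε ∧ pb.B pr CB ≤ c * ε := by
  have hε := ht.ε_pos
  have hμ := hv.μ_pos
  have hc : 0 < 1 - pr.β := by linarith [hv.β_lt_one]
  have hl0 : 0 < pr.lam₀ := (Real.log_pos (by norm_num)).trans_le hv.log_two_le_lam₀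
  have hl : 0 < pr.lam := (Real.log_pos (by norm_num)).trans_le
    (hv.log_two_le_lam (by linarith [ht.four_le_T hv]))
  have hr := ht.le_R_div h hv
  obtain ⟨hy0, hb0⟩ := hK _ (pr.M₀ / pr.lam₀) hr (by
    rw [le_div_iff₀ hl0]
    refine le_trans (le_of_eq ?_) hM₀
    rw [batchScale₀]; ring)
  obtain ⟨hy, hb⟩ := hK _ (pr.M / ((1 - pr.β) * pr.lam)) hr (by
    rw [le_div_iff₀ (by positivity)]
    refine le_trans (le_of_eq ?_) hM
    rw [batchScale]; ring)
  have key : ∀ y, 1 ≤ y → C * (pb.R pr.μ / ε * (1 / y) ^ ((pb.p - 1) / pb.p) *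
      Real.sqrt (1 + Real.log y)) ≤ c → ∀ C' ≤ C, C' * pb.devScale pr.μ y ≤ c * ε := by
    intro y hy hb C' hC'
    calc C' * pb.devScale pr.μ y ≤ C * pb.devScale pr.μ y :=
          mul_le_mul_of_nonneg_right hC' (h.devScale_pos hμ hy).le
      _ = C * (pb.R pr.μ / ε * (1 / y) ^ ((pb.p - 1) / pb.p) *
          Real.sqrt (1 + Real.log y)) * ε := by rw [devScale_eq pb pr.μ y hε]; ring
      _ ≤ c * ε := mul_le_mul_of_nonneg_right hb hε.le
  refine ⟨⟨(one_le_div hl0).mp hy0, (one_le_div (by positivity)).mp hy⟩, ?_, ?_, ?_⟩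
  · rw [G_eq]; exact key _ hy0 hb0 _ hCG
  · rw [U_eq]; exact key _ hy hb _ hCU
  · rw [B_eq]; exact (h.bias_le_devScale hμ hy hCB0).trans (key _ hy hb _ hCB)

theorem Tuned.L_mul_μ_le_quarter (ht : pb.Tuned pr ε) (h : pb.Assumptions) (hv : pr.Valid) :
    pb.L * pr.μ ≤ ε / 4 := by
  have hd : (1 : ℝ) ≤ d := by exact_mod_cast h.d_pos
  exact (le_mul_of_one_le_left (mul_pos h.L_pos hv.μ_pos).le hd).trans (ht.L_mul_μ_le h)

theorem Tuned.abs_gapBar_sub_gap_le (ht : pb.Tuned pr ε) (h : pb.Assumptions) (hv : pr.Valid) :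
    |pb.gapBar pr.μ - pb.gap| ≤ ε ^ 2 / (pb.L * d ^ 2) := by
  have hL := h.L_pos
  have hμ := hv.μ_pos
  have hε := ht.ε_pos
  have hd : (0 : ℝ) < d := by exact_mod_cast h.d_pos
  rw [gapBar, add_sub_cancel_left, abs_of_nonneg (by positivity), le_div_iff₀ (by positivity)]
  calc pb.L * pr.μ ^ 2 / 2 * (pb.L * d ^ 2) = (d * (pb.L * pr.μ)) ^ 2 / 2 := by ring
    _ ≤ (ε / 4) ^ 2 / 2 := by have := ht.L_mul_μ_le h; gcongr
    _ ≤ ε ^ 2 := by nlinarith [sq_nonneg ε]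

theorem Tuned.abs_R_sub_le (ht : pb.Tuned pr ε) (h : pb.Assumptions) (hv : pr.Valid) :
    |pb.R pr.μ - Real.sqrt d * (Real.sqrt (pb.L * pb.gap) + pb.σ)| ≤ ε / 2 := by
  have hL := h.L_pos
  have hμ := hv.μ_pos
  have hg := h.gap_nonneg
  have hd : (1 : ℝ) ≤ d := by exact_mod_cast h.d_pos
  have hd2 : Real.sqrt d ≤ d := by
    rw [Real.sqrt_le_left (by linarith)]; nlinarith
  have h1 : Real.sqrt (pb.L * pb.gap) ≤ Real.sqrt (pb.L * pb.gapBar pr.μ) := by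
    refine Real.sqrt_le_sqrt ?_
    rw [gapBar]
    have : 0 ≤ pb.L * pr.μ ^ 2 / 2 := by positivity
    gcongr
    linarith
  -- Enlarging the gap adds only `(L μ)² / 2` under the root. With `√d ≤ d`, both parts of the
  -- difference are then at most `d L μ ≤ ε / 4`.
  have h2 : Real.sqrt (pb.L * pb.gapBar pr.μ) ≤ Real.sqrt (pb.L * pb.gap) + pb.L * pr.μ := by
    rw [Real.sqrt_le_left (by positivity), add_sq, Real.sq_sqrt (by positivity), gapBar]
    have : 0 ≤ 2 * Real.sqrt (pb.L * pb.gap) * (pb.L * pr.μ) := by positivity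
    nlinarith [sq_nonneg (pb.L * pr.μ)]
  have e : pb.R pr.μ - Real.sqrt d * (Real.sqrt (pb.L * pb.gap) + pb.σ) = Real.sqrt d *
      (Real.sqrt (pb.L * pb.gapBar pr.μ) - Real.sqrt (pb.L * pb.gap)) + d * (pb.L * pr.μ) := by
    rw [h.R_eq]; ring
  have h3 : 0 ≤ Real.sqrt (pb.L * pb.gapBar pr.μ) - Real.sqrt (pb.L * pb.gap) := by linarith
  rw [e, abs_of_nonneg (by positivity)]
  have h4 : Real.sqrt d * (Real.sqrt (pb.L * pb.gapBar pr.μ) - Real.sqrt (pb.L * pb.gap)) ≤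
      d * (pb.L * pr.μ) := by gcongr; linarith
  linarith [ht.L_mul_μ_le h]

/-- The evaluation count in terms of `R_μ` and the enlarged gap. -/
theorem Tuned.queries_le (ht : pb.Tuned pr ε) (hv : pr.Valid) {κ : ℝ}
    (hM₀ : (pr.M₀ : ℝ) ≤ κ * pb.batchScale₀ pr ε) (hM : (pr.M : ℝ) ≤ κ * pb.batchScale pr ε)
    (ω : Ω) : ((pb.state pr s ω (pr.T - 1)).queries : ℝ) ≤ 4096 * κ *
      ((pb.R pr.μ / ε) ^ (pb.p / (pb.p - 1)) * (pr.lam₀ * logFactor pb.p (pb.R pr.μ / ε)) +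
        pb.L * pb.gapBar pr.μ / ε ^ 2 * (pb.R pr.μ / ε) ^ (pb.p / (pb.p - 1)) *
          (pr.lam * logFactor pb.p (pb.R pr.μ / ε))) := by
  have hc : 0 < 1 - pr.β := by linarith [hv.β_lt_one]
  have hε := ht.ε_pos
  have hT := ht.four_le_T hv
  have hX := ht.two_le_horizon hv
  rw [state_queries]
  push_cast [show 1 ≤ pr.T by omega]
  have hM0 : (0 : ℝ) ≤ pr.M := Nat.cast_nonneg _
  have hM00 : (0 : ℝ) ≤ pr.M₀ := Nat.cast_nonneg _
  have h1 : (pr.M : ℝ) * (pr.T - 1) ≤ κ * pb.batchScale pr ε * (2 * pb.horizon pr ε) := by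
    have hT0 : (0 : ℝ) ≤ (pr.T : ℝ) - 1 := by linarith [ht.horizon_le]
    exact mul_le_mul hM (ht.T_sub_one_le hv) hT0 (hM0.trans hM)
  set W := pb.L * pb.gapBar pr.μ / ε ^ 2 * (pb.R pr.μ / ε) ^ (pb.p / (pb.p - 1)) *
    (pr.lam * logFactor pb.p (pb.R pr.μ / ε)) with hW
  -- Here the factor `1 - β` of the batch cancels against the horizon.
  have e : κ * pb.batchScale pr ε * (2 * pb.horizon pr ε) = 1024 * Real.sqrt 3 * (κ * W) := by
    rw [batchScale, horizon, hW]
    field_simp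
    ring
  -- No sign of `κ` is assumed; it is recovered from the nonnegativity of the batch size.
  have hW0 : 0 ≤ κ * W := by
    have h2 : 0 ≤ 1024 * Real.sqrt 3 * (κ * W) := by
      rw [← e]; exact mul_nonneg (hM0.trans hM) (by linarith)
    exact nonneg_of_mul_nonneg_right h2 (by positivity)
  have h3 : 1024 * Real.sqrt 3 * (κ * W) ≤ 1024 * 2 * (κ * W) := by
    gcongr; exact sqrt_three_le_two
  rw [batchScale₀] at hM₀
  linarith

/-- The evaluation count in terms of the initial gap. -/
theorem Tuned.queries_le_of_gap (ht : pb.Tuned pr ε) (h : pb.Assumptions) (hv : pr.Valid) {κ : ℝ}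
    (hM₀ : (pr.M₀ : ℝ) ≤ κ * pb.batchScale₀ pr ε) (hM : (pr.M : ℝ) ≤ κ * pb.batchScale pr ε)
    (hd : 2 ≤ d ∨ ε ^ 2 ≤ 32 * pb.L * pb.gap) {A : ℝ}
    (hA : A = Real.sqrt d * (Real.sqrt (pb.L * pb.gap) + pb.σ) / ε) (ω : Ω) :
    ((pb.state pr s ω (pr.T - 1)).queries : ℝ) ≤
      4096 * (3 * 5 ^ (pb.p / (pb.p - 1)) * 3 ^ (pb.p / (2 * (pb.p - 1)))) * κ *
        (A ^ (pb.p / (pb.p - 1)) * (pr.lam₀ * logFactor pb.p A) +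
          pb.L * pb.gap / ε ^ 2 * A ^ (pb.p / (pb.p - 1)) * (pr.lam * logFactor pb.p A)) := by
  have hε := ht.ε_pos
  have hL := h.L_pos
  have hσ := h.σ_pos
  have hg := h.gap_nonneg
  have hp := h.one_lt_p
  have hp1 : 0 < pb.p - 1 := by linarith
  have hl0 : 0 < pr.lam₀ := (Real.log_pos (by norm_num)).trans_le hv.log_two_le_lam₀
  have hl : 0 < pr.lam := (Real.log_pos (by norm_num)).trans_le
    (hv.log_two_le_lam (by linarith [ht.four_le_T hv]))
  have hd1 : (1 : ℝ) ≤ d := by exact_mod_cast h.d_pos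
  have hLμ0 : 0 < pb.L * pr.μ := mul_pos hL hv.μ_pos
  have hLD : pb.L * pb.gapBar pr.μ = pb.L * pb.gap + (pb.L * pr.μ) ^ 2 / 2 := by
    rw [gapBar]; ring
  have hLμ : (pb.L * pr.μ) ^ 2 ≤ ε ^ 2 / 16 := by
    calc (pb.L * pr.μ) ^ 2 ≤ (ε / 4) ^ 2 := by have := ht.L_mul_μ_le_quarter h hv; gcongr
      _ = _ := by ring
  -- The aim is to replace the enlarged gap by `Δ₀`. For `d ≥ 2` one has `L μ ≤ ε / 8`, so the
  -- smoothing part of `32 L` times the enlarged gap is at most `ε² / 4` and can be absorbed. For `d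
  -- = 1` the available bound on it is the whole of `ε²`, hence the alternative hypothesis.
  have hgap : ε ^ 2 ≤ 49 * (pb.L * pb.gap) := by
    have hLg : 0 ≤ pb.L * pb.gap := by positivity
    rcases hd with hd | hd
    · have h2 : (2 : ℝ) ≤ d := by exact_mod_cast hd
      have h3 : 2 * (pb.L * pr.μ) ≤ ε / 4 :=
        (mul_le_mul_of_nonneg_right h2 hLμ0.le).trans (ht.L_mul_μ_le h)
      have h4 : (2 * (pb.L * pr.μ)) ^ 2 ≤ (ε / 4) ^ 2 := by gcongr
      have h5 := ht.ε_le
      rw [mul_assoc, hLD] at h5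
      linarith
    · linarith
  have hgapBar : pb.L * pb.gapBar pr.μ ≤ 3 * (pb.L * pb.gap) := by linarith [mul_nonneg hL.le hg]
  have hA0 : 1 / 7 ≤ A := by
    have h1 : ε ≤ 7 * Real.sqrt (pb.L * pb.gap) := by
      refine le_of_sq_le_sq ?_ (by positivity)
      rw [mul_pow, Real.sq_sqrt (by positivity)]
      linarith
    have h2 : 1 ≤ Real.sqrt d := Real.one_le_sqrt.mpr hd1
    have h4 : Real.sqrt (pb.L * pb.gap) + pb.σ ≤
        Real.sqrt d * (Real.sqrt (pb.L * pb.gap) + pb.σ) :=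
      le_mul_of_one_le_left (by positivity) h2
    rw [hA, le_div_iff₀ hε]
    linarith
  have hApos : 0 < A := by linarith
  have hr0 : 0 < pb.R pr.μ / ε := by linarith [ht.le_R_div h hv]
  -- `R_μ / ε ≤ A + 1 / 2`, and `A ≥ 1 / 7` turns the additive constant into a multiple of `A`.
  have hrA : pb.R pr.μ / ε ≤ 5 * A := by
    have h1 := (abs_le.mp (ht.abs_R_sub_le h hv)).2
    have h2 : A * ε = Real.sqrt d * (Real.sqrt (pb.L * pb.gap) + pb.σ) := by
      rw [hA]; field_simp
    rw [div_le_iff₀ hε]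
    nlinarith
  have hℓ := logFactor_le_of_le_five_mul hp hr0 hApos hrA
  have hℓ1 := one_le_logFactor hp (pb.R pr.μ / ε)
  have hℓA := one_le_logFactor hp A
  have hpow : (pb.R pr.μ / ε) ^ (pb.p / (pb.p - 1)) ≤
      5 ^ (pb.p / (pb.p - 1)) * A ^ (pb.p / (pb.p - 1)) := by
    rw [← Real.mul_rpow (by norm_num) hApos.le]
    exact Real.rpow_le_rpow hr0.le hrA (by positivity)
  have hκ : 0 ≤ κ := by
    have h1 : 0 < pb.batchScale₀ pr ε := by rw [batchScale₀]; positivity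
    exact nonneg_of_mul_nonneg_left ((Nat.cast_nonneg _).trans hM₀) h1
  refine (ht.queries_le hv hM₀ hM ω).trans ?_
  set r := pb.R pr.μ / ε
  set a := pb.p / (pb.p - 1)
  set k := (3 : ℝ) ^ (pb.p / (2 * (pb.p - 1)))
  have hk : 0 < k := by positivity
  have h1 : r ^ a * (pr.lam₀ * logFactor pb.p r) ≤
      3 * (5 ^ a * A ^ a * (pr.lam₀ * (k * logFactor pb.p A))) := by
    calc r ^ a * (pr.lam₀ * logFactor pb.p r) ≤
          5 ^ a * A ^ a * (pr.lam₀ * (k * logFactor pb.p A)) := by gcongr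
      _ ≤ _ := le_mul_of_one_le_left (by positivity) (by norm_num)
  have h2 : pb.L * pb.gapBar pr.μ / ε ^ 2 * r ^ a * (pr.lam * logFactor pb.p r) ≤
      3 * (pb.L * pb.gap) / ε ^ 2 * (5 ^ a * A ^ a) * (pr.lam * (k * logFactor pb.p A)) := by
    gcongr
  calc 4096 * κ * (r ^ a * (pr.lam₀ * logFactor pb.p r) +
        pb.L * pb.gapBar pr.μ / ε ^ 2 * r ^ a * (pr.lam * logFactor pb.p r))
      ≤ 4096 * κ * (3 * (5 ^ a * A ^ a * (pr.lam₀ * (k * logFactor pb.p A))) +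
        3 * (pb.L * pb.gap) / ε ^ 2 * (5 ^ a * A ^ a) * (pr.lam * (k * logFactor pb.p A))) := by
        gcongr
    _ = _ := by ring

end ZOProblem

end

/-! ### Assembly. -/

theorem theorem3 :
    -- absolute constants
    ∃ c₀ c₁ C_Q : ℝ, 0 < c₀ ∧ 0 < c₁ ∧ 0 < C_Q ∧
    ∀ p : ℝ, 1 < p → p ≤ 2 →
    -- constants that depend on `p` only
    ∃ C_U C_B C_G K C_p : ℝ, 0 < C_U ∧ 0 < C_B ∧ 0 < C_G ∧ 0 < K ∧ 0 < C_p ∧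
    ∀ (d : ℕ) (Ξ : Type*) [MeasurableSpace Ξ] (pb : ZOProblem d Ξ), pb.p = p → pb.Assumptions →
    ∀ pr : MomentumParams, pr.Valid →
    ∀ (Ω : Type*) [MeasurableSpace Ω] (Pr : Measure Ω) [IsProbabilityMeasure Pr]
      (s : Fin pr.M₀ ⊕ (ℕ × Fin pr.M) → Ω → EuclideanSpace ℝ (Fin d) × Ξ),
      pb.IsSampling pr Pr s →
    -- (1) localized convergence, for general stepsize and horizon
    (pr.BatchOK → 4 ≤ pr.T → 0 < pr.α → pr.α ≤ 1 / (4 * pb.L) →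
      pr.α ≤ (1 - pr.β) / (4 * Real.sqrt 3 * pr.β * pb.L) →
      5 * pr.α / 4 * pb.G pr C_G ^ 2 +
          2 * pr.α / (1 - pr.β) *
            (pr.β * ((1 + pb.L * pr.α) * pb.G pr C_G + pb.L * pr.α * pb.H pr.μ) +
              (1 - pr.β) * pb.B pr C_B) ^ 2 ≤ pb.gapBar pr.μ →
      (pr.T - 1) * pr.α * (pb.U pr C_U ^ 2 + 4 * pb.B pr C_B ^ 2) ≤ pb.gapBar pr.μ →
      1 - pr.δ ≤ Pr.real {ω |
        (∀ t, 1 ≤ t → t ≤ pr.T - 1 →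
          pb.f (pb.iterate pr s ω t) - pb.fStar ≤ 4 * pb.gapBar pr.μ) ∧
        pb.avgGradSq pr s ω ≤ 8 * pb.gapBar pr.μ / (pr.α * (pr.T - 2)) +
          4 * pb.U pr C_U ^ 2 + 16 * pb.B pr C_B ^ 2 + 2 * pb.L ^ 2 * pr.μ ^ 2}) ∧
    ∀ ε : ℝ, pb.Tuned pr ε →
      -- (2) convergence when the error levels are below the accuracy
      (pr.BatchOK → pb.G pr C_G ≤ c₀ * ε → pb.U pr C_U ≤ c₁ * ε → pb.B pr C_B ≤ c₁ * ε →
        1 - pr.δ ≤ Pr.real {ω | pb.avgGradSq pr s ω ≤ ε ^ 2}) ∧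
      -- (3) batch sizes of the stated order are enough
      (K * pb.batchScale₀ pr ε ≤ pr.M₀ → K * pb.batchScale pr ε ≤ pr.M →
        (pr.BatchOK ∧ pb.G pr C_G ≤ c₀ * ε ∧ pb.U pr C_U ≤ c₁ * ε ∧ pb.B pr C_B ≤ c₁ * ε) ∧
        1 - pr.δ ≤ Pr.real {ω | pb.avgGradSq pr s ω ≤ ε ^ 2}) ∧
      -- (4) number of stochastic function evaluations
      (∀ ω, (pb.state pr s ω (pr.T - 1)).queries = 2 * pr.M₀ + 2 * pr.M * (pr.T - 1)) ∧
      |pb.gapBar pr.μ - pb.gap| ≤ C_Q * (ε ^ 2 / (pb.L * d ^ 2)) ∧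
      |pb.R pr.μ - Real.sqrt d * (Real.sqrt (pb.L * pb.gap) + pb.σ)| ≤ C_Q * ε ∧
      ∀ κ : ℝ, (pr.M₀ : ℝ) ≤ κ * pb.batchScale₀ pr ε → (pr.M : ℝ) ≤ κ * pb.batchScale pr ε →
        (∀ ω, ((pb.state pr s ω (pr.T - 1)).queries : ℝ) ≤
          C_Q * κ *
            ((pb.R pr.μ / ε) ^ (p / (p - 1)) * (pr.lam₀ * logFactor p (pb.R pr.μ / ε)) +
              pb.L * pb.gapBar pr.μ / ε ^ 2 * (pb.R pr.μ / ε) ^ (p / (p - 1)) *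
                (pr.lam * logFactor p (pb.R pr.μ / ε)))) ∧
        (2 ≤ d ∨ ε ^ 2 ≤ 32 * pb.L * pb.gap →
          ∀ A : ℝ, A = Real.sqrt d * (Real.sqrt (pb.L * pb.gap) + pb.σ) / ε →
          ∀ ω, ((pb.state pr s ω (pr.T - 1)).queries : ℝ) ≤
            C_p * κ *
              (A ^ (p / (p - 1)) * (pr.lam₀ * logFactor p A) +
                pb.L * pb.gap / ε ^ 2 * A ^ (p / (p - 1)) *
                  (pr.lam * logFactor p A))) := by
  refine ⟨1 / 20, 1 / 20, 4096, by norm_num, by norm_num, by norm_num, fun p hp hp2 => ?_⟩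
  have hp1 : 0 < p - 1 := by linarith
  have hCB : 0 < 144 / (p - 1) := by positivity
  -- Deviation contributes `240` and clipping bias `144 / (p - 1)`. The warm-start error contains
  -- both, so their sum dominates `C_U`, `C_B` and `C_G` and one `K` serves all three.
  obtain ⟨K, hK0, hK⟩ := exists_batch_constant (C := 240 + 144 / (p - 1)) (c := 1 / 20) hp hp2
    (by positivity) (by norm_num)
  refine ⟨240, 144 / (p - 1), 240 + 144 / (p - 1), K,
    4096 * (3 * 5 ^ (p / (p - 1)) * 3 ^ (p / (2 * (p - 1)))), by norm_num, hCB, by positivity, hK0,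
    by positivity, ?_⟩
  intro d Ξ _ pb hpb h pr hv Ω _ Pr _ s hs
  subst hpb
  refine ⟨h.localized_convergence hv hs le_rfl le_rfl le_rfl, fun ε ht => ?_⟩
  have hconv := h.tuned_convergence hv hs ht (CU := 240) (CB := 144 / (pb.p - 1))
    (CG := 240 + 144 / (pb.p - 1)) le_rfl le_rfl le_rfl
  refine ⟨hconv, fun hM₀ hM => ?_, fun ω => ZOProblem.state_queries ω _, ?_, ?_, fun κ hM₀ hM => ?_⟩
  · have hlev := ht.error_levels_le h hv (CU := 240) (CB := 144 / (pb.p - 1))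
      (CG := 240 + 144 / (pb.p - 1)) (by linarith) hCB.le (by linarith) le_rfl hK hM₀ hM
    exact ⟨hlev, hconv hlev.1 hlev.2.1 hlev.2.2.1 hlev.2.2.2⟩
  · refine (ht.abs_gapBar_sub_gap_le h hv).trans (le_mul_of_one_le_left ?_ (by norm_num))
    have := h.L_pos
    positivity
  · refine (ht.abs_R_sub_le h hv).trans ?_
    linarith [ht.ε_pos]
  · exact ⟨ht.queries_le hv hM₀ hM, fun hd A hA => ht.queries_le_of_gap h hv hM₀ hM hd hA⟩
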